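/- Let $M$ be a smooth manifold (Hausdorff, $\sigma$-compact, without boundary) with a Poisson bivector field $\Pi$, local components $\pi^{ij}$, bracket $\{f,g\}=\Pi(df,dg)$, bundle map $\#:T^*M\to TM$, $\langle\beta,\#\alpha\rangle=\Pi(\alpha,\beta)$, and bracket of 1-forms $[\alpha,\beta]=\mathcal L_{\#\alpha}\beta-\mathcal L_{\#\beta}\alpha-d\Pi(\alpha,\beta)$. Summation over repeated indices is understood. A contravariant connection $\nabla^\bullet$ on $TM$ assigns to a 1-form $\alpha$ and a vector field $X$ a vector field $\nabla^\alpha X$, bilinearly, with $\nabla^{f\alpha}X=f\nabla^\alpha X$ and $\nabla^\alpha(fX)=f\nabla^\alpha X+(\#\alpha)(f)X$. It acts on 1-forms by $\langle\nabla^\alpha\beta,X\rangle=(\#\alpha)\langle\beta,X\rangle-\langle\beta,\nabla^\alpha X\rangle$, and its Christoffel symbols are given by $\nabla^{dx^i}\partial_k=\Gamma^{ij}_k\partial_j$. Let $(\nabla^\bullet,{}^\dagger\nabla^\bullet)$ be two contravariant connections which are associated, ${}^\dagger\nabla^\alpha\#\beta-\nabla^\beta\#\alpha-\#[\alpha,\beta]=0$,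 and such that ${}^\dagger\nabla^\bullet$ is torsion-free, ${}^\dagger\nabla^\alpha\beta-{}^\dagger\nabla^\beta\alpha=[\alpha,\beta]$. Let $Z$ be the zero section of $p:T^*M\to M$. Formal functions, $F\in C^\infty(T^*M,Z)$, are fibrewise formal power series $F=\sum_{k\ge0}F_k$, where $F_k$ is a smooth function on $T^*M$ that is a homogeneous polynomial of degree $k$ on every fibre (the Taylor series along $Z$ of smooth functions on $T^*M$); in coordinates these are the formal series $F(x,\xi)$ in the fibre coordinates $\xi_i$ with coefficients smooth in $x$. The connection $\nabla^\bullet$ induces derivations of $C^\infty(T^*M,Z)$, $$\bar\nabla^{\alpha}=\alpha_i\Big(\pi^{ij}\frac{\partial}{\partial x^j}+\Gamma^{ij}_k\xi_j\frac{\partial}{\partial\xi_k}\Big),$$ with curvature $R^{\bar\nabla}(\alpha,\beta)=[\bar\nabla^\alpha,\bar\nabla^\beta]-\bar\nabla^{[\alpha,\beta]}$, a vertical vector field. Let $\Omega=\frac12\pi^{ij}d\xi_i\wedge d\xi_j$ be the fibrewise presymplectic form, $\mathcal E=\xi_k\,\partial/\partial\xi_k$, and $\bar Q(\alpha,\beta)=\frac12\Omega(\mathcal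 E,R^{\bar\nabla}(\alpha,\beta))$. Let $\mathcal H_\Omega$ be the set of those $F\in C^\infty(T^*M,Z)$ for which there is a vertical formal vector field $H_F$ with $\iota(H_F)\Omega=-d_\xi F$, where $d_\xi$ is the fibrewise differential, with the bracket $\{F,G\}_\Omega=H_FG$ (which does not depend on the choice of $H_F$). Let $U$ be a global vertical 1-form on $(T^*M,Z)$, that is, $U=U^i(x,\xi)\,d\xi_i$ with formal $U^i$, and put $U(\alpha)=\alpha_iU^i$ for $\alpha=\alpha_i\,dx^i$. Suppose that $M$ is covered by coordinate charts on each of which there are formal functions $u_k(x,\xi)$ and $v^i_k(x,\xi)$ with $$\pi^{is}v^j_s=\pi^{js}\frac{\partial u_s}{\partial\xi_i},\qquad U(dx^i)=\pi^{ik}u_k,\qquad u_k=-\xi_k \ (\mathrm{mod}\ \xi^2),\qquad v^i_k=\delta^i_k\ (\mathrm{mod}\ \xi),$$ and that $U$ satisfies the Fundamental Equation: for all 1-forms $\alpha,\beta$ on $M$, $$\Pi(\alpha,\beta)=\bar Q(\alpha,\beta)-\bar\nabla^\alpha U(\beta)+\bar\nabla^\beta U(\alpha)+U([\alpha,\beta])+\{U(\alpha),U(\beta)\}_\Omega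 .$$ Then for every $f\in C^\infty(M)$ there is exactly one $F\in\mathcal H_\Omega$ such that $\bar\nabla^\alpha F=\{U(\alpha),F\}_\Omega$ for all 1-forms $\alpha$ on $M$ and $F|_Z=p^*f|_Z$. -/

import Mathlib

open Bundle FiberBundle VectorField Finset
open scoped Manifold ContDiff Topology

noncomputable section

namespace FormalLift

/-! ## Cotangent bundle, vector fields and 1-forms of an `n`-dimensional manifold -/

section Basic

variable (n : ℕ) {M : Type*} [TopologicalSpace M] [ChartedSpace (EuclideanSpace ℝ (Fin n)) M]

/-- The cotangent space `T*_x M`. -/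
abbrev CotangentSpace (x : M) : Type := TangentSpace (𝓡 n) x →L[ℝ] ℝ

variable (M) in
/-- The total space of the cotangent bundle, with elements `⟨x, ξ⟩`, `ξ ∈ T*_x M`. It carries
Mathlib's manifold structure of the bundle of linear maps from `TM` to the trivial line bundle. -/
abbrev CotangentBundle : Type _ :=
  TotalSpace (EuclideanSpace ℝ (Fin n) →L[ℝ] ℝ) (fun x : M => CotangentSpace n x)

variable (M) [IsManifold (𝓡 n) ∞ M]

/-- Smooth 1-forms on `M`. -/
abbrev OneForm : Type _ :=
  Cₛ^∞⟮𝓡 n; EuclideanSpace ℝ (Fin n) →L[ℝ] ℝ, (fun x : M => CotangentSpace n x)⟯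

/-- Smooth vector fields on `M`. -/
abbrev VField : Type _ :=
  Cₛ^∞⟮𝓡 n; EuclideanSpace ℝ (Fin n), (fun x : M => TangentSpace (𝓡 n) x)⟯

end Basic

variable {n : ℕ} {M : Type*} [TopologicalSpace M] [ChartedSpace (EuclideanSpace ℝ (Fin n)) M]

/-! ## Poisson manifolds -/

section Poisson

variable [IsManifold (𝓡 n) ∞ M]

/-- The bracket `{f, g} = Π(df, dg) = ⟨dg, #df⟩` of functions on `M`. -/
def functionBracket (sharp : ∀ x : M, CotangentSpace n x →L[ℝ] TangentSpace (𝓡 n) x)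
    (f g : M → ℝ) (x : M) : ℝ :=
  mvfderiv (𝓡 n) g x (sharp x (mvfderiv (𝓡 n) f x))

variable (n M) in
/-- A Poisson structure on `M`. A bivector field `Π` is the same as a skew-symmetric bundle map
`# : T*M → TM`, through `⟨β, #α⟩ = Π(α, β)`; here `#` is the field and `Π` is defined from it. -/
structure PoissonStructure where
  /-- the bundle map `#` -/
  sharp : ∀ x : M, CotangentSpace n x →L[ℝ] TangentSpace (𝓡 n) x
  contMDiff_sharp : ContMDiff (𝓡 n) ((𝓡 n).prod
      𝓘(ℝ, (EuclideanSpace ℝ (Fin n) →L[ℝ] ℝ) →L[ℝ] EuclideanSpace ℝ (Fin n))) ∞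
    (fun x => TotalSpace.mk'
      ((EuclideanSpace ℝ (Fin n) →L[ℝ] ℝ) →L[ℝ] EuclideanSpace ℝ (Fin n))
      (E := fun y : M => CotangentSpace n y →L[ℝ] TangentSpace (𝓡 n) y) x (sharp x))
  skew : ∀ (x : M) (a b : CotangentSpace n x), b (sharp x a) = - a (sharp x b)
  /-- the Jacobi identity on `C^∞(M)` -/
  jacobi : ∀ f g h : M → ℝ, ContMDiff (𝓡 n) 𝓘(ℝ, ℝ) ∞ f → ContMDiff (𝓡 n) 𝓘(ℝ, ℝ) ∞ g →
    ContMDiff (𝓡 n) 𝓘(ℝ, ℝ) ∞ h →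
    functionBracket sharp f (functionBracket sharp g h) +
      functionBracket sharp g (functionBracket sharp h f) +
      functionBracket sharp h (functionBracket sharp f g) = 0

namespace PoissonStructure

variable (P : PoissonStructure n M)

/-- The Poisson bivector field, `Π(α, β) = ⟨β, #α⟩`. -/
def biv (x : M) (a b : CotangentSpace n x) : ℝ := b (P.sharp x a)

/-- The vector field `#α`. -/
def sharpField (α : ∀ x : M, CotangentSpace n x) (x : M) : TangentSpace (𝓡 n) x :=
  P.sharp x (α x)

/-- The value at `x` of `L_{#α} β - L_{#β} α - dΠ(α, β)` on a vector field `X`. -/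
def bracketAux (α β : ∀ x : M, CotangentSpace n x) (X : ∀ x : M, TangentSpace (𝓡 n) x)
    (x : M) : ℝ :=
  (mvfderiv (𝓡 n) (fun y => β y (X y)) x (P.sharpField α x)
      - β x (mlieBracket (𝓡 n) (P.sharpField α) X x))
    - (mvfderiv (𝓡 n) (fun y => α y (X y)) x (P.sharpField β x)
      - α x (mlieBracket (𝓡 n) (P.sharpField β) X x))
    - mvfderiv (𝓡 n) (fun y => P.biv y (α y) (β y)) x (X x)

end PoissonStructure

/-- A (not necessarily smooth) 1-form is differentiable at `x`. -/
abbrev MDiffFormAt (β : ∀ x : M, CotangentSpace n x) (x : M) : Prop :=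
  MDifferentiableAt (𝓡 n) ((𝓡 n).prod 𝓘(ℝ, EuclideanSpace ℝ (Fin n) →L[ℝ] ℝ))
    (fun y => (⟨y, β y⟩ : CotangentBundle n M)) x

/-- A (not necessarily smooth) vector field is differentiable at `x`. -/
abbrev MDiffFieldAt (X : ∀ x : M, TangentSpace (𝓡 n) x) (x : M) : Prop :=
  MDifferentiableAt (𝓡 n) ((𝓡 n).prod 𝓘(ℝ, EuclideanSpace ℝ (Fin n)))
    (fun y => (⟨y, X y⟩ : TotalSpace (EuclideanSpace ℝ (Fin n))
      (fun x : M => TangentSpace (𝓡 n) x))) x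

theorem mdiffAt_pair {β : ∀ x : M, CotangentSpace n x} {X : ∀ x : M, TangentSpace (𝓡 n) x} {x : M}
    (hβ : MDiffFormAt β x) (hX : MDiffFieldAt X x) :
    MDifferentiableAt (𝓡 n) 𝓘(ℝ, ℝ) (fun y => β y (X y)) x := by
  have h : MDifferentiableAt (𝓡 n) ((𝓡 n).prod 𝓘(ℝ, ℝ))
      (fun y => TotalSpace.mk' ℝ (E := Bundle.Trivial M ℝ) y (β y (X y))) x :=
    MDifferentiableAt.clm_bundle_apply (F₁ := EuclideanSpace ℝ (Fin n)) (F₂ := ℝ)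
      (E₁ := fun y : M => TangentSpace (𝓡 n) y) (E₂ := Bundle.Trivial M ℝ) hβ hX
  rw [mdifferentiableAt_totalSpace] at h
  simpa using! h.2

theorem bracket_tensorial (P : PoissonStructure n M) {α β : ∀ x : M, CotangentSpace n x} {x : M}
    (hα : MDiffFormAt α x) (hβ : MDiffFormAt β x) :
    TensorialAt (𝓡 n) (EuclideanSpace ℝ (Fin n)) (fun X => P.bracketAux α β X x) x where
  smul := by
    intro f X hf hX
    have h1 := mvfderiv_fun_mul hf (mdiffAt_pair hβ hX)
    have h2 := mvfderiv_fun_mul hf (mdiffAt_pair hα hX)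
    simp only [PoissonStructure.bracketAux, Pi.smul_apply', map_smul, smul_eq_mul, h1, h2,
      mlieBracket_smul_right hf hX, map_add, add_apply, smul_apply]
    ring
  add := by
    intro X Y hX hY
    have h1 := mvfderiv_fun_add (mdiffAt_pair hβ hX) (mdiffAt_pair hβ hY)
    have h2 := mvfderiv_fun_add (mdiffAt_pair hα hX) (mdiffAt_pair hα hY)
    simp only [PoissonStructure.bracketAux, Pi.add_apply, map_add, h1, h2,
      mlieBracket_add_right hX hY, add_apply]
    ring

theorem OneForm.mdiffFormAt (α : OneForm n M) (x : M) : MDiffFormAt (fun y => α y) x :=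
  α.contMDiff.mdifferentiable (by simp) x

/-- The Lie bracket `[α, β] = L_{#α} β - L_{#β} α - dΠ(α, β)` of 1-forms: the 1-form whose value
on every vector field `X` is `P.bracketAux α β X` (an expression tensorial in `X`). -/
def PoissonStructure.bracket (P : PoissonStructure n M) (α β : OneForm n M) (x : M) :
    CotangentSpace n x :=
  TensorialAt.mkHom (fun X => P.bracketAux (fun y => α y) (fun y => β y) X x) x
    (bracket_tensorial P (α.mdiffFormAt x) (β.mdiffFormAt x))

/-! ## Linear contravariant connections -/

/-- A smooth contravariant connection `∇` on `TM` over a Poisson manifold. As in Mathlib's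
covariant derivatives, `nabla X x a` is the value at `x` of `∇^α X` for any 1-form `α` with
`α_x = a`, so that `∇^{fα} X = f ∇^α X` is part of the type, the remaining axioms are required
for vector fields differentiable at a point, and values on other fields are irrelevant. -/
structure ContravariantConnection (P : PoissonStructure n M) where
  nabla : (∀ x : M, TangentSpace (𝓡 n) x) →
    ∀ x : M, CotangentSpace n x →L[ℝ] TangentSpace (𝓡 n) x
  nabla_add : ∀ {X Y : ∀ x : M, TangentSpace (𝓡 n) x} {x : M},
    MDiffFieldAt X x → MDiffFieldAt Y x → nabla (X + Y) x = nabla X x + nabla Y x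
  /-- `∇^α (f X) = f ∇^α X + (#α)(f) X` -/
  leibniz : ∀ {f : M → ℝ} {X : ∀ x : M, TangentSpace (𝓡 n) x} {x : M},
    MDifferentiableAt (𝓡 n) 𝓘(ℝ, ℝ) f x → MDiffFieldAt X x → ∀ a : CotangentSpace n x,
      nabla (f • X) x a = f x • nabla X x a + mvfderiv (𝓡 n) f x (P.sharp x a) • X x
  smooth : ∀ (X : VField n M) (α : OneForm n M),
    ContMDiff (𝓡 n) ((𝓡 n).prod 𝓘(ℝ, EuclideanSpace ℝ (Fin n))) ∞
      (fun x => (⟨x, nabla (fun y => X y) x (α x)⟩ : TotalSpace (EuclideanSpace ℝ (Fin n))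
        (fun x : M => TangentSpace (𝓡 n) x)))

namespace ContravariantConnection

variable {P : PoissonStructure n M} (D : ContravariantConnection P)

theorem dual_tensorial {β : ∀ x : M, CotangentSpace n x} {x : M} (hβ : MDiffFormAt β x)
    (a : CotangentSpace n x) :
    TensorialAt (𝓡 n) (EuclideanSpace ℝ (Fin n))
      (fun X => mvfderiv (𝓡 n) (fun y => β y (X y)) x (P.sharp x a) - β x (D.nabla X x a)) x where
  smul := by
    intro f X hf hX
    have h1 := mvfderiv_fun_mul hf (mdiffAt_pair hβ hX)
    simp only [Pi.smul_apply', map_smul, smul_eq_mul, h1, D.leibniz hf hX, map_add, add_apply,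
      smul_apply]
    ring
  add := by
    intro X Y hX hY
    have h1 := mvfderiv_fun_add (mdiffAt_pair hβ hX) (mdiffAt_pair hβ hY)
    simp only [Pi.add_apply, map_add, h1, D.nabla_add hX hY, add_apply]
    ring

/-- The value at `x`, in the direction `a = α_x`, of the contravariant derivative `∇^α β` of a
1-form `β` for the connection on `T*M` that corresponds to `∇`:
`⟨∇^α β, X⟩ = (#α)⟨β, X⟩ - ⟨β, ∇^α X⟩` for every vector field `X`. -/
def dual {β : ∀ x : M, CotangentSpace n x} {x : M} (hβ : MDiffFormAt β x)
    (a : CotangentSpace n x) : CotangentSpace n x :=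
  TensorialAt.mkHom
    (fun X => mvfderiv (𝓡 n) (fun y => β y (X y)) x (P.sharp x a) - β x (D.nabla X x a)) x
    (D.dual_tensorial hβ a)

/-- The torsion `T(α, β) = ∇^α β - ∇^β α - [α, β]` vanishes. -/
def TorsionFree : Prop :=
  ∀ (α β : OneForm n M) (x : M),
    D.dual (β.mdiffFormAt x) (α x) - D.dual (α.mdiffFormAt x) (β x) - P.bracket α β x = 0

/-- The pair `(∇, ∇†)` is associated: `∇†^α #β - ∇^β #α - #[α, β] = 0`. -/
def Associated (D D' : ContravariantConnection P) : Prop :=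
  ∀ (α β : OneForm n M) (x : M),
    D'.nabla (P.sharpField (fun y => β y)) x (α x) - D.nabla (P.sharpField (fun y => α y)) x (β x)
      - P.sharp x (P.bracket α β x) = 0

end ContravariantConnection

/-! ## Formal functions, vertical vector fields and vertical 1-forms on `(T*M, Z)`

A formal function on the formal neighbourhood of the zero section is a fibrewise formal power
series `∑ₖ Fₖ`, where `Fₖ` is a smooth function which is a homogeneous polynomial of degree `k` on
every fibre. A smooth function `g` on a vector space is a homogeneous polynomial of degree `k` if
and only if `g (t ξ) = t ^ k g (ξ)` for all real `t`. A series is recorded by the sequence of its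
homogeneous components. -/

/-- The series `∑ₖ F k` is a formal function on `(T*W, Z)`, for an open `W ⊆ M` (the values of
`F k` outside `T*W` play no role). -/
def IsFormalOn (W : Set M) (F : ℕ → CotangentBundle n M → ℝ) : Prop :=
  ∀ k, ContMDiffOn ((𝓡 n).prod 𝓘(ℝ, EuclideanSpace ℝ (Fin n) →L[ℝ] ℝ)) 𝓘(ℝ, ℝ) ∞ (F k)
      {p | p.1 ∈ W} ∧
    ∀ x ∈ W, ∀ (ξ : CotangentSpace n x) (t : ℝ), F k ⟨x, t • ξ⟩ = t ^ k * F k ⟨x, ξ⟩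

/-- The derivative of a function on `T*M` at `p` in the fibre direction `η`; in coordinates
`η_i ∂g/∂ξ_i`. -/
def fibreDeriv (g : CotangentBundle n M → ℝ) (p : CotangentBundle n M)
    (η : CotangentSpace n p.1) : ℝ :=
  lineDeriv ℝ (fun ζ : CotangentSpace n p.1 => g ⟨p.1, ζ⟩) p.2 η

/-- A vertical formal vector field `∑ₖ H k` on `(T*M, Z)`. A vertical tangent vector at
`p = (x, ξ)` is an element of `T*_x M`; in coordinates `H = a_i ∂/∂ξ_i` is `a_i dx^i`, where the
`a_i` are formal functions, whose components of degree `k` form `H k`. -/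
def IsVerticalField (H : ℕ → ∀ p : CotangentBundle n M, CotangentSpace n p.1) : Prop :=
  ∀ X : VField n M, IsFormalOn Set.univ (fun k p => H k p (X p.1))

/-- A vertical 1-form `∑ₖ U k` on `(T*M, Z)`: a 1-form along the fibres whose value `U(α)` on (the
vertical vector field `α_i ∂/∂ξ_i` of) every 1-form `α` of `M` is a formal function. -/
def IsVerticalOneForm (U : ℕ → ∀ p : CotangentBundle n M, CotangentSpace n p.1 →ₗ[ℝ] ℝ) : Prop :=
  ∀ α : OneForm n M, IsFormalOn Set.univ (fun k p => U k p (α p.1))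

/-- The formal function `U(α) = ⟨U, α_i ∂/∂ξ_i⟩`. -/
def evalForm (U : ℕ → ∀ p : CotangentBundle n M, CotangentSpace n p.1 →ₗ[ℝ] ℝ)
    (α : ∀ x : M, CotangentSpace n x) (k : ℕ) (p : CotangentBundle n M) : ℝ :=
  U k p (α p.1)

/-- The action `H F` of a vertical formal vector field on a formal function. -/
def verticalAct (H : ℕ → ∀ p : CotangentBundle n M, CotangentSpace n p.1)
    (F : ℕ → CotangentBundle n M → ℝ) (k : ℕ) (p : CotangentBundle n M) : ℝ :=
  ∑ ij ∈ antidiagonal k, fibreDeriv (F (ij.2 + 1)) p (H ij.1 p)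

/-- The formal function `p*f` for a function `f` on `M`. -/
def pullback (f : M → ℝ) (k : ℕ) (p : CotangentBundle n M) : ℝ :=
  if k = 0 then f p.1 else 0

/-! ## The fibrewise presymplectic form -/

/-- `Ω(H, K)`, where `Ω = ½ π^{ij} dξ_i ∧ dξ_j`: if `H = a_i ∂/∂ξ_i` and `K = b_j ∂/∂ξ_j`, this is
the formal function `π^{ij} a_i b_j`. -/
def omega (P : PoissonStructure n M) (H K : ℕ → ∀ p : CotangentBundle n M, CotangentSpace n p.1)
    (k : ℕ) (p : CotangentBundle n M) : ℝ :=
  ∑ ij ∈ antidiagonal k, P.biv p.1 (H ij.1 p) (K ij.2 p)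

/-- `H` is a Hamiltonian vector field of `F`: `ι(H) Ω = - d_ξ F`. -/
def IsHamiltonianField (P : PoissonStructure n M) (F : ℕ → CotangentBundle n M → ℝ)
    (H : ℕ → ∀ p : CotangentBundle n M, CotangentSpace n p.1) : Prop :=
  IsVerticalField H ∧ ∀ (k : ℕ) (p : CotangentBundle n M) (η : CotangentSpace n p.1),
    P.biv p.1 (H k p) η = - fibreDeriv (F (k + 1)) p η

/-- The space `H_Ω` of Hamiltonian functions of `Ω`. -/
def IsHamiltonian (P : PoissonStructure n M) (F : ℕ → CotangentBundle n M → ℝ) : Prop :=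
  IsFormalOn Set.univ F ∧ ∃ H, IsHamiltonianField P F H

open Classical in
/-- A Hamiltonian vector field `H_F` of `F ∈ H_Ω`. -/
def hamiltonianField (P : PoissonStructure n M) (F : ℕ → CotangentBundle n M → ℝ) :
    ℕ → ∀ p : CotangentBundle n M, CotangentSpace n p.1 :=
  if h : ∃ H, IsHamiltonianField P F H then h.choose else fun _ _ => 0

/-- The bracket `{F, G}_Ω = H_F G` of `F, G ∈ H_Ω`; it does not depend on the choice of `H_F`. -/
def omegaBracket (P : PoissonStructure n M) (F G : ℕ → CotangentBundle n M → ℝ) :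
    ℕ → CotangentBundle n M → ℝ :=
  verticalAct (hamiltonianField P F) G

/-! ## The connection induced on `(T*M, Z)` -/

theorem mdiffFormAt_extend {x : M} (ξ : CotangentSpace n x) :
    MDiffFormAt (fun y => extend (EuclideanSpace ℝ (Fin n) →L[ℝ] ℝ)
      (E := fun y : M => CotangentSpace n y) ξ y) x :=
  mdifferentiableAt_extend (𝓡 n) (EuclideanSpace ℝ (Fin n) →L[ℝ] ℝ)
    (V := fun y : M => CotangentSpace n y) ξ

namespace ContravariantConnection

variable {P : PoissonStructure n M} (D : ContravariantConnection P)

/-- The vector field on `T*M` (of degree zero) induced by `∇^α`, acting on functions on `T*M`.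
At `(x, ξ)`, for any 1-form `β` near `x` with `β_x = ξ`,
`(∇^α g)(x, ξ) = (#α)(g ∘ β)(x) - d_ξ g(x, ξ)(∇^α β)`.
If `β` has constant coefficients in local coordinates this reads
`α_i (π^{ij} ∂g/∂x^j + Γ^{ij}_k ξ_j ∂g/∂ξ_k)`, where `∇^{dx^i} ∂_k = Γ^{ij}_k ∂_j`. The definition
uses the 1-form `extend ξ`, which has constant coefficients in the preferred chart at `x`. -/
def bar (α : ∀ x : M, CotangentSpace n x) (g : CotangentBundle n M → ℝ)
    (p : CotangentBundle n M) : ℝ :=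
  mvfderiv (𝓡 n) (fun y => g ⟨y, extend (EuclideanSpace ℝ (Fin n) →L[ℝ] ℝ)
      (E := fun y : M => CotangentSpace n y) p.2 y⟩) p.1 (P.sharp p.1 (α p.1))
    - fibreDeriv g p (D.dual (mdiffFormAt_extend p.2) (α p.1))

/-- The curvature `R(α, β) = [∇^α, ∇^β] - ∇^{[α, β]}` of the induced connection on `T*M`, acting
on functions on `T*M`. -/
def barCurvature (α β : OneForm n M) (g : CotangentBundle n M → ℝ) (p : CotangentBundle n M) : ℝ :=
  D.bar (fun y => α y) (D.bar (fun y => β y) g) p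
    - D.bar (fun y => β y) (D.bar (fun y => α y) g) p - D.bar (P.bracket α β) g p

/-- The vertical vector field `R(α, β) = R_k ∂/∂ξ_k`. Its coefficient `R_k` at `(x, ξ)` is obtained
by applying `R(α, β)` to the fibre coordinate `ξ_k` of the preferred chart at `x`, that is, to the
fibrewise linear function given by the coordinate vector field `∂_k`. It has degree one. -/
def barCurvatureField (α β : OneForm n M) (k : ℕ) (p : CotangentBundle n M) :
    CotangentSpace n p.1 :=
  if k = 1 then
    ∑ j : Fin n, D.barCurvature α β
        (fun q => q.2 (extend (EuclideanSpace ℝ (Fin n))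
          (E := fun y : M => TangentSpace (𝓡 n) y) (x := p.1) (EuclideanSpace.single j (1 : ℝ)) q.1))
        p • (EuclideanSpace.proj j : EuclideanSpace ℝ (Fin n) →L[ℝ] ℝ)
  else 0

end ContravariantConnection

/-- The fibrewise Euler vector field `ξ_k ∂/∂ξ_k`. -/
def eulerField (k : ℕ) (p : CotangentBundle n M) : CotangentSpace n p.1 :=
  if k = 1 then p.2 else 0

/-- `Q(α, β) = ½ Ω(E, R(α, β))`, where `E` is the Euler vector field and `R` is the curvature of
the connection on `(T*M, Z)` induced by `∇`. -/
def barQ {P : PoissonStructure n M} (D : ContravariantConnection P) (α β : OneForm n M) (k : ℕ)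
    (p : CotangentBundle n M) : ℝ :=
  1 / 2 * omega P eulerField (D.barCurvatureField α β) k p

/-! ## The hypotheses on `U` -/

/-- The coordinate 1-form `dx^i` of a chart. -/
def coordForm (φ : OpenPartialHomeomorph M (EuclideanSpace ℝ (Fin n))) (i : Fin n) (x : M) :
    CotangentSpace n x :=
  mvfderiv (𝓡 n) (fun y => φ y i) x

/-- The formal functions `u k = u_k` and `v i k = v^i_k` on the domain of the chart `φ` are local
potentials of `U`. -/
structure IsLocalPotential (P : PoissonStructure n M)
    (U : ℕ → ∀ p : CotangentBundle n M, CotangentSpace n p.1 →ₗ[ℝ] ℝ)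
    (φ : OpenPartialHomeomorph M (EuclideanSpace ℝ (Fin n)))
    (u : Fin n → ℕ → CotangentBundle n M → ℝ)
    (v : Fin n → Fin n → ℕ → CotangentBundle n M → ℝ) : Prop where
  formal_u : ∀ k, IsFormalOn φ.source (u k)
  formal_v : ∀ i k, IsFormalOn φ.source (v i k)
  /-- `π^{is} v^j_s = π^{js} ∂u_s/∂ξ_i` -/
  compatible : ∀ i j, ∀ x ∈ φ.source, ∀ (ξ : CotangentSpace n x) (d : ℕ),
    ∑ s, P.biv x (coordForm φ i x) (coordForm φ s x) * v j s d ⟨x, ξ⟩ =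
      ∑ s, P.biv x (coordForm φ j x) (coordForm φ s x) *
        fibreDeriv (u s (d + 1)) ⟨x, ξ⟩ (coordForm φ i x)
  /-- `U(dx^i) = π^{ik} u_k` -/
  potential : ∀ i, ∀ x ∈ φ.source, ∀ (ξ : CotangentSpace n x) (d : ℕ),
    U d ⟨x, ξ⟩ (coordForm φ i x) =
      ∑ k, P.biv x (coordForm φ i x) (coordForm φ k x) * u k d ⟨x, ξ⟩
  /-- `u_k = -ξ_k` modulo terms of degree at least two in `ξ`; here `ξ = ξ_i dx^i` -/
  u_zero : ∀ k, ∀ x ∈ φ.source, ∀ ξ : CotangentSpace n x, u k 0 ⟨x, ξ⟩ = 0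
  u_one : ∀ k, ∀ x ∈ φ.source, ∀ c : Fin n → ℝ,
    u k 1 ⟨x, ∑ i, c i • coordForm φ i x⟩ = - c k
  /-- `v^i_k = δ^i_k` modulo terms of positive degree in `ξ` -/
  v_zero : ∀ i k, ∀ x ∈ φ.source, ∀ ξ : CotangentSpace n x,
    v i k 0 ⟨x, ξ⟩ = if i = k then 1 else 0

/-- `U` has local potentials on a covering of `M` by coordinate charts. -/
def HasLocalPotentials (P : PoissonStructure n M)
    (U : ℕ → ∀ p : CotangentBundle n M, CotangentSpace n p.1 →ₗ[ℝ] ℝ) : Prop :=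
  ∀ x : M, ∃ φ ∈ IsManifold.maximalAtlas (𝓡 n) ∞ M, x ∈ φ.source ∧
    ∃ u v, IsLocalPotential P U φ u v

/-- The Fundamental Equation
`Π(α, β) = Q(α, β) - ∇^α U(β) + ∇^β U(α) + U([α, β]) + {U(α), U(β)}_Ω`. -/
def FundamentalEquation {P : PoissonStructure n M} (D : ContravariantConnection P)
    (U : ℕ → ∀ p : CotangentBundle n M, CotangentSpace n p.1 →ₗ[ℝ] ℝ) : Prop :=
  ∀ (α β : OneForm n M) (k : ℕ) (p : CotangentBundle n M),
    pullback (fun x => P.biv x (α x) (β x)) k p =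
      barQ D α β k p
        - D.bar (fun y => α y) (evalForm U (fun y => β y) k) p
        + D.bar (fun y => β y) (evalForm U (fun y => α y) k) p
        + evalForm U (P.bracket α β) k p
        + omegaBracket P (evalForm U (fun y => α y)) (evalForm U (fun y => β y)) k p

end Poisson

end FormalLift

end

open Bundle FiberBundle VectorField Finset
open scoped Manifold ContDiff Topology

noncomputable section

namespace FormalLift

section

/-! ## Flatness of the twisted connection: algebra of derivations -/

section Flatness

variable {A : Type*} [CommRing A] [Algebra ℝ A] {n : ℕ} {ι : Type*} [Fintype ι]

/-! In a chart, the compatibility of `u` and `v` says that `v^i` is a Hamiltonian field of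
`U(dx^i)`, so the lifting equation reads `∇^i F = v^i_s ∂F/∂ξ_s`. Since `v^i_s` starts with `δ^i_s`,
the part of degree `k` prescribes the fibre gradient of the next component: `∂F_{k+1}/∂ξ_i = r_i`,
where `r_i` (`residue`) involves only `F_0, …, F_k`. Euler's identity leaves the single candidate
`F_{k+1} = (k+1)⁻¹ ξ_i r_i`; this is uniqueness (`SolvesAt.unique`). For existence, `r_i` must lie
in the image of `π`, so that `F` is Hamiltonian, and must be closed along the fibres.

Image of `π`: inductively `∂F_{j+1}/∂ξ_s = π^{sl} H_{j,l}` for `j < k`. Association, in the form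
`Γ^{ij}_k π^{lk} = π^{ik} Γ'^{lj}_k`, and the compatibility of `u` and `v` move `π` to the front,
which gives `r_i = π^{im} H_{k,m}` with an explicit `H_k` (`residue_eq`).

Closedness comes from the flatness of the twisted connection `∇^i - v^i_s ∂/∂ξ_s` on Hamiltonian
functions (`twist_flat`). Its curvature is a vertical field `C`. Association and torsion-freeness
make `π` parallel for `∇`, so `∇` and brackets carry Hamiltonian pairs to Hamiltonian pairs
(`IsPair.nab`, `IsPair.vert`), and the curvature of `∇` is a Hamiltonian field of `Q` (`dξ_quad`).
The fibre differential of the Fundamental Equation therefore says `π C = 0`. For degenerate `π` this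
does not force `C = 0`, but `C` kills every Hamiltonian function, because its fibre gradient lies in
the image of `π`. Applied to `F` truncated at degree `k`, flatness has as lowest surviving term
`∂r_j/∂ξ_i = ∂r_i/∂ξ_j` (`dξ_residue_symm`).

The algebra is carried out in an abstract ring with coordinate derivations; power series in one
variable record the degree along the fibres. The ring of smooth functions on a cotangent chart is
then shown to be an instance. Local lifts agree on overlaps by uniqueness, so they define a global
`F`. Their Hamiltonian fields are determined only modulo the kernel of `π` and are glued by a
partition of unity (`exists_isHamiltonianField`). -/

/-- The derivation `∑ₛ vₛ δₛ`. -/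
def combination (δ : ι → Derivation ℝ A A) (v : ι → A) : Derivation ℝ A A :=
  ∑ s, v s • δ s

theorem combination_apply (δ : ι → Derivation ℝ A A) (v : ι → A) (g : A) :
    combination δ v g = ∑ s, v s * δ s g := by
  rw [combination, ← Derivation.coeFnAddMonoidHom_apply, map_sum, Finset.sum_apply]
  rfl

/-- The commutator of two derivations in the span of a commuting family. -/
theorem combination_commutator {δ : ι → Derivation ℝ A A}
    (hδ : ∀ i j g, δ i (δ j g) = δ j (δ i g)) (v w : ι → A) (g : A) :
    combination δ v (combination δ w g) - combination δ w (combination δ v g) =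
      combination δ (fun s => combination δ v (w s) - combination δ w (v s)) g := by
  simp only [combination_apply, map_sum, Derivation.leibniz, smul_eq_mul, sub_mul,
    Finset.sum_sub_distrib, Finset.mul_sum, Finset.sum_mul, Finset.sum_add_distrib]
  have h1 : ∑ x, ∑ y, w x * (v y * δ y (δ x g)) = ∑ x, ∑ y, v x * (w y * δ y (δ x g)) := by
    rw [Finset.sum_comm]
    refine Finset.sum_congr rfl fun s _ => Finset.sum_congr rfl fun k _ => ?_
    rw [hδ]; ring
  rw [h1, add_sub_add_left_eq_sub]
  congr 1 <;> exact Finset.sum_congr rfl fun s _ => Finset.sum_congr rfl fun k _ => by ring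

/-- Coefficients of a Poisson bivector and of a contravariant connection in a ring with coordinate
derivations `dx`, `dξ` and fibre coordinates `ξ`. -/
structure ConnectionAlgebra (n : ℕ) (A : Type*) [CommRing A] [Algebra ℝ A] where
  dx : Fin n → Derivation ℝ A A
  dξ : Fin n → Derivation ℝ A A
  ξ : Fin n → A
  biv : Fin n → Fin n → A
  Γ : Fin n → Fin n → Fin n → A
  dx_dx : ∀ i j g, dx i (dx j g) = dx j (dx i g)
  dx_dξ : ∀ i j g, dx i (dξ j g) = dξ j (dx i g)
  dξ_dξ : ∀ i j g, dξ i (dξ j g) = dξ j (dξ i g)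
  dx_ξ : ∀ i j, dx i (ξ j) = 0
  dξ_ξ : ∀ i j, dξ i (ξ j) = if i = j then 1 else 0
  dξ_biv : ∀ a i j, dξ a (biv i j) = 0
  dξ_Γ : ∀ a i j k, dξ a (Γ i j k) = 0
  skew : ∀ i j, biv i j = - biv j i
  jacobi : ∀ l i j, ∑ m, biv l m * dx m (biv i j) + ∑ m, biv i m * dx m (biv j l)
    + ∑ m, biv j m * dx m (biv l i) = 0
  parallel : ∀ i a s, ∑ m, biv i m * dx m (biv a s) =
    ∑ k, biv s k * Γ i a k - ∑ k, biv a k * Γ i s k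

namespace ConnectionAlgebra

variable (K : ConnectionAlgebra n A)

/-- The coefficient `Γ^{ij}_k ξ_j`. -/
def fibreCoeff (i k : Fin n) : A := ∑ j, K.Γ i j k * K.ξ j

/-- The derivation `π^{ij} ∂/∂x^j + Γ^{ij}_k ξ_j ∂/∂ξ_k`. -/
def nab (i : Fin n) : Derivation ℝ A A :=
  combination (Sum.elim K.dx K.dξ) (Sum.elim (K.biv i) (K.fibreCoeff i))

/-- The derivation `vₛ ∂/∂ξₛ`. -/
abbrev vert (v : Fin n → A) : Derivation ℝ A A := combination K.dξ v

theorem nab_apply (i : Fin n) (g : A) :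
    K.nab i g = ∑ j, K.biv i j * K.dx j g + ∑ k, K.fibreCoeff i k * K.dξ k g := by
  simp [nab, combination_apply]

theorem dξ_fibreCoeff (a i k : Fin n) : K.dξ a (K.fibreCoeff i k) = K.Γ i a k := by
  simp [fibreCoeff, map_sum, Derivation.leibniz, K.dξ_Γ, K.dξ_ξ]

theorem nab_ξ (i k : Fin n) : K.nab i (K.ξ k) = K.fibreCoeff i k := by
  simp [nab_apply, K.dx_ξ, K.dξ_ξ]

theorem dξ_nab (a i : Fin n) (g : A) :
    K.dξ a (K.nab i g) = K.nab i (K.dξ a g) + ∑ k, K.Γ i a k * K.dξ k g := by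
  simp only [nab_apply, map_add, map_sum, Derivation.leibniz, smul_eq_mul, K.dξ_biv,
    dξ_fibreCoeff, mul_zero, add_zero, Finset.sum_add_distrib, K.dx_dξ, K.dξ_dξ a]
  simp only [mul_comm, add_assoc]

theorem nab_of_vertical_const (i : Fin n) {g : A} (hg : ∀ a, K.dξ a g = 0) :
    K.nab i g = ∑ j, K.biv i j * K.dx j g := by
  simp [nab_apply, hg]

theorem dξ_dx_eq_zero (k : Fin n) {g : A} (hg : ∀ a, K.dξ a g = 0) (a : Fin n) :
    K.dξ a (K.dx k g) = 0 := by
  rw [← K.dx_dξ, hg, map_zero]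

/-- The coefficient `R_s` of the curvature of the connection. -/
def curv (i j s : Fin n) : A :=
  K.nab i (K.fibreCoeff j s) - K.nab j (K.fibreCoeff i s)
    - ∑ k, K.dx k (K.biv i j) * K.fibreCoeff k s

/-- The vertical part of `nab i` is linear in `ξ` with matrix `Γ^i`. The commutator with a vertical
field is thus the vertical field of the covariant derivative of `v`, seen as a covector field. -/
theorem nab_vert (i : Fin n) (v : Fin n → A) (g : A) :
    K.nab i (K.vert v g) - K.vert v (K.nab i g) =
      K.vert (fun s => K.nab i (v s) - ∑ j, K.Γ i j s * v j) g := by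
  simp only [combination_apply, map_sum, Derivation.leibniz, dξ_nab, smul_eq_mul, sub_mul,
    Finset.sum_sub_distrib, Finset.sum_mul, mul_add, Finset.sum_add_distrib, Finset.mul_sum]
  rw [add_sub_add_left_eq_sub, Finset.sum_comm (f := fun x j => K.Γ i j x * v j * K.dξ x g)]
  congr 1
  · exact Finset.sum_congr rfl fun s _ => by ring
  · exact Finset.sum_congr rfl fun s _ => Finset.sum_congr rfl fun k _ => by ring

theorem vert_vert (v w : Fin n → A) (g : A) :
    K.vert v (K.vert w g) - K.vert w (K.vert v g) =
      K.vert (fun s => K.vert v (w s) - K.vert w (v s)) g :=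
  combination_commutator K.dξ_dξ v w g

/-- The Jacobi identity in the form `#[dx^i, dx^j] = [#dx^i, #dx^j]`, with `[dx^i, dx^j] = dπ^{ij}`.
-/
theorem sum_dx_biv_mul (i j l : Fin n) :
    ∑ k, K.dx k (K.biv i j) * K.biv k l =
      ∑ m, K.biv i m * K.dx m (K.biv j l) - ∑ m, K.biv j m * K.dx m (K.biv i l) := by
  have h := K.jacobi l i j
  have h1 : ∑ k, K.dx k (K.biv i j) * K.biv k l = - ∑ m, K.biv l m * K.dx m (K.biv i j) := by
    rw [← Finset.sum_neg_distrib]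
    refine Finset.sum_congr rfl fun m _ => ?_
    rw [K.skew l m]; ring
  have h2 : ∑ m, K.biv j m * K.dx m (K.biv l i) = - ∑ m, K.biv j m * K.dx m (K.biv i l) := by
    rw [← Finset.sum_neg_distrib]
    refine Finset.sum_congr rfl fun m _ => ?_
    rw [K.skew l i, map_neg]; ring
  rw [h1]
  rw [h2] at h
  linear_combination -h

/-- The base parts of the commutator close up by the Jacobi identity into `∇` along `dπ^{ij}`. What
is left is vertical, and is the curvature. -/
theorem nab_nab (i j : Fin n) (g : A) :
    K.nab i (K.nab j g) - K.nab j (K.nab i g) =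
      ∑ k, K.dx k (K.biv i j) * K.nab k g + K.vert (K.curv i j) g := by
  have hδ : ∀ a b g, (Sum.elim K.dx K.dξ a) (Sum.elim K.dx K.dξ b g) =
      (Sum.elim K.dx K.dξ b) (Sum.elim K.dx K.dξ a g) := by
    rintro (a | a) (b | b) g
    · exact K.dx_dx a b g
    · exact K.dx_dξ a b g
    · exact (K.dx_dξ b a g).symm
    · exact K.dξ_dξ a b g
  have h := combination_commutator hδ (Sum.elim (K.biv i) (K.fibreCoeff i))
    (Sum.elim (K.biv j) (K.fibreCoeff j)) g
  change K.nab i (K.nab j g) - K.nab j (K.nab i g) =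
    combination _ (fun s => K.nab i _ - K.nab j _) g at h
  rw [h]
  simp only [combination_apply, Fintype.sum_sum_type, Sum.elim_inl, Sum.elim_inr, K.nab_apply _ g,
    curv]
  have h1 : ∀ l, K.nab i (K.biv j l) - K.nab j (K.biv i l) =
      ∑ k, K.dx k (K.biv i j) * K.biv k l := by
    intro l
    rw [K.sum_dx_biv_mul, K.nab_of_vertical_const i (fun a => K.dξ_biv a j l),
      K.nab_of_vertical_const j (fun a => K.dξ_biv a i l)]
  have e1 : ∑ k, K.dx k (K.biv i j) * ∑ l, K.biv k l * K.dx l g =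
      ∑ l, (∑ k, K.dx k (K.biv i j) * K.biv k l) * K.dx l g := by
    simp only [Finset.mul_sum, Finset.sum_mul]
    rw [Finset.sum_comm]
    exact Finset.sum_congr rfl fun s _ => Finset.sum_congr rfl fun k _ => by ring
  have e2 : ∑ k, K.dx k (K.biv i j) * ∑ l, K.fibreCoeff k l * K.dξ l g =
      ∑ l, (∑ k, K.dx k (K.biv i j) * K.fibreCoeff k l) * K.dξ l g := by
    simp only [Finset.mul_sum, Finset.sum_mul]
    rw [Finset.sum_comm]
    exact Finset.sum_congr rfl fun s _ => Finset.sum_congr rfl fun k _ => by ring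
  simp only [h1, mul_add, Finset.sum_add_distrib, e1, e2, sub_mul, Finset.sum_sub_distrib]
  ring

/-- `ι(V) Ω = - t⁻¹ d_ξ F` in coordinates: `∂F/∂ξ_a = t π^{as} V_s`. -/
def IsPair (t : A) (F : A) (V : Fin n → A) : Prop :=
  ∀ a, K.dξ a F = t * ∑ s, K.biv a s * V s

variable {K} {t : A}

/-- This rests on `π` being parallel: of the `Γ` terms from the derivative of `π`, one group cancels
`[∂/∂ξ_a, ∇^i]` and the other completes the covariant derivative of `V`. The hypotheses on `t` make
it a constant for all the derivations. -/
theorem IsPair.nab {F : A} {V : Fin n → A} (h : K.IsPair t F V)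
    (hξ : ∀ a, K.dξ a t = 0) (hx : ∀ a, K.dx a t = 0) (i : Fin n) :
    K.IsPair t (K.nab i F) (fun s => K.nab i (V s) - ∑ j, K.Γ i j s * V j) := by
  intro a
  have hp : ∀ s, K.nab i (K.biv a s) = ∑ k, K.biv s k * K.Γ i a k - ∑ k, K.biv a k * K.Γ i s k :=
    fun s => by rw [K.nab_of_vertical_const i (fun b => K.dξ_biv b a s), K.parallel]
  have ht : K.nab i t = 0 := by simp [K.nab_apply, hξ, hx]
  rw [K.dξ_nab, h a]
  simp only [h _, Derivation.leibniz, smul_eq_mul, ht, mul_zero, add_zero, map_sum, hp, mul_add,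
    mul_sub, Finset.sum_add_distrib, Finset.sum_sub_distrib, Finset.mul_sum]
  have e1 : ∑ x, ∑ k, t * (V x * (K.biv x k * K.Γ i a k)) =
      - ∑ x, ∑ k, K.Γ i a x * (t * (K.biv x k * V k)) := by
    rw [Finset.sum_comm, ← Finset.sum_neg_distrib]
    refine Finset.sum_congr rfl fun s _ => ?_
    rw [← Finset.sum_neg_distrib]
    refine Finset.sum_congr rfl fun k _ => ?_
    rw [K.skew k s]; ring
  have e2 : ∑ x, ∑ k, t * (V x * (K.biv a k * K.Γ i x k)) =
      ∑ x, ∑ k, t * (K.biv a x * (K.Γ i k x * V k)) := by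
    rw [Finset.sum_comm]
    exact Finset.sum_congr rfl fun s _ => Finset.sum_congr rfl fun k _ => by ring
  simp only [e1, e2]
  ring

/-- As `π` is constant along the fibres, the commutator of two Hamiltonian fields is a Hamiltonian
field of the bracket of the functions. -/
theorem IsPair.vert {F G : A} {V W : Fin n → A} (hF : K.IsPair t F V) (hG : K.IsPair t G W)
    (hξ : ∀ a, K.dξ a t = 0) :
    K.IsPair t (K.vert V G) (fun s => K.vert V (W s) - K.vert W (V s)) := by
  intro a
  -- Symmetry of the second fibre derivatives of `F`, expressed through first derivatives of `V`.
  have hsymm : ∀ b, t * ∑ s, K.biv a s * K.dξ b (V s) = t * ∑ s, K.biv b s * K.dξ a (V s) := by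
    intro b
    have h := K.dξ_dξ a b F
    simp only [hF _, Derivation.leibniz, smul_eq_mul, hξ, mul_zero, add_zero, map_sum, K.dξ_biv]
      at h
    exact h.symm
  have hF2 : ∀ s, K.dξ s G = t * ∑ b, K.biv s b * W b := hG
  simp only [combination_apply, map_sum, Derivation.leibniz, smul_eq_mul, mul_sub,
    Finset.sum_sub_distrib, Finset.sum_add_distrib]
  have e1 : ∑ x, V x * K.dξ a (K.dξ x G) = t * ∑ s, K.biv a s * ∑ b, V b * K.dξ b (W s) := by
    simp only [K.dξ_dξ a, hF2 a, Derivation.leibniz, smul_eq_mul, hξ, mul_zero, add_zero, map_sum,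
      K.dξ_biv, Finset.mul_sum]
    rw [Finset.sum_comm]
    exact Finset.sum_congr rfl fun s _ => Finset.sum_congr rfl fun k _ => by ring
  have e2 : ∑ s, K.dξ s G * K.dξ a (V s) = - (t * ∑ s, K.biv a s * ∑ b, W b * K.dξ b (V s)) := by
    have : t * ∑ s, K.biv a s * ∑ b, W b * K.dξ b (V s) =
        ∑ b, W b * (t * ∑ s, K.biv a s * K.dξ b (V s)) := by
      simp only [Finset.mul_sum]
      rw [Finset.sum_comm]
      exact Finset.sum_congr rfl fun s _ => Finset.sum_congr rfl fun k _ => by ring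
    rw [this]
    simp only [hsymm, hF2, Finset.mul_sum, Finset.sum_mul, ← Finset.sum_neg_distrib]
    rw [Finset.sum_comm]
    refine Finset.sum_congr rfl fun s _ => Finset.sum_congr rfl fun k _ => ?_
    rw [K.skew s k]; ring
  rw [e1, e2]; ring

end ConnectionAlgebra

end Flatness

end

/-! ### Curvature, its Hamiltonian function `Q`, and flatness of the twisted connection. -/

section

section Flatness

variable {A : Type*} [CommRing A] [Algebra ℝ A] {n : ℕ}

theorem map_derivation_mul (X : Derivation ℝ A A) (M N : Matrix (Fin n) (Fin n) A) :
    (M * N).map X = M.map X * N + M * N.map X := by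
  ext a b
  simp only [Matrix.map_apply, Matrix.mul_apply, Matrix.add_apply, map_sum, Derivation.leibniz,
    smul_eq_mul, Finset.sum_add_distrib]
  rw [add_comm]
  congr 1
  exact Finset.sum_congr rfl fun s _ => mul_comm _ _

namespace ConnectionAlgebra

variable (K : ConnectionAlgebra n A)

theorem dξ_curv (i j b s : Fin n) :
    K.dξ b (K.curv i j s) = K.nab i (K.Γ j b s) - K.nab j (K.Γ i b s)
      + ∑ k, K.Γ i b k * K.Γ j k s - ∑ k, K.Γ j b k * K.Γ i k s
      - ∑ k, K.dx k (K.biv i j) * K.Γ k b s := by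
  have h : ∀ k, K.dξ b (K.dx k (K.biv i j)) = 0 :=
    fun k => K.dξ_dx_eq_zero k (fun a => K.dξ_biv a i j) b
  simp only [curv, map_sub, map_sum, Derivation.leibniz, dξ_nab, dξ_fibreCoeff, h, smul_eq_mul,
    mul_zero, add_zero]
  ring

/-- The curvature preserves `Ω`. -/
theorem dξ_curv_symm (i j a s : Fin n) :
    ∑ k, K.biv a k * K.dξ s (K.curv i j k) = ∑ k, K.biv s k * K.dξ a (K.curv i j k) := by
  -- In matrix form the claim is `C P + P Cᵀ = 0`, where `C` is the linear field `curv i j`. It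
  -- follows by commuting two derivatives of the parallelism equation `∇^i P = -G_i P - P G_iᵀ`.
  let P : Matrix (Fin n) (Fin n) A := Matrix.of K.biv
  let G : Fin n → Matrix (Fin n) (Fin n) A := fun i => Matrix.of (K.Γ i)
  let C : Matrix (Fin n) (Fin n) A := Matrix.of fun b s => K.dξ b (K.curv i j s)
  have hP : ∀ i, P.map (K.nab i) = -(G i * P) - P * (G i).transpose := by
    intro i
    ext a s
    simp only [P, G, Matrix.map_apply, Matrix.of_apply, Matrix.sub_apply, Matrix.neg_apply,
      Matrix.mul_apply, Matrix.transpose_apply]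
    rw [K.nab_of_vertical_const i (fun b => K.dξ_biv b a s), K.parallel, ← Finset.sum_neg_distrib]
    congr 1
    refine Finset.sum_congr rfl fun k _ => ?_
    rw [K.skew s k]; ring
  have hPP : ∀ i j, (P.map (K.nab j)).map (K.nab i) =
      -((G j).map (K.nab i) * P + G j * P.map (K.nab i))
        - (P.map (K.nab i) * (G j).transpose + P * ((G j).map (K.nab i)).transpose) := by
    intro i j
    rw [hP j, ← Matrix.transpose_map, ← map_derivation_mul, ← map_derivation_mul]
    ext a b
    simp only [Matrix.map_apply, Matrix.sub_apply, Matrix.neg_apply, map_sub, map_neg]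
  have hC : C = (G j).map (K.nab i) - (G i).map (K.nab j) + G i * G j - G j * G i
      - ∑ k, K.dx k (K.biv i j) • G k := by
    ext b s
    simp only [C, G, Matrix.of_apply, K.dξ_curv, Matrix.sub_apply, Matrix.add_apply,
      Matrix.map_apply, Matrix.mul_apply, Matrix.sum_apply, Matrix.smul_apply, smul_eq_mul]
  -- The entries of `P` are constant along the fibres, so the vertical curvature term of `nab_nab`
  -- drops out.
  have h0 : (P.map (K.nab j)).map (K.nab i) - (P.map (K.nab i)).map (K.nab j) =
      ∑ k, K.dx k (K.biv i j) • P.map (K.nab k) := by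
    ext a b
    have h := K.nab_nab i j (K.biv a b)
    simp only [combination_apply, K.dξ_biv, mul_zero, Finset.sum_const_zero, add_zero] at h
    simpa only [P, Matrix.sub_apply, Matrix.map_apply, Matrix.of_apply, Matrix.sum_apply,
      Matrix.smul_apply, smul_eq_mul] using h
  have hS : ∑ k, K.dx k (K.biv i j) • P.map (K.nab k) =
      -((∑ k, K.dx k (K.biv i j) • G k) * P) - P * (∑ k, K.dx k (K.biv i j) • G k).transpose := by
    simp only [hP, smul_sub, smul_neg, Finset.sum_sub_distrib, Finset.sum_neg_distrib,
      Finset.sum_mul, Matrix.transpose_sum, Finset.mul_sum, Matrix.smul_mul,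
      Matrix.transpose_smul, Matrix.mul_smul]
  have hfin : C * P + P * C.transpose = 0 := by
    rw [hS, hPP, hPP, hP, hP] at h0
    rw [hC]
    simp only [Matrix.transpose_sub, Matrix.transpose_add, Matrix.transpose_mul]
    rw [← sub_eq_zero] at h0
    rw [← neg_eq_zero, ← h0]
    noncomm_ring
  have h1 := congrFun (congrFun hfin a) s
  simp only [C, P, Matrix.add_apply, Matrix.mul_apply, Matrix.of_apply, Matrix.transpose_apply,
    Matrix.zero_apply] at h1
  have h2 : ∑ k, K.dξ a (K.curv i j k) * K.biv k s = - ∑ k, K.biv s k * K.dξ a (K.curv i j k) := by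
    rw [← Finset.sum_neg_distrib]
    refine Finset.sum_congr rfl fun k _ => ?_
    rw [K.skew k s]; ring
  rw [h2] at h1
  linear_combination h1

/-- The vertical part of `nab i` is linear in `ξ`, so `nab i` preserves the degree along the fibres.
-/
theorem euler_nab (i : Fin n) (g : A) :
    K.vert K.ξ (K.nab i g) = K.nab i (K.vert K.ξ g) := by
  have h := K.nab_vert i K.ξ g
  have h0 : (fun s => K.nab i (K.ξ s) - ∑ j, K.Γ i j s * K.ξ j) = 0 := by
    funext s
    rw [nab_ξ, fibreCoeff, sub_self]; rfl
  rw [h0] at h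
  rw [eq_comm, ← sub_eq_zero, h]
  simp [combination_apply]

theorem euler_fibreCoeff (i s : Fin n) : K.vert K.ξ (K.fibreCoeff i s) = K.fibreCoeff i s := by
  rw [combination_apply, fibreCoeff]
  refine Finset.sum_congr rfl fun k _ => ?_
  rw [← fibreCoeff, dξ_fibreCoeff, mul_comm]

theorem euler_curv (i j s : Fin n) : ∑ b, K.ξ b * K.dξ b (K.curv i j s) = K.curv i j s := by
  rw [← combination_apply]
  have h : ∀ k, K.vert K.ξ (K.dx k (K.biv i j)) = 0 := fun k => by
    simp [combination_apply, K.dξ_dx_eq_zero k (fun a => K.dξ_biv a i j)]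
  simp only [curv, map_sub, map_sum, Derivation.leibniz, euler_nab, euler_fibreCoeff, h,
    smul_eq_mul, mul_zero, add_zero]

/-- `Q = ½ Ω(E, R)`. -/
def quad (i j : Fin n) : A :=
  algebraMap ℝ A (1 / 2) * ∑ a, ∑ b, K.biv a b * (K.ξ a * K.curv i j b)

/-- `curv` is linear in `ξ` and symmetric with respect to `Ω`, so the two Leibniz terms agree and
absorb the factor `½`. Hence the curvature is a Hamiltonian field of `Q`. -/
theorem dξ_quad (i j c : Fin n) : K.dξ c (K.quad i j) = ∑ s, K.biv c s * K.curv i j s := by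
  have h1 : ∑ a, ∑ b, K.biv a b * (K.ξ a * K.dξ c (K.curv i j b)) =
      ∑ s, K.biv c s * K.curv i j s := by
    have : ∀ a, ∑ b, K.biv a b * (K.ξ a * K.dξ c (K.curv i j b)) =
        ∑ k, K.biv c k * (K.ξ a * K.dξ a (K.curv i j k)) := by
      intro a
      have := congrArg (K.ξ a * ·) (K.dξ_curv_symm i j a c)
      simp only [Finset.mul_sum] at this
      rw [Finset.sum_congr rfl fun k _ => mul_left_comm (K.biv a k) _ _, this]
      exact Finset.sum_congr rfl fun k _ => mul_left_comm _ _ _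
    simp only [this]
    rw [Finset.sum_comm]
    refine Finset.sum_congr rfl fun s _ => ?_
    rw [← Finset.mul_sum, euler_curv]
  have h2 : ∑ a, ∑ b, K.biv a b * (K.curv i j b * K.dξ c (K.ξ a)) =
      ∑ s, K.biv c s * K.curv i j s := by
    simp [K.dξ_ξ]
  have h3 : algebraMap ℝ A (1 / 2) * 2 = 1 := by
    rw [← map_ofNat (algebraMap ℝ A) 2, ← map_mul]
    norm_num
  simp only [quad, Derivation.leibniz, map_sum, smul_eq_mul, K.dξ_biv, mul_zero, add_zero,
    Derivation.map_algebraMap, mul_add, Finset.sum_add_distrib]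
  simp only [h1, h2]
  linear_combination (∑ s, K.biv c s * K.curv i j s) * h3

/-- The derivation `t ∇^i - v^i_s ∂/∂ξ_s`. -/
def twist (t : A) (v : Fin n → Fin n → A) (i : Fin n) (F : A) : A :=
  t * K.nab i F - K.vert (v i) F

/-- The twisted connection is flat on Hamiltonian functions, if the fundamental equation holds. -/
theorem twist_flat {t : A} (ht : IsLeftRegular t) (hξ : ∀ a, K.dξ a t = 0)
    (hx : ∀ a, K.dx a t = 0) {U : Fin n → A} {v : Fin n → Fin n → A}
    (hU : ∀ i, K.IsPair t (U i) (v i))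
    (hfund : ∀ i j, t * K.biv i j = t * (t ^ 2 * K.quad i j) - t * K.nab i (U j)
      + t * K.nab j (U i) + t * ∑ k, K.dx k (K.biv i j) * U k + K.vert (v i) (U j))
    {F : A} {H : Fin n → A} (hF : K.IsPair t F H) (i j : Fin n) :
    K.twist t v i (K.twist t v j F) - K.twist t v j (K.twist t v i F) =
      t * ∑ k, K.dx k (K.biv i j) * K.twist t v k F := by
  -- The curvature of the twisted connection is the vertical field with these coefficients.
  let C : Fin n → A := fun s =>
    t ^ 2 * K.curv i j s - t * (K.nab i (v j s) - ∑ k, K.Γ i k s * v j k)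
    + t * (K.nab j (v i s) - ∑ k, K.Γ j k s * v i k) + t * ∑ k, K.dx k (K.biv i j) * v k s
    + (K.vert (v i) (v j s) - K.vert (v j) (v i s))
  have htn : ∀ i, K.nab i t = 0 := fun i => by simp [K.nab_apply, hξ, hx]
  have htv : ∀ w, K.vert w t = 0 := fun w => by simp [combination_apply, hξ]
  -- Fibre differential of the Fundamental Equation: the left side is constant along the fibres, and
  -- the Hamiltonian fields of the terms on the right add up to `C`. The common factor `t` is
  -- cancelled by regularity.
  have hC : ∀ a, ∑ s, K.biv a s * C s = 0 := by
    intro a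
    apply ht
    have h := congrArg (K.dξ a) (hfund i j)
    have h1 := (hU j).nab hξ hx i a
    have h2 := (hU i).nab hξ hx j a
    have h3 := (hU i).vert (hU j) hξ a
    have h4 : K.dξ a (∑ k, K.dx k (K.biv i j) * U k) =
        t * ∑ s, K.biv a s * ∑ k, K.dx k (K.biv i j) * v k s := by
      simp only [map_sum, Derivation.leibniz, smul_eq_mul, hU _ a,
        K.dξ_dx_eq_zero _ (fun a => K.dξ_biv a i j), mul_zero, add_zero, Finset.mul_sum]
      rw [Finset.sum_comm]
      exact Finset.sum_congr rfl fun s _ => Finset.sum_congr rfl fun k _ => by ring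
    have h5 : K.dξ a (t ^ 2) = 0 := by simp [pow_two, Derivation.leibniz, hξ]
    simp only [map_add, map_sub, Derivation.leibniz, smul_eq_mul, hξ, mul_zero, add_zero, h1, h2,
      h3, h4, h5, K.dξ_biv, K.dξ_quad] at h
    simp only [C, mul_add, mul_sub, Finset.sum_add_distrib, Finset.sum_sub_distrib] at h ⊢
    have hp : ∀ (w : A) (Z : Fin n → A), ∑ s, K.biv a s * (w * Z s) = w * ∑ s, K.biv a s * Z s := by
      intro w Z
      rw [Finset.mul_sum]
      exact Finset.sum_congr rfl fun s _ => mul_left_comm _ _ _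
    simp only [hp]
    linear_combination -h
  -- Knowing `π C = 0` suffices: with `∂F/∂ξ_s = t π^{sb} H_b`, the function `C F` is a pairing of
  -- `H` with `π C`.
  have hCF : K.vert C F = 0 := by
    have : K.vert C F = - ∑ s, H s * (t * ∑ b, K.biv s b * C b) := by
      simp only [combination_apply, hF _, Finset.mul_sum, ← Finset.sum_neg_distrib]
      rw [Finset.sum_comm]
      refine Finset.sum_congr rfl fun s _ => Finset.sum_congr rfl fun k _ => ?_
      rw [K.skew s k]; ring
    rw [this]; simp [hC]
  have e1 := K.nab_nab i j F
  have e2 := K.nab_vert i (v j) F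
  have e3 := K.nab_vert j (v i) F
  have e4 := K.vert_vert (v i) (v j) F
  have e5 : K.vert C F = t ^ 2 * K.vert (K.curv i j) F
      - t * K.vert (fun s => K.nab i (v j s) - ∑ k, K.Γ i k s * v j k) F
      + t * K.vert (fun s => K.nab j (v i s) - ∑ k, K.Γ j k s * v i k) F
      + t * ∑ k, K.dx k (K.biv i j) * K.vert (v k) F
      + K.vert (fun s => K.vert (v i) (v j s) - K.vert (v j) (v i s)) F := by
    have : ∑ k, K.dx k (K.biv i j) * K.vert (v k) F =
        K.vert (fun s => ∑ k, K.dx k (K.biv i j) * v k s) F := by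
      simp only [combination_apply, Finset.mul_sum, Finset.sum_mul]
      rw [Finset.sum_comm]
      exact Finset.sum_congr rfl fun s _ => Finset.sum_congr rfl fun k _ => by ring
    rw [this, combination_apply, combination_apply _ (K.curv i j),
      combination_apply K.dξ (fun s => K.nab i (v j s) - ∑ k, K.Γ i k s * v j k),
      combination_apply K.dξ (fun s => K.nab j (v i s) - ∑ k, K.Γ j k s * v i k),
      combination_apply K.dξ (fun s => ∑ k, K.dx k (K.biv i j) * v k s),
      combination_apply K.dξ (fun s => K.vert (v i) (v j s) - K.vert (v j) (v i s))]
    simp only [C, Finset.mul_sum (a := t), Finset.mul_sum (a := t ^ 2), ← Finset.sum_add_distrib,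
      ← Finset.sum_sub_distrib]
    refine Finset.sum_congr rfl fun s _ => ?_
    simp only [← Finset.mul_sum (a := t)]
    ring
  have e6 : ∑ k, K.dx k (K.biv i j) * K.twist t v k F =
      t * ∑ k, K.dx k (K.biv i j) * K.nab k F - ∑ k, K.dx k (K.biv i j) * K.vert (v k) F := by
    simp only [twist, mul_sub, Finset.sum_sub_distrib, Finset.mul_sum]
    congr 1
    exact Finset.sum_congr rfl fun s _ => mul_left_comm _ _ _
  rw [e6]
  simp only [twist, map_sub, Derivation.leibniz, smul_eq_mul, htn, htv, mul_zero, add_zero]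
  rw [e5] at hCF
  linear_combination t ^ 2 * e1 - t * e2 + t * e3 + e4 + hCF

end ConnectionAlgebra

end Flatness

end

/-! ### Power series in the fibre degree, and the recursive lift in a formal chart. -/

section

section Series

open PowerSeries

variable {B : Type*} [CommRing B] [Algebra ℝ B] {n : ℕ}

/-- A derivation acting on the coefficients of power series. -/
def coeffDerivation (X : Derivation ℝ B B) : Derivation ℝ B⟦X⟧ B⟦X⟧ :=
  Derivation.mk'
    { toFun := fun F => PowerSeries.mk fun k => X (coeff k F)
      map_add' := fun F G => by ext k; simp
      map_smul' := fun c F => by ext k; simp }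
    (fun F G => by
      ext k
      simp only [LinearMap.coe_mk, AddHom.coe_mk, coeff_mk, coeff_mul, map_sum, Derivation.leibniz,
        smul_eq_mul, map_add, Finset.sum_add_distrib]
      congr 1
      rw [← Finset.Nat.sum_antidiagonal_swap]
      rfl)

@[simp]
theorem coeff_coeffDerivation (X : Derivation ℝ B B) (F : B⟦X⟧) (k : ℕ) :
    coeff k (coeffDerivation X F) = X (coeff k F) := by
  simp [coeffDerivation]

theorem coeffDerivation_C (X : Derivation ℝ B B) (b : B) :
    coeffDerivation X (C b) = C (X b) := by
  ext k
  simp only [coeff_coeffDerivation, coeff_C]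
  split_ifs <;> simp

theorem coeffDerivation_X (X : Derivation ℝ B B) :
    coeffDerivation X (PowerSeries.X : B⟦X⟧) = 0 := by
  ext k
  simp only [coeff_coeffDerivation, coeff_X]
  split_ifs <;> simp

namespace ConnectionAlgebra

/-- The connection algebra extended to power series. -/
def lift (K : ConnectionAlgebra n B) : ConnectionAlgebra n B⟦X⟧ where
  dx i := coeffDerivation (K.dx i)
  dξ i := coeffDerivation (K.dξ i)
  ξ i := C (K.ξ i)
  biv i j := C (K.biv i j)
  Γ i j k := C (K.Γ i j k)
  dx_dx i j g := by ext; simp [K.dx_dx i]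
  dx_dξ i j g := by ext; simp [K.dx_dξ i]
  dξ_dξ i j g := by ext; simp [K.dξ_dξ i]
  dx_ξ i j := by simp [coeffDerivation_C, K.dx_ξ]
  dξ_ξ i j := by
    rw [coeffDerivation_C, K.dξ_ξ]
    split_ifs <;> simp
  dξ_biv a i j := by simp [coeffDerivation_C, K.dξ_biv]
  dξ_Γ a i j k := by simp [coeffDerivation_C, K.dξ_Γ]
  skew i j := by rw [K.skew, map_neg]
  jacobi l i j := by simp only [coeffDerivation_C, ← map_mul, ← map_sum, ← map_add, K.jacobi,
    map_zero]
  parallel i a s := by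
    simp only [coeffDerivation_C, ← map_mul, ← map_sum, ← map_sub, K.parallel]

variable (K : ConnectionAlgebra n B)

theorem coeff_lift_nab (i : Fin n) (F : B⟦X⟧) (k : ℕ) :
    coeff k (K.lift.nab i F) = K.nab i (coeff k F) := by
  have h : ∀ k, K.lift.fibreCoeff i k = C (K.fibreCoeff i k) := fun k => by
    simp [fibreCoeff, lift]
  simp only [nab_apply, h, map_add, map_sum]
  simp [lift]

theorem lift_fibreCoeff (i k : Fin n) : K.lift.fibreCoeff i k = C (K.fibreCoeff i k) := by
  simp [fibreCoeff, lift]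

theorem lift_nab_C (i : Fin n) (b : B) : K.lift.nab i (C b) = C (K.nab i b) := by
  ext k
  rw [coeff_lift_nab]
  simp only [coeff_C]
  split_ifs <;> simp

theorem lift_curv (i j s : Fin n) : K.lift.curv i j s = C (K.curv i j s) := by
  simp only [curv, lift_fibreCoeff, lift_nab_C, map_sub, map_sum, map_mul]
  simp [lift, coeffDerivation_C]

theorem lift_quad (i j : Fin n) : K.lift.quad i j = C (K.quad i j) := by
  simp only [quad, lift_curv, map_sum, map_mul, PowerSeries.algebraMap_apply]
  rfl

/-- The coefficients of the derivative of `G` along the vertical field with coefficients `v`. -/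
def shiftedVert (v : Fin n → ℕ → B) (G : ℕ → B) (d : ℕ) : B :=
  ∑ ab ∈ antidiagonal d, ∑ s, v s ab.1 * K.dξ s (G (ab.2 + 1))

/-- A formal function is recorded as `∑ F_k X^k`, but `∂/∂ξ_s` lowers the degree along the fibres
without lowering the power of `X`. The surplus factor `X` plays the role of `t` in `IsPair` and
`twist`. -/
theorem lift_vert (v : Fin n → ℕ → B) (G : ℕ → B) (h0 : ∀ s, K.dξ s (G 0) = 0) :
    K.lift.vert (fun s => PowerSeries.mk (v s)) (PowerSeries.mk G) =
      X * PowerSeries.mk (K.shiftedVert v G) := by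
  have h : ∀ s, K.lift.dξ s (PowerSeries.mk G) =
      X * PowerSeries.mk (fun d => K.dξ s (G (d + 1))) := by
    intro s
    ext (_ | k)
    · simp [lift, h0]
    · simp [lift, coeff_succ_X_mul]
  ext (_ | k)
  · simp [combination_apply, h]
  · simp only [combination_apply, h, map_sum, coeff_succ_X_mul, coeff_mk, shiftedVert]
    rw [Finset.sum_comm]
    refine Finset.sum_congr rfl fun s _ => ?_
    rw [mul_left_comm, coeff_succ_X_mul, coeff_mul]
    simp

end ConnectionAlgebra

/-- The data of a formal chart: a graded connection algebra, the coefficients `Γ'` of an associated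
connection, and local potentials `u`, `v` that solve the fundamental equation. -/
structure FormalChart (n : ℕ) (B : Type*) [CommRing B] [Algebra ℝ B] extends
    ConnectionAlgebra n B where
  deg : ℕ → Submodule ℝ B
  mul_mem : ∀ {k l a b}, a ∈ deg k → b ∈ deg l → a * b ∈ deg (k + l)
  ξ_mem : ∀ i, ξ i ∈ deg 1
  biv_mem : ∀ i j, biv i j ∈ deg 0
  dx_mem : ∀ {k a} i, a ∈ deg k → dx i a ∈ deg k
  dξ_mem : ∀ {k a} i, a ∈ deg (k + 1) → dξ i a ∈ deg k
  euler : ∀ {k a}, a ∈ deg k → ∑ i, ξ i * dξ i a = (k : ℝ) • a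
  Γ' : Fin n → Fin n → Fin n → B
  Γ'_mem : ∀ i j k, Γ' i j k ∈ deg 0
  assoc : ∀ i j l, ∑ k, Γ i j k * biv l k = ∑ k, biv i k * Γ' l j k
  u : Fin n → ℕ → B
  v : Fin n → Fin n → ℕ → B
  u_mem : ∀ k d, u k d ∈ deg d
  u_zero : ∀ k, u k 0 = 0
  v_zero : ∀ i k, v i k 0 = if i = k then 1 else 0
  compatible : ∀ i j d, ∑ s, biv i s * v j s d = ∑ s, biv j s * dξ i (u s (d + 1))
  fundamental : ∀ i j d, (if d = 0 then biv i j else 0) =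
    (if d = 2 then toConnectionAlgebra.quad i j else 0)
      - toConnectionAlgebra.nab i (∑ k, biv j k * u k d)
      + toConnectionAlgebra.nab j (∑ k, biv i k * u k d)
      + ∑ l, dx l (biv i j) * ∑ k, biv l k * u k d
      + toConnectionAlgebra.shiftedVert (v i) (fun e => ∑ k, biv j k * u k e) d

namespace FormalChart

variable (L : FormalChart n B) (f : B)

/-- The degree `k` part of the Hamiltonian vector field of the formal lift of `f`. -/
def liftField : ℕ → Fin n → B
  | 0, m => L.dx m f
  -- The three terms are what remains of `∂/∂x^m`, of `Γ ξ ∂/∂ξ` and of `v ∂/∂ξ` once a factor `π`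
  -- has been moved to the front. The first contains `liftFun f (k + 1)` written out, so that the
  -- recursion is not mutual.
  | k + 1, m => L.dx m (((k + 1 : ℕ) : ℝ)⁻¹ • ∑ i, L.ξ i * ∑ s, L.biv i s * liftField k s)
      - ∑ l, (∑ j, L.Γ' l j m * L.ξ j) * liftField k l
      + ∑ j : Fin (k + 1), ∑ a, L.dξ a (L.u m (k + 1 - j.1 + 1)) * liftField j.1 a
termination_by k => k
decreasing_by all_goals omega

/-- The degree `k` part of the formal lift of `f`. -/
def liftFun : ℕ → B
  | 0 => f
  | k + 1 => ((k + 1 : ℕ) : ℝ)⁻¹ • ∑ i, L.ξ i * ∑ s, L.biv i s * L.liftField f k s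

theorem liftField_succ (k : ℕ) (m : Fin n) :
    L.liftField f (k + 1) m = L.dx m (L.liftFun f (k + 1))
      - ∑ l, (∑ j, L.Γ' l j m * L.ξ j) * L.liftField f k l
      + ∑ j ∈ range (k + 1), ∑ a, L.dξ a (L.u m (k + 1 - j + 1)) * L.liftField f j a := by
  rw [liftField, liftFun, ← Fin.sum_univ_eq_sum_range
    (fun j => ∑ a, L.dξ a (L.u m (k + 1 - j + 1)) * L.liftField f j a)]

/-- The part of the equation for `∂F_{k+1}/∂ξ_i` that involves lower components. -/
def residue (i : Fin n) (k : ℕ) : B :=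
  -- The sum stops at `j < k`: as `v i s 0` is `δ^i_s`, the term `j = k` would be `∂F_{k+1}/∂ξ_i`
  -- itself.
  L.nab i (L.liftFun f k) -
    ∑ j ∈ range k, ∑ s, L.v i s (k - j) * L.dξ s (L.liftFun f (j + 1))

variable {L f}

theorem mem_deg_of_eq {k l : ℕ} {a : B} (h : a ∈ L.deg k) (hkl : k = l) : a ∈ L.deg l := hkl ▸ h

theorem liftField_mem (hf : f ∈ L.deg 0) : ∀ (k : ℕ) (m : Fin n), L.liftField f k m ∈ L.deg k := by
  intro k
  induction k using Nat.strong_induction_on with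
  | _ k ih =>
    intro m
    cases k with
    | zero => rw [liftField]; exact L.dx_mem m hf
    | succ k =>
      rw [liftField]
      refine Submodule.add_mem _ (Submodule.sub_mem _ ?_ ?_) ?_
      · refine L.dx_mem m (Submodule.smul_mem _ _ (Submodule.sum_mem _ fun i _ => ?_))
        refine mem_deg_of_eq (L.mul_mem (L.ξ_mem i) (Submodule.sum_mem _ fun s _ =>
          L.mul_mem (L.biv_mem i s) (ih k (by omega) s))) (by omega)
      · refine Submodule.sum_mem _ fun l _ => mem_deg_of_eq (L.mul_mem
          (Submodule.sum_mem _ fun j _ => L.mul_mem (L.Γ'_mem l j m) (L.ξ_mem j))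
          (ih k (by omega) l)) (by omega)
      · refine Submodule.sum_mem _ fun j _ => Submodule.sum_mem _ fun a _ => mem_deg_of_eq
          (L.mul_mem (L.dξ_mem a (L.u_mem m _)) (ih j.1 (by omega) a)) (by omega)

theorem liftFun_mem (hf : f ∈ L.deg 0) (k : ℕ) : L.liftFun f k ∈ L.deg k := by
  cases k with
  | zero => exact hf
  | succ k =>
    refine Submodule.smul_mem _ _ (Submodule.sum_mem _ fun i _ => ?_)
    exact mem_deg_of_eq (L.mul_mem (L.ξ_mem i) (Submodule.sum_mem _ fun s _ =>
      L.mul_mem (L.biv_mem i s) (liftField_mem hf k s))) (by omega)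

/-- The residue lies in the image of the bivector. -/
theorem residue_eq (hf0 : ∀ a, L.dξ a f = 0) (k : ℕ)
    (ih : ∀ j < k, ∀ a, L.dξ a (L.liftFun f (j + 1)) = ∑ s, L.biv a s * L.liftField f j s)
    (i : Fin n) : L.residue f i k = ∑ m, L.biv i m * L.liftField f k m := by
  cases k with
  | zero =>
    simp only [residue, liftFun, range_zero, sum_empty, sub_zero]
    rw [L.nab_of_vertical_const i hf0]
    simp [liftField]
  | succ k =>
    -- Association exchanges `Γ π` for `π Γ'`.
    have e1 : ∑ s, L.fibreCoeff i s * ∑ l, L.biv s l * L.liftField f k l =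
        - ∑ m, L.biv i m * ∑ l, (∑ j, L.Γ' l j m * L.ξ j) * L.liftField f k l := by
      have h : ∀ l, ∑ s, L.fibreCoeff i s * L.biv s l =
          - ∑ m, L.biv i m * ∑ j, L.Γ' l j m * L.ξ j := by
        intro l
        have h2 : ∀ j, ∑ s, L.Γ i j s * L.biv s l = - ∑ k, L.biv i k * L.Γ' l j k := by
          intro j
          rw [← L.assoc, ← Finset.sum_neg_distrib]
          refine Finset.sum_congr rfl fun s _ => ?_
          rw [L.skew s l]; ring
        calc ∑ s, L.fibreCoeff i s * L.biv s l
            = ∑ j, L.ξ j * ∑ s, L.Γ i j s * L.biv s l := by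
              simp only [ConnectionAlgebra.fibreCoeff, Finset.mul_sum, Finset.sum_mul]
              rw [Finset.sum_comm]
              exact Finset.sum_congr rfl fun s _ => Finset.sum_congr rfl fun k _ => by ring
          _ = _ := by
              simp only [h2, Finset.mul_sum, ← Finset.sum_neg_distrib]
              rw [Finset.sum_comm]
              exact Finset.sum_congr rfl fun s _ => Finset.sum_congr rfl fun k _ => by ring
      calc ∑ s, L.fibreCoeff i s * ∑ l, L.biv s l * L.liftField f k l
          = ∑ l, (∑ s, L.fibreCoeff i s * L.biv s l) * L.liftField f k l := by
            simp only [Finset.mul_sum, Finset.sum_mul]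
            rw [Finset.sum_comm]
            exact Finset.sum_congr rfl fun s _ => Finset.sum_congr rfl fun k _ => by ring
        _ = _ := by
            simp only [h, Finset.mul_sum, Finset.sum_mul, ← Finset.sum_neg_distrib]
            rw [Finset.sum_comm]
            exact Finset.sum_congr rfl fun s _ => Finset.sum_congr rfl fun k _ =>
              Finset.sum_congr rfl fun _ _ => by ring
    -- Compatibility exchanges `v π` for `π ∂u/∂ξ`; the sign comes from the skew-symmetry of `π`.
    have e2 : ∀ j d, ∑ s, L.v i s d * ∑ l, L.biv s l * L.liftField f j l =
        - ∑ m, L.biv i m * ∑ a, L.dξ a (L.u m (d + 1)) * L.liftField f j a := by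
      intro j d
      calc ∑ s, L.v i s d * ∑ l, L.biv s l * L.liftField f j l
          = - ∑ l, (∑ s, L.biv l s * L.v i s d) * L.liftField f j l := by
            simp only [Finset.mul_sum, Finset.sum_mul, ← Finset.sum_neg_distrib]
            rw [Finset.sum_comm]
            refine Finset.sum_congr rfl fun s _ => Finset.sum_congr rfl fun k _ => ?_
            rw [L.skew s k]; ring
        _ = _ := by
            simp only [L.compatible, Finset.mul_sum, Finset.sum_mul, ← Finset.sum_neg_distrib]
            rw [Finset.sum_comm]
            exact Finset.sum_congr rfl fun s _ => Finset.sum_congr rfl fun k _ => by ring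
    have e3 : ∑ j ∈ range (k + 1), ∑ s, L.v i s (k + 1 - j) * L.dξ s (L.liftFun f (j + 1)) =
        - ∑ m, L.biv i m * ∑ j ∈ range (k + 1), ∑ a,
          L.dξ a (L.u m (k + 1 - j + 1)) * L.liftField f j a := by
      calc _ = ∑ j ∈ range (k + 1), - ∑ m, L.biv i m * ∑ a,
          L.dξ a (L.u m (k + 1 - j + 1)) * L.liftField f j a := by
            refine Finset.sum_congr rfl fun j hj => ?_
            rw [← e2]
            refine Finset.sum_congr rfl fun s _ => ?_
            rw [ih j (Finset.mem_range.mp hj)]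
        _ = _ := by
            rw [Finset.sum_neg_distrib, Finset.sum_comm]
            simp only [Finset.mul_sum]
    rw [residue, e3, L.nab_apply]
    simp only [ih k (Nat.lt_succ_self k), e1, liftField_succ, mul_add, mul_sub,
      Finset.sum_add_distrib, Finset.sum_sub_distrib]
    ring

/-- Isolates the only component of degree `d + 1`, which comes with the leading coefficient `δ^i_s`
of `v`. This is what allows solving degree by degree. -/
theorem shiftedVert_eq (i : Fin n) (g : ℕ → B) (d : ℕ) :
    L.shiftedVert (L.v i) g d =
      ∑ b ∈ range d, ∑ s, L.v i s (d - b) * L.dξ s (g (b + 1)) + L.dξ i (g (d + 1)) := by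
  rw [ConnectionAlgebra.shiftedVert, ← Finset.Nat.sum_antidiagonal_swap]
  simp only [Prod.swap]
  rw [Finset.Nat.sum_antidiagonal_eq_sum_range_succ
      (fun b a => ∑ s, L.v i s a * L.dξ s (g (b + 1))), Finset.sum_range_succ]
  simp [L.v_zero]

/-- The compatibility relation read as a statement about Hamiltonian fields: `v^i` belongs to
`U(dx^i) = π^{ik} u_k`. -/
theorem potential_isPair (i : Fin n) :
    L.lift.IsPair X (PowerSeries.mk fun d => ∑ k, L.biv i k * L.u k d)
      (fun s => PowerSeries.mk (L.v i s)) := by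
  intro a
  ext (_ | d)
  · simp [ConnectionAlgebra.lift, L.u_zero]
  · have h := L.compatible a i d
    simp only [coeff_succ_X_mul, map_sum]
    simp [ConnectionAlgebra.lift, Derivation.leibniz, L.dξ_biv, h]

/-- Flatness is applied to the truncation of the lift at degree `k`. The coefficients of its twisted
derivatives vanish through `X^k`, and at `X^{k+1}` they are the residues. At `X^{k+1}` the flatness
identity therefore retains only first fibre derivatives of the residues. -/
theorem dξ_residue_symm (hf0 : ∀ a, L.dξ a f = 0) (k : ℕ)
    (ih : ∀ j < k, ∀ a, L.dξ a (L.liftFun f (j + 1)) = ∑ s, L.biv a s * L.liftField f j s)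
    (i j : Fin n) : L.dξ i (L.residue f j k) = L.dξ j (L.residue f i k) := by
  let v : Fin n → Fin n → B⟦X⟧ := fun i s => PowerSeries.mk (L.v i s)
  -- The function is cut off above degree `k` and its field from degree `k` on, so that the pair
  -- relation holds in every degree.
  let G : ℕ → B := fun j => if j ≤ k then L.liftFun f j else 0
  let W : ℕ → Fin n → B := fun j s => if j < k then L.liftField f j s else 0
  have hG0 : ∀ s, L.dξ s (G 0) = 0 := fun s => by simp [G, liftFun, hf0]
  have hpair : L.lift.IsPair X (PowerSeries.mk G) (fun s => PowerSeries.mk fun j => W j s) := by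
    intro a
    ext (_ | d)
    · simp [ConnectionAlgebra.lift, hG0]
    · simp only [coeff_succ_X_mul, map_sum]
      by_cases hd : d < k
      · simp [ConnectionAlgebra.lift, G, W, hd, Nat.succ_le_of_lt hd, ih d hd]
      · simp [ConnectionAlgebra.lift, G, W, hd]
  have hfund : ∀ i j, X * L.lift.biv i j = X * (X ^ 2 * L.lift.quad i j)
      - X * L.lift.nab i (PowerSeries.mk fun d => ∑ k, L.biv j k * L.u k d)
      + X * L.lift.nab j (PowerSeries.mk fun d => ∑ k, L.biv i k * L.u k d)
      + X * ∑ k, L.lift.dx k (L.lift.biv i j) *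
        (PowerSeries.mk fun d => ∑ s, L.biv k s * L.u s d)
      + L.lift.vert (v i) (PowerSeries.mk fun d => ∑ k, L.biv j k * L.u k d) := by
    intro i j
    rw [L.lift_vert _ _ (fun s => by simp [L.u_zero]), ← mul_sub, ← mul_add, ← mul_add, ← mul_add]
    congr 1
    ext d
    have h := L.fundamental i j d
    simp only [map_add, map_sub, L.coeff_lift_nab, coeff_mk, map_sum, L.lift_quad]
    have h1 : coeff d (L.lift.biv i j) = if d = 0 then L.biv i j else 0 := by
      simp [ConnectionAlgebra.lift, coeff_C]
    have h2 : coeff d (X ^ 2 * C (L.quad i j)) = if d = 2 then L.quad i j else 0 := by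
      rw [mul_comm, coeff_C_mul, coeff_X_pow]; simp
    have h3 : ∀ k, coeff d (L.lift.dx k (L.lift.biv i j) *
        (PowerSeries.mk fun d => ∑ s, L.biv k s * L.u s d)) =
        L.dx k (L.biv i j) * ∑ s, L.biv k s * L.u s d := by
      intro k
      simp [ConnectionAlgebra.lift, coeffDerivation_C]
    simp only [h1, h2, h3, h, map_sum]
  have hflat := L.lift.twist_flat (t := X) (PowerSeries.X_mul_injective)
    (fun a => coeffDerivation_X _) (fun a => coeffDerivation_X _)
    (fun i => L.potential_isPair i) hfund hpair
  have htw : ∀ i (g : ℕ → B), (∀ s, L.dξ s (g 0) = 0) →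
      L.lift.twist X v i (PowerSeries.mk g) =
      X * PowerSeries.mk fun d => L.nab i (g d) - L.shiftedVert (L.v i) g d := by
    intro i g hg
    rw [ConnectionAlgebra.twist, L.lift_vert _ _ hg, ← mul_sub]
    congr 1
    ext d
    simp [L.coeff_lift_nab]
  have hdeg : ∀ i d, d < k → L.nab i (G d) - L.shiftedVert (L.v i) G d = 0 := by
    intro i d hd
    have h := residue_eq hf0 d (fun j hj => ih j (hj.trans hd)) i
    rw [← ih d hd i, residue] at h
    have h1 : ∀ b, b ≤ d → G (b + 1) = L.liftFun f (b + 1) := fun b hb => if_pos (by omega)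
    rw [shiftedVert_eq, show G d = L.liftFun f d from if_pos hd.le, h1 d le_rfl, ← h,
      Finset.sum_congr rfl fun b hb => by rw [h1 b (Finset.mem_range.mp hb).le]]
    ring
  have htop : ∀ i, L.nab i (G k) - L.shiftedVert (L.v i) G k = L.residue f i k := by
    intro i
    have h1 : ∀ b, b < k → G (b + 1) = L.liftFun f (b + 1) := fun b hb => if_pos (by omega)
    rw [shiftedVert_eq, show G k = L.liftFun f k from if_pos le_rfl,
      show G (k + 1) = 0 from if_neg (by omega), residue, map_zero, add_zero,
      Finset.sum_congr rfl fun b hb => by rw [h1 b (Finset.mem_range.mp hb)]]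
  let T : Fin n → ℕ → B := fun i d => coeff d (L.lift.twist X v i (PowerSeries.mk G))
  have hT : ∀ i, L.lift.twist X v i (PowerSeries.mk G) = PowerSeries.mk (T i) := fun i => by
    ext d; simp [T]
  have hT0 : ∀ i d, d ≤ k → T i d = 0 := by
    intro i d hd
    simp only [T, htw i G hG0]
    cases d with
    | zero => simp
    | succ d => rw [coeff_succ_X_mul, coeff_mk, hdeg i d (by omega)]
  have hTk : ∀ i, T i (k + 1) = L.residue f i k := by
    intro i
    simp only [T, htw i G hG0]
    rw [coeff_succ_X_mul, coeff_mk, htop]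
  -- The coefficients of `T j` through `k` vanish, so `∇^i` contributes nothing, and the residue
  -- meets only the leading part `δ^i_s` of `v`.
  have hTT : ∀ i j, coeff (k + 1) (L.lift.twist X v i (PowerSeries.mk (T j))) =
      - L.dξ i (L.residue f j k) := by
    intro i j
    rw [htw i (T j) (fun s => by rw [hT0 j 0 (Nat.zero_le k), map_zero]), coeff_succ_X_mul,
      coeff_mk, shiftedVert_eq, hT0 j k le_rfl, hTk, Finset.sum_eq_zero]
    · simp
    · intro b hb
      rw [hT0 j (b + 1) (Finset.mem_range.mp hb)]
      simp
  have h := congrArg (coeff (k + 1)) (hflat i j)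
  rw [hT i, hT j, map_sub, hTT, hTT, coeff_succ_X_mul, map_sum, Finset.sum_eq_zero] at h
  · linear_combination -h
  · intro l _
    rw [hT l]
    simp [ConnectionAlgebra.lift, coeffDerivation_C, hT0 l k le_rfl]

/-- The homogeneous Poincaré lemma: for `r` closed and of degree `k`, `∂(ξ_i r_i)/∂ξ_a = r_a + ξ_i
∂r_a/∂ξ_i = (k+1) r_a` by Euler's identity. -/
theorem dξ_liftFun (hf : f ∈ L.deg 0) (hf0 : ∀ a, L.dξ a f = 0) (k : ℕ) :
    ∀ a, L.dξ a (L.liftFun f (k + 1)) = ∑ s, L.biv a s * L.liftField f k s := by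
  induction k using Nat.strong_induction_on with
  | _ k ih =>
    intro a
    have hE := residue_eq hf0 k ih
    have hmem : L.residue f a k ∈ L.deg k := by
      rw [hE]
      exact Submodule.sum_mem _ fun s _ =>
        mem_deg_of_eq (L.mul_mem (L.biv_mem a s) (liftField_mem hf k s)) (by omega)
    have h : L.dξ a (∑ i, L.ξ i * L.residue f i k) = ((k + 1 : ℕ) : ℝ) • L.residue f a k := by
      simp only [map_sum, Derivation.leibniz, smul_eq_mul, L.dξ_ξ, Finset.sum_add_distrib,
        dξ_residue_symm hf0 k ih a, L.euler hmem]
      simp [add_smul]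
    rw [liftFun, ← hE a]
    simp only [← hE]
    rw [Derivation.map_smul, h, smul_smul, inv_mul_cancel₀ (by positivity), one_smul]

/-- With `∂F_{k+1}/∂ξ_i` equal to the residue, the term omitted from the residue is restored; the
result is the lifting equation in degree `k`. -/
theorem nab_liftFun (hf : f ∈ L.deg 0) (hf0 : ∀ a, L.dξ a f = 0) (i : Fin n) (k : ℕ) :
    L.nab i (L.liftFun f k) = L.shiftedVert (L.v i) (L.liftFun f) k := by
  have h := residue_eq hf0 k (fun j _ => dξ_liftFun hf hf0 j) i
  rw [← dξ_liftFun hf hf0, residue] at h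
  rw [shiftedVert_eq, ← h]
  ring

end FormalChart

end Series

end

section

/-! ## The ring of smooth functions on an open set of a normed space -/

section SmoothFun

/-- The extension by zero of a function on `Ω`. -/
def zeroExt {V : Type*} {Ω : Set V} (f : Ω → ℝ) : V → ℝ := Function.extend Subtype.val f 0

theorem zeroExt_apply {V : Type*} {Ω : Set V} (f : Ω → ℝ) (p : Ω) : zeroExt f p = f p :=
  Subtype.val_injective.extend_apply f 0 p

theorem zeroExt_eqOn {V : Type*} {Ω : Set V} {f : Ω → ℝ} {g : V → ℝ} (h : ∀ p : Ω, f p = g p) :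
    Set.EqOn (zeroExt f) g Ω := fun p hp => by
  rw [← h ⟨p, hp⟩]; exact zeroExt_apply f ⟨p, hp⟩

variable {V : Type*} [NormedAddCommGroup V] [NormedSpace ℝ V]

/-- Smooth functions on `Ω`. -/
def SmoothFun (Ω : Set V) : Subalgebra ℝ (Ω → ℝ) where
  -- Elements live on the subtype, so equality in the ring is equality on `Ω`. The extension by zero
  -- serves to take derivatives, which on an open `Ω` do not see the values outside.
  carrier := {f | ContDiffOn ℝ ∞ (zeroExt f) Ω}
  mul_mem' {f g} hf hg := (ContDiffOn.mul hf hg).congr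
    (zeroExt_eqOn fun p => by simp [zeroExt_apply])
  add_mem' {f g} hf hg := (ContDiffOn.add hf hg).congr
    (zeroExt_eqOn fun p => by simp [zeroExt_apply])
  algebraMap_mem' r := (contDiffOn_const (c := r)).congr (zeroExt_eqOn fun p => rfl)

namespace SmoothFun

variable {Ω : Set V}

/-- The restriction to `Ω` of a function smooth on `Ω`. -/
def restrict (g : V → ℝ) (hg : ContDiffOn ℝ ∞ g Ω) : SmoothFun Ω :=
  ⟨fun p => g p, hg.congr (zeroExt_eqOn fun _ => rfl)⟩

/-- The extension by zero. -/
def ext (f : SmoothFun Ω) : V → ℝ := zeroExt f.1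

theorem ext_apply (f : SmoothFun Ω) (p : Ω) : (ext f) p = f.1 p := zeroExt_apply f.1 p

theorem contDiffOn_ext (f : SmoothFun Ω) : ContDiffOn ℝ ∞ (ext f) Ω := f.2

theorem ext_restrict (g : V → ℝ) (hg : ContDiffOn ℝ ∞ g Ω) :
    Set.EqOn (ext (restrict g hg)) g Ω := zeroExt_eqOn fun _ => rfl

theorem eq_of_ext {f g : SmoothFun Ω} (h : ∀ p ∈ Ω, (ext f) p = (ext g) p) : f = g := by
  refine Subtype.ext (funext fun p => ?_)
  rw [← ext_apply, ← ext_apply, h p p.2]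

section Ext

variable {p : V}

theorem ext_add (f g : SmoothFun Ω) (hp : p ∈ Ω) : ext (f + g) p = ext f p + (ext g) p := by
  lift p to Ω using hp
  simp [ext_apply]

theorem ext_sub (f g : SmoothFun Ω) (hp : p ∈ Ω) : (ext (f - g)) p = (ext f) p - (ext g) p := by
  lift p to Ω using hp
  simp [ext_apply]

theorem ext_neg (f : SmoothFun Ω) (hp : p ∈ Ω) : (ext (-f)) p = -(ext f) p := by
  lift p to Ω using hp
  simp [ext_apply]

theorem ext_mul (f g : SmoothFun Ω) (hp : p ∈ Ω) : (ext (f * g)) p = (ext f) p * (ext g) p := by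
  lift p to Ω using hp
  simp [ext_apply]

theorem ext_smul (c : ℝ) (f : SmoothFun Ω) (hp : p ∈ Ω) : (ext (c • f)) p = c * (ext f) p := by
  lift p to Ω using hp
  simp [ext_apply]

theorem ext_zero (hp : p ∈ Ω) : (ext (0 : SmoothFun Ω)) p = 0 := by
  lift p to Ω using hp
  simp [ext_apply]

theorem ext_one (hp : p ∈ Ω) : (ext (1 : SmoothFun Ω)) p = 1 := by
  lift p to Ω using hp
  simp [ext_apply]

theorem ext_algebraMap (c : ℝ) (hp : p ∈ Ω) : ext (algebraMap ℝ (SmoothFun Ω) c) p = c := by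
  lift p to Ω using hp
  rw [ext_apply]
  rfl

theorem ext_sum {ι : Type*} (s : Finset ι) (f : ι → SmoothFun Ω) (hp : p ∈ Ω) :
    (ext (∑ i ∈ s, f i)) p = ∑ i ∈ s, (ext (f i)) p := by
  classical
  induction s using Finset.induction_on with
  | empty => simp [ext_zero hp]
  | insert a s ha ih => rw [Finset.sum_insert ha, ext_add _ _ hp, ih, Finset.sum_insert ha]

end Ext


theorem differentiableAt_ext (hΩ : IsOpen Ω) (f : SmoothFun Ω) {p : V} (hp : p ∈ Ω) :
    DifferentiableAt ℝ (ext f) p :=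
  (((contDiffOn_ext f).contDiffAt (hΩ.mem_nhds hp)).differentiableAt (by simp))

theorem contDiffOn_fderiv_apply (hΩ : IsOpen Ω) {g : V → ℝ} (hg : ContDiffOn ℝ ∞ g Ω) (w : V) :
    ContDiffOn ℝ ∞ (fun p => fderiv ℝ g p w) Ω :=
  (hg.fderiv_of_isOpen hΩ (by simp)).clm_apply contDiffOn_const

/-- The derivative in the direction `w`. -/
def deriv (hΩ : IsOpen Ω) (w : V) : Derivation ℝ (SmoothFun Ω) (SmoothFun Ω) :=
  Derivation.mk'
    { toFun := fun f => restrict (fun p => fderiv ℝ (ext f) p w)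
        (contDiffOn_fderiv_apply hΩ (contDiffOn_ext f) w)
      map_add' := fun f g => by
        refine Subtype.ext (funext fun p => ?_)
        have h : (ext (f + g)) =ᶠ[𝓝 p.1] (ext f) + (ext g) :=
          Filter.eventually_of_mem (hΩ.mem_nhds p.2) fun q hq => ext_add f g hq
        change fderiv ℝ (ext (f + g)) p w = fderiv ℝ (ext f) p w + fderiv ℝ (ext g) p w
        rw [h.fderiv_eq, fderiv_add (differentiableAt_ext hΩ f p.2) (differentiableAt_ext hΩ g p.2)]
        rfl
      map_smul' := fun c f => by
        refine Subtype.ext (funext fun p => ?_)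
        have h : (ext (c • f)) =ᶠ[𝓝 p.1] c • (ext f) :=
          Filter.eventually_of_mem (hΩ.mem_nhds p.2) fun q hq => ext_smul c f hq
        change fderiv ℝ (ext (c • f)) p w = c • fderiv ℝ (ext f) p w
        rw [h.fderiv_eq, fderiv_const_smul (differentiableAt_ext hΩ f p.2)]
        rfl }
    (fun f g => by
      refine Subtype.ext (funext fun p => ?_)
      have h : (ext (f * g)) =ᶠ[𝓝 p.1] (ext f) * (ext g) :=
        Filter.eventually_of_mem (hΩ.mem_nhds p.2) fun q hq => ext_mul f g hq
      change fderiv ℝ (ext (f * g)) p w =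
          f.1 p * fderiv ℝ (ext g) p w + g.1 p * fderiv ℝ (ext f) p w
      rw [h.fderiv_eq, fderiv_mul (differentiableAt_ext hΩ f p.2) (differentiableAt_ext hΩ g p.2),
        ← ext_apply, ← ext_apply]
      rfl)

theorem ext_deriv (hΩ : IsOpen Ω) (w : V) (f : SmoothFun Ω) {p : V} (hp : p ∈ Ω) :
    (ext (deriv hΩ w f)) p = fderiv ℝ (ext f) p w :=
  ext_restrict _ (contDiffOn_fderiv_apply hΩ (contDiffOn_ext f) w) hp

theorem ext_deriv_of_eqOn (hΩ : IsOpen Ω) (w : V)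
    {f : SmoothFun Ω} {g : V → ℝ} (h : Set.EqOn (ext f) g Ω) {p : V}
    (hp : p ∈ Ω) : (ext (deriv hΩ w f)) p = fderiv ℝ g p w := by
  rw [ext_deriv hΩ w f hp, (Filter.eventuallyEq_of_mem (hΩ.mem_nhds hp) h).fderiv_eq]

theorem deriv_comm (hΩ : IsOpen Ω) (v w : V) (f : SmoothFun Ω) :
    deriv hΩ v (deriv hΩ w f) = deriv hΩ w (deriv hΩ v f) := by
  refine eq_of_ext fun p hp => ?_
  have hd : DifferentiableAt ℝ (fderiv ℝ (ext f)) p :=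
    (((contDiffOn_ext f).fderiv_of_isOpen hΩ (m := ∞) (by simp)).contDiffAt
      (hΩ.mem_nhds hp)).differentiableAt (by simp)
  have hs := ((contDiffOn_ext f).contDiffAt (hΩ.mem_nhds hp)).isSymmSndFDerivAt
    (by
      rw [minSmoothness_of_isRCLikeNormedField]
      exact WithTop.coe_le_coe.2 (le_top : (2 : ℕ∞) ≤ ⊤))
  have h : ∀ v w, ext (deriv hΩ v (deriv hΩ w f)) p = fderiv ℝ (fderiv ℝ (ext f)) p v w := by
    intro v w
    rw [ext_deriv_of_eqOn hΩ v (fun q hq => ext_deriv hΩ w f hq) hp]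
    rw [fderiv_clm_apply hd (differentiableAt_const w)]
    simp
  rw [h, h, hs.eq]

end SmoothFun

end SmoothFun

/-! ### Homogeneity along the fibres. -/

section Fibrewise

variable {E : Type*} [NormedAddCommGroup E] [NormedSpace ℝ E] {n : ℕ}
  {T : Set E}

/-- Smooth functions on `T × ℝⁿ` that are homogeneous of degree `k` in the second variable. -/
def homogeneous (T : Set E) (k : ℕ) :
    Submodule ℝ (SmoothFun (T ×ˢ (Set.univ : Set (Fin n → ℝ)))) where
  carrier := {f | ∀ x ∈ T, ∀ (c : Fin n → ℝ) (t : ℝ), (SmoothFun.ext f) (x, t • c) =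
      t ^ k * (SmoothFun.ext f) (x, c)}
  add_mem' {f g} hf hg x hx c t := by
    rw [SmoothFun.ext_add _ _ (Set.mk_mem_prod hx (Set.mem_univ _)),
        SmoothFun.ext_add _ _ (Set.mk_mem_prod hx (Set.mem_univ _)), hf x hx c t,
      hg x hx c t]
    ring
  zero_mem' x hx c t := by
    rw [SmoothFun.ext_zero (Set.mk_mem_prod hx (Set.mem_univ _)),
        SmoothFun.ext_zero (Set.mk_mem_prod hx (Set.mem_univ _)), mul_zero]
  smul_mem' a f hf x hx c t := by
    rw [SmoothFun.ext_smul _ _ (Set.mk_mem_prod hx (Set.mem_univ _)),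
        SmoothFun.ext_smul _ _ (Set.mk_mem_prod hx (Set.mem_univ _)), hf x hx c t]
    ring

theorem mul_mem_homogeneous {k l : ℕ} {f g : SmoothFun (T ×ˢ (Set.univ : Set (Fin n → ℝ)))}
    (hf : f ∈ homogeneous T k) (hg : g ∈ homogeneous T l) : f * g ∈ homogeneous T (k + l) := by
  intro x hx c t
  rw [SmoothFun.ext_mul _ _ (Set.mk_mem_prod hx (Set.mem_univ _)),
      SmoothFun.ext_mul _ _ (Set.mk_mem_prod hx (Set.mem_univ _)), hf x hx c t,
    hg x hx c t]
  ring


/-- The chain rule for the dilation `(x, c) ↦ (x, t c)`. -/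
theorem fderiv_homogeneous (hT : IsOpen T) {k : ℕ}
    {f : SmoothFun (T ×ˢ (Set.univ : Set (Fin n → ℝ)))}
    (hf : f ∈ homogeneous T k) {x : E} (hx : x ∈ T) (c : Fin n → ℝ) (t : ℝ) (w : E)
    (e : Fin n → ℝ) :
    fderiv ℝ (SmoothFun.ext f) (x, t • c) (w, t • e) =
        t ^ k * fderiv ℝ (SmoothFun.ext f) (x, c) (w, e) := by
  have hΩ : IsOpen (T ×ˢ (Set.univ : Set (Fin n → ℝ))) := hT.prod isOpen_univ
  let S : E × (Fin n → ℝ) →L[ℝ] E × (Fin n → ℝ) :=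
    (ContinuousLinearMap.id ℝ E).prodMap (t • ContinuousLinearMap.id ℝ (Fin n → ℝ))
  have hS : ∀ q : E × (Fin n → ℝ), S q = (q.1, t • q.2) := fun q => rfl
  have h : (SmoothFun.ext f) ∘ S =ᶠ[𝓝 (x, c)] fun q => t ^ k * (SmoothFun.ext f) q := by
    refine Filter.eventually_of_mem (hΩ.mem_nhds (Set.mk_mem_prod hx (Set.mem_univ _)))
        fun q hq => ?_
    exact hf q.1 hq.1 q.2 t
  have h1 := h.fderiv_eq (𝕜 := ℝ)
  have hd : ∀ d : Fin n → ℝ, DifferentiableAt ℝ (SmoothFun.ext f) (x, d) := fun d =>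
    SmoothFun.differentiableAt_ext hΩ f (Set.mk_mem_prod hx (Set.mem_univ _))
  have hd' : DifferentiableAt ℝ (SmoothFun.ext f) (S (x, c)) := hd _
  rw [fderiv_const_mul (hd c), fderiv_comp (x, c) hd' S.differentiableAt, S.fderiv] at h1
  exact DFunLike.congr_fun h1 (w, e)

theorem deriv_base_mem_homogeneous (hT : IsOpen T) {k : ℕ}
    {f : SmoothFun (T ×ˢ (Set.univ : Set (Fin n → ℝ)))}
    (hf : f ∈ homogeneous T k) (w : E) :
    SmoothFun.deriv (hT.prod isOpen_univ) (w, 0) f ∈ homogeneous T k := by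
  intro x hx c t
  rw [SmoothFun.ext_deriv _ _ _ (Set.mk_mem_prod hx (Set.mem_univ _)),
      SmoothFun.ext_deriv _ _ _ (Set.mk_mem_prod hx (Set.mem_univ _)),
    ← fderiv_homogeneous hT hf hx c t w 0, smul_zero]

theorem deriv_fibre_mem_homogeneous (hT : IsOpen T) {k : ℕ}
    {f : SmoothFun (T ×ˢ (Set.univ : Set (Fin n → ℝ)))}
    (hf : f ∈ homogeneous T (k + 1)) (e : Fin n → ℝ) :
    SmoothFun.deriv (hT.prod isOpen_univ) (0, e) f ∈ homogeneous T k := by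
  intro x hx c
  have hΩ : IsOpen (T ×ˢ (Set.univ : Set (Fin n → ℝ))) := hT.prod isOpen_univ
  set g := SmoothFun.deriv hΩ (0, e) f with hg
  -- The dilation identity carries an extra factor `t`, which can be cancelled only for `t ≠ 0`; the
  -- case `t = 0` follows by continuity.
  have h0 : ∀ t : ℝ, t ≠ 0 → (SmoothFun.ext g) (x, t • c) = t ^ k * (SmoothFun.ext g) (x, c) := by
    intro t ht
    have h := fderiv_homogeneous hT hf hx c t 0 e
    have h2 : ((0 : E), t • e) = t • ((0 : E), e) := by simp
    rw [h2, map_smul, smul_eq_mul] at h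
    rw [hg, SmoothFun.ext_deriv _ _ _ (Set.mk_mem_prod hx (Set.mem_univ _)),
        SmoothFun.ext_deriv _ _ _ (Set.mk_mem_prod hx (Set.mem_univ _))]
    apply mul_left_cancel₀ ht
    rw [h]; ring
  have hc : Continuous fun t : ℝ => (SmoothFun.ext g) (x, t • c) :=
    (SmoothFun.contDiffOn_ext g).continuousOn.comp_continuous (by fun_prop)
        fun t => (Set.mk_mem_prod hx (Set.mem_univ _))
  have h1 : (fun t : ℝ => (SmoothFun.ext g) (x, t • c)) =
      fun t : ℝ => t ^ k * (SmoothFun.ext g) (x, c) :=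
    Continuous.ext_on (dense_compl_singleton (0 : ℝ)) hc (by fun_prop) fun t ht => h0 t ht
  exact fun t => congrFun h1 t

theorem euler_homogeneous (hT : IsOpen T) {k : ℕ}
    {f : SmoothFun (T ×ˢ (Set.univ : Set (Fin n → ℝ)))}
    (hf : f ∈ homogeneous T k) {x : E} (hx : x ∈ T) (c : Fin n → ℝ) :
    fderiv ℝ (SmoothFun.ext f) (x, c) (0, c) = k * (SmoothFun.ext f) (x, c) := by
  have hΩ : IsOpen (T ×ˢ (Set.univ : Set (Fin n → ℝ))) := hT.prod isOpen_univ
  have h1 : HasDerivAt (fun t : ℝ => (SmoothFun.ext f) (x, t • c))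
      (fderiv ℝ (SmoothFun.ext f) (x, c) (0, c)) 1 := by
    have hd : HasFDerivAt (SmoothFun.ext f) (fderiv ℝ (SmoothFun.ext f) (x, c)) (x, (1 : ℝ) • c) := by
      rw [one_smul]
      exact (SmoothFun.differentiableAt_ext hΩ f
        (Set.mk_mem_prod hx (Set.mem_univ _))).hasFDerivAt
    have hl : HasDerivAt (fun t : ℝ => (x, t • c)) ((0 : E), c) 1 := by
      have := (hasDerivAt_id (1 : ℝ)).smul_const c
      simpa using (hasDerivAt_const (1 : ℝ) x).prodMk this
    exact hd.comp_hasDerivAt 1 hl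
  have h2 : HasDerivAt (fun t : ℝ => t ^ k * (SmoothFun.ext f) (x, c))
      (k * (SmoothFun.ext f) (x, c)) 1 := by
    simpa using (hasDerivAt_pow k (1 : ℝ)).mul_const ((SmoothFun.ext f) (x, c))
  have h3 : (fun t : ℝ => (SmoothFun.ext f) (x, t • c)) =
      fun t : ℝ => t ^ k * (SmoothFun.ext f) (x, c) :=
    funext fun t => hf x hx c t
  rw [h3] at h1
  exact h1.unique h2

end Fibrewise

end

/-! ### Coordinate frames, and coordinates on `T*M`. -/

section

section Frame

variable {n : ℕ} {M : Type*} [TopologicalSpace M] [ChartedSpace (EuclideanSpace ℝ (Fin n)) M]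

/-- The constant vector field on Euclidean space. -/
def constField (w : EuclideanSpace ℝ (Fin n)) (y : EuclideanSpace ℝ (Fin n)) :
    TangentSpace (𝓡 n) y :=
  (NormedSpace.fromTangentSpace y).symm w

/-- The coordinate vector field `∂_j` of a chart. -/
def coordField (φ : OpenPartialHomeomorph M (EuclideanSpace ℝ (Fin n))) (j : Fin n) :
    ∀ x : M, TangentSpace (𝓡 n) x :=
  mpullback (𝓡 n) (𝓡 n) φ (constField (EuclideanSpace.single j (1 : ℝ)))

variable {φ : OpenPartialHomeomorph M (EuclideanSpace ℝ (Fin n))}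

theorem contMDiffAt_chart (hφ : φ ∈ IsManifold.maximalAtlas (𝓡 n) ∞ M) {x : M}
    (hx : x ∈ φ.source) : ContMDiffAt (𝓡 n) (𝓡 n) ∞ φ x :=
  contMDiffAt_of_mem_maximalAtlas hφ hx

theorem mdifferentiable_of_mem_maximalAtlas (hφ : φ ∈ IsManifold.maximalAtlas (𝓡 n) ∞ M) :
    φ.MDifferentiable (𝓡 n) (𝓡 n) :=
  ⟨(contMDiffOn_of_mem_maximalAtlas hφ).mdifferentiableOn (by simp),
    (contMDiffOn_symm_of_mem_maximalAtlas hφ).mdifferentiableOn (by simp)⟩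

theorem contMDiffAt_coord (hφ : φ ∈ IsManifold.maximalAtlas (𝓡 n) ∞ M) (i : Fin n) {x : M}
    (hx : x ∈ φ.source) : ContMDiffAt (𝓡 n) 𝓘(ℝ, ℝ) ∞ (fun y => φ y i) x :=
  (EuclideanSpace.proj i : EuclideanSpace ℝ (Fin n) →L[ℝ] ℝ).contDiff.contMDiff.contMDiffAt.comp x
    (contMDiffAt_chart hφ hx)

theorem isInvertible_mfderiv_chart (hφ : φ ∈ IsManifold.maximalAtlas (𝓡 n) ∞ M) {x : M}
    (hx : x ∈ φ.source) : (mfderiv (𝓡 n) (𝓡 n) φ x).IsInvertible :=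
  ⟨(mdifferentiable_of_mem_maximalAtlas hφ).mfderiv hx, rfl⟩

theorem coordForm_apply (hφ : φ ∈ IsManifold.maximalAtlas (𝓡 n) ∞ M) (i : Fin n) {x : M}
    (hx : x ∈ φ.source) (w : TangentSpace (𝓡 n) x) :
    coordForm φ i x w = mvfderiv (𝓡 n) φ x w i := by
  let L : EuclideanSpace ℝ (Fin n) →L[ℝ] ℝ := EuclideanSpace.proj i
  have h : (fun y => φ y i) = L ∘ φ := rfl
  have hL : MDifferentiableAt (𝓡 n) 𝓘(ℝ, ℝ) L (φ x) := L.mdifferentiableAt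
  rw [coordForm, h, mvfderiv_comp_apply x hL ((contMDiffAt_chart hφ hx).mdifferentiableAt
      (by simp))]
  simp only [mvfderiv, L.mfderiv_eq]
  rfl

theorem mvfderiv_coordField (hφ : φ ∈ IsManifold.maximalAtlas (𝓡 n) ∞ M) (j : Fin n) {x : M}
    (hx : x ∈ φ.source) : mvfderiv (𝓡 n) φ x (coordField φ j x) =
      (EuclideanSpace.single j (1 : ℝ)) := by
  have h := (isInvertible_mfderiv_chart hφ hx).self_apply_inverse
    (constField (EuclideanSpace.single j (1 : ℝ)) (φ x))
  rw [mvfderiv, coordField, mpullback_apply]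
  exact congrArg (NormedSpace.fromTangentSpace (φ x)) h

theorem coordForm_coordField (hφ : φ ∈ IsManifold.maximalAtlas (𝓡 n) ∞ M) (i j : Fin n) {x : M}
    (hx : x ∈ φ.source) : coordForm φ i x (coordField φ j x) = if i = j then 1 else 0 := by
  rw [coordForm_apply hφ i hx, mvfderiv_coordField hφ j hx]
  simp

theorem sum_coordForm_smul (hφ : φ ∈ IsManifold.maximalAtlas (𝓡 n) ∞ M) {x : M}
    (hx : x ∈ φ.source) (w : TangentSpace (𝓡 n) x) :
    ∑ i, coordForm φ i x w • coordField φ i x = w := by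
  have hinj : Function.Injective (mvfderiv (𝓡 n) φ x) :=
    (NormedSpace.fromTangentSpace (φ x)).injective.comp
      (isInvertible_mfderiv_chart hφ hx).injective
  apply hinj
  rw [map_sum]
  simp only [map_smul, mvfderiv_coordField hφ _ hx, coordForm_apply hφ _ hx]
  ext j
  simp [Pi.single_apply]

theorem sum_coordField_smul (hφ : φ ∈ IsManifold.maximalAtlas (𝓡 n) ∞ M) {x : M}
    (hx : x ∈ φ.source) (a : CotangentSpace n x) :
    ∑ i, a (coordField φ i x) • coordForm φ i x = a := by
  ext w
  conv_rhs => rw [← sum_coordForm_smul hφ hx w]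
  simp [mul_comm]

/-- The coordinates of `T*M` induced by a chart of `M`: those of the base point, and those of the
covector. -/
def coords (φ : OpenPartialHomeomorph M (EuclideanSpace ℝ (Fin n))) (p : CotangentBundle n M) :
    EuclideanSpace ℝ (Fin n) × (Fin n → ℝ) :=
  (φ p.1, fun i => p.2 (coordField φ i p.1))

/-- The point of `T*M` with given coordinates. -/
def ofCoords (φ : OpenPartialHomeomorph M (EuclideanSpace ℝ (Fin n)))
    (z : EuclideanSpace ℝ (Fin n) × (Fin n → ℝ)) : CotangentBundle n M :=
  ⟨φ.symm z.1, ∑ i, z.2 i • coordForm φ i (φ.symm z.1)⟩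

theorem coords_mem {p : CotangentBundle n M} (hp : p.1 ∈ φ.source) :
    coords φ p ∈ φ.target ×ˢ (Set.univ : Set (Fin n → ℝ)) :=
  Set.mk_mem_prod (φ.map_source hp) (Set.mem_univ _)

theorem sum_smul_coordForm_apply (hφ : φ ∈ IsManifold.maximalAtlas (𝓡 n) ∞ M) {x : M}
    (hx : x ∈ φ.source) (c : Fin n → ℝ) (i : Fin n) :
    (∑ j, c j • coordForm φ j x) (coordField φ i x) = c i := by
  simp [coordForm_coordField hφ _ i hx]

theorem coords_ofCoords (hφ : φ ∈ IsManifold.maximalAtlas (𝓡 n) ∞ M)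
    {z : EuclideanSpace ℝ (Fin n) × (Fin n → ℝ)} (hz : z.1 ∈ φ.target) :
    coords φ (ofCoords φ z) = z := by
  exact Prod.ext (φ.right_inv hz)
    (funext fun i => sum_smul_coordForm_apply hφ (φ.map_target hz) z.2 i)

theorem ofCoords_coords (hφ : φ ∈ IsManifold.maximalAtlas (𝓡 n) ∞ M) {p : CotangentBundle n M}
    (hp : p.1 ∈ φ.source) : ofCoords φ (coords φ p) = p := by
  obtain ⟨x, ξ⟩ := p
  -- The base point is generalised because `φ.symm (φ x) = x` cannot be rewritten inside the
  -- dependent pair.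
  have h : ∀ y, y = x → (⟨y, ∑ i, ξ (coordField φ i x) • coordForm φ i y⟩ : CotangentBundle n M) =
      ⟨x, ξ⟩ := by
    rintro _ rfl
    exact congrArg (TotalSpace.mk _) (sum_coordField_smul hφ hp ξ)
  exact h _ (φ.left_inv hp)

variable [IsManifold (𝓡 n) ∞ M]

theorem contMDiffAt_coordField (hφ : φ ∈ IsManifold.maximalAtlas (𝓡 n) ∞ M) (j : Fin n) {x : M}
    (hx : x ∈ φ.source) : ContMDiffAt (𝓡 n) ((𝓡 n).prod 𝓘(ℝ, EuclideanSpace ℝ (Fin n))) ∞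
      (fun y => (⟨y, coordField φ j y⟩ : TotalSpace (EuclideanSpace ℝ (Fin n))
        (fun x : M => TangentSpace (𝓡 n) x))) x :=
  ContMDiffAt.mpullback_vectorField_preimage (n := ∞)
    (contMDiffAt_vectorSpace_iff_contDiffAt.2 contDiffAt_const) (contMDiffAt_chart hφ hx)
    (isInvertible_mfderiv_chart hφ hx) (by simp)

theorem contMDiffAt_differential {f : M → ℝ} {x : M} (hf : ContMDiffAt (𝓡 n) 𝓘(ℝ, ℝ) ∞ f x) :
    ContMDiffAt (𝓡 n) ((𝓡 n).prod 𝓘(ℝ, EuclideanSpace ℝ (Fin n) →L[ℝ] ℝ)) ∞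
      (fun y => (⟨y, mvfderiv (𝓡 n) f y⟩ : CotangentBundle n M)) x := by
  have h := hf.mfderiv_const (m := ∞) (by simp)
  rw [contMDiffAt_hom_bundle]
  refine ⟨contMDiffAt_id, ?_⟩
  refine h.congr_of_eventuallyEq (Filter.Eventually.of_forall fun y => ?_)
  ext w
  simp only [inTangentCoordinates, ContinuousLinearMap.inCoordinates]
  simp
  rfl

/-- A 1-form evaluated on a vector field. -/
theorem contMDiffAt_pairing {N G : Type*} {H : Type*} [TopologicalSpace H] [NormedAddCommGroup G]
    [NormedSpace ℝ G] {J : ModelWithCorners ℝ G H} [TopologicalSpace N] [ChartedSpace H N]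
    {b : N → M} {β : ∀ z, CotangentSpace n (b z)} {X : ∀ z, TangentSpace (𝓡 n) (b z)} {z : N}
    (hβ : ContMDiffAt J ((𝓡 n).prod 𝓘(ℝ, EuclideanSpace ℝ (Fin n) →L[ℝ] ℝ)) ∞
      (fun z => (⟨b z, β z⟩ : CotangentBundle n M)) z)
    (hX : ContMDiffAt J ((𝓡 n).prod 𝓘(ℝ, EuclideanSpace ℝ (Fin n))) ∞
      (fun z => (⟨b z, X z⟩ : TotalSpace (EuclideanSpace ℝ (Fin n))
        (fun x : M => TangentSpace (𝓡 n) x))) z) :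
    ContMDiffAt J 𝓘(ℝ, ℝ) ∞ (fun z => β z (X z)) z := by
  have h : ContMDiffAt J ((𝓡 n).prod 𝓘(ℝ, ℝ)) ∞
      (fun z => TotalSpace.mk' ℝ (E := Bundle.Trivial M ℝ) (b z) (β z (X z))) z :=
    ContMDiffAt.clm_bundle_apply (F₁ := EuclideanSpace ℝ (Fin n)) (F₂ := ℝ)
      (E₁ := fun y : M => TangentSpace (𝓡 n) y) (E₂ := Bundle.Trivial M ℝ) hβ hX
  rw [contMDiffAt_totalSpace] at h
  simpa using! h.2

theorem contMDiffAt_coordForm (hφ : φ ∈ IsManifold.maximalAtlas (𝓡 n) ∞ M) (i : Fin n) {x : M}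
    (hx : x ∈ φ.source) :
    ContMDiffAt (𝓡 n) ((𝓡 n).prod 𝓘(ℝ, EuclideanSpace ℝ (Fin n) →L[ℝ] ℝ)) ∞
      (fun y => (⟨y, coordForm φ i y⟩ : CotangentBundle n M)) x :=
  contMDiffAt_differential (contMDiffAt_coord hφ i hx)

/-- A linear combination of 1-forms along a map. -/
theorem contMDiffAt_sum_smul_form {N G : Type*} {H : Type*} [TopologicalSpace H]
    [NormedAddCommGroup G] [NormedSpace ℝ G] {J : ModelWithCorners ℝ G H} [TopologicalSpace N]
    [ChartedSpace H N] {ι : Type*} (s : Finset ι)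
    {b : N → M} {β : ι → ∀ z, CotangentSpace n (b z)} {c : ι → N → ℝ} {z : N}
    (hb : ContMDiffAt J (𝓡 n) ∞ b z)
    (hβ : ∀ i, ContMDiffAt J ((𝓡 n).prod 𝓘(ℝ, EuclideanSpace ℝ (Fin n) →L[ℝ] ℝ)) ∞
      (fun z => (⟨b z, β i z⟩ : CotangentBundle n M)) z)
    (hc : ∀ i, ContMDiffAt J 𝓘(ℝ, ℝ) ∞ (c i) z) :
    ContMDiffAt J ((𝓡 n).prod 𝓘(ℝ, EuclideanSpace ℝ (Fin n) →L[ℝ] ℝ)) ∞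
      (fun z => (⟨b z, ∑ i ∈ s, c i z • β i z⟩ : CotangentBundle n M)) z := by
  rw [contMDiffAt_hom_bundle]
  refine ⟨hb, ?_⟩
  have h : ∀ i, _ := fun i => ((contMDiffAt_hom_bundle _).1 (hβ i)).2
  have h' := ContMDiffAt.sum (t := s) fun i _ => (hc i).smul (h i)
  refine h'.congr_of_eventuallyEq (Filter.Eventually.of_forall fun y => ?_)
  ext w
  simp [ContinuousLinearMap.inCoordinates]

theorem contMDiffAt_coords (hφ : φ ∈ IsManifold.maximalAtlas (𝓡 n) ∞ M) {p : CotangentBundle n M}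
    (hp : p.1 ∈ φ.source) :
    ContMDiffAt ((𝓡 n).prod 𝓘(ℝ, EuclideanSpace ℝ (Fin n) →L[ℝ] ℝ))
      𝓘(ℝ, EuclideanSpace ℝ (Fin n) × (Fin n → ℝ)) ∞ (coords φ) p := by
  have hproj : ContMDiffAt ((𝓡 n).prod 𝓘(ℝ, EuclideanSpace ℝ (Fin n) →L[ℝ] ℝ)) (𝓡 n) ∞
      (fun q : CotangentBundle n M => q.1) p := contMDiffAt_proj _
  refine ContMDiffAt.prodMk_space ((contMDiffAt_chart hφ hp).comp p hproj) ?_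
  refine contMDiffAt_pi_space.2 fun i => contMDiffAt_pairing (b :=
      fun q : CotangentBundle n M => q.1)
    (β := fun q => q.2) contMDiffAt_id ?_
  exact (contMDiffAt_coordField hφ i hp).comp p hproj

theorem contMDiffAt_ofCoords (hφ : φ ∈ IsManifold.maximalAtlas (𝓡 n) ∞ M)
    {z : EuclideanSpace ℝ (Fin n) × (Fin n → ℝ)} (hz : z.1 ∈ φ.target) :
    ContMDiffAt 𝓘(ℝ, EuclideanSpace ℝ (Fin n) × (Fin n → ℝ))
      ((𝓡 n).prod 𝓘(ℝ, EuclideanSpace ℝ (Fin n) →L[ℝ] ℝ)) ∞ (ofCoords φ) z := by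
  have hb : ContMDiffAt 𝓘(ℝ, EuclideanSpace ℝ (Fin n) × (Fin n → ℝ)) (𝓡 n) ∞
      (fun z : EuclideanSpace ℝ (Fin n) × (Fin n → ℝ) => φ.symm z.1) z :=
    (contMDiffAt_symm_of_mem_maximalAtlas hφ hz).comp z contDiff_fst.contMDiff.contMDiffAt
  refine contMDiffAt_sum_smul_form univ hb (fun i => ?_) (fun i => ?_)
  · exact (contMDiffAt_coordForm hφ i (φ.map_target hz)).comp z hb
  · exact ContDiff.contMDiff (by fun_prop) |>.contMDiffAt

end Frame

end

/-! ### Extension of local objects by bump functions, and local operators in components. -/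

section

variable {n : ℕ} {M : Type*} [TopologicalSpace M] [ChartedSpace (EuclideanSpace ℝ (Fin n)) M]

section Extension

variable [IsManifold (𝓡 n) ∞ M] [T2Space M]

/-- Several axioms and hypotheses are stated for globally smooth functions, forms and fields.
Cutting off with such a function makes them available for coordinate functions, forms and fields
near a point. -/
theorem exists_contMDiff_bump {x : M} {W : Set M} (hW : W ∈ 𝓝 x) :
    ∃ ψ : M → ℝ, ContMDiff (𝓡 n) 𝓘(ℝ, ℝ) ∞ ψ ∧ tsupport ψ ⊆ W ∧ ∀ᶠ y in 𝓝 x, ψ y = 1 := by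
  obtain ⟨ψ, -, hψ⟩ := (SmoothBumpFunction.nhds_basis_tsupport (I := 𝓡 n) x).mem_iff.1 hW
  exact ⟨ψ, ψ.contMDiff, hψ, ψ.eventuallyEq_one⟩

theorem exists_contMDiff_eventuallyEq {x : M} {W : Set M} (hW : IsOpen W) (hx : x ∈ W) {g : M → ℝ}
    (hg : ∀ y ∈ W, ContMDiffAt (𝓡 n) 𝓘(ℝ, ℝ) ∞ g y) :
    ∃ g' : M → ℝ, ContMDiff (𝓡 n) 𝓘(ℝ, ℝ) ∞ g' ∧ ∀ᶠ y in 𝓝 x, g' y = g y := by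
  obtain ⟨ψ, hψ, hψW, hψ1⟩ := exists_contMDiff_bump (n := n) (hW.mem_nhds hx)
  refine ⟨fun y => ψ y * g y, contMDiff_of_tsupport fun y hy => ?_, ?_⟩
  · exact hψ.contMDiffAt.mul (hg y (hψW (tsupport_mul_subset_left hy)))
  · filter_upwards [hψ1] with y hy
    rw [hy, one_mul]

theorem exists_oneForm_eventuallyEq {x : M} {W : Set M} (hW : IsOpen W) (hx : x ∈ W)
    {β : ∀ y : M, CotangentSpace n y}
    (hβ : ∀ y ∈ W, ContMDiffAt (𝓡 n) ((𝓡 n).prod 𝓘(ℝ, EuclideanSpace ℝ (Fin n) →L[ℝ] ℝ)) ∞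
      (fun y => (⟨y, β y⟩ : CotangentBundle n M)) y) :
    ∃ α : OneForm n M, ∀ᶠ y in 𝓝 x, α y = β y := by
  obtain ⟨ψ, hψ, hψW, hψ1⟩ := exists_contMDiff_bump (n := n) (hW.mem_nhds hx)
  refine ⟨⟨fun y => ψ y • β y, ContMDiffOn.smul_section_of_tsupport hψ.contMDiffOn hW hψW
    fun y hy => (hβ y hy).contMDiffWithinAt⟩, ?_⟩
  filter_upwards [hψ1] with y hy
  change ψ y • β y = β y
  rw [hy, one_smul]

theorem exists_vField_eventuallyEq {x : M} {W : Set M} (hW : IsOpen W) (hx : x ∈ W)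
    {X : ∀ y : M, TangentSpace (𝓡 n) y}
    (hX : ∀ y ∈ W, ContMDiffAt (𝓡 n) ((𝓡 n).prod 𝓘(ℝ, EuclideanSpace ℝ (Fin n))) ∞
      (fun y => (⟨y, X y⟩ : TotalSpace (EuclideanSpace ℝ (Fin n))
        (fun x : M => TangentSpace (𝓡 n) x))) y) :
    ∃ Y : VField n M, ∀ᶠ y in 𝓝 x, Y y = X y := by
  obtain ⟨ψ, hψ, hψW, hψ1⟩ := exists_contMDiff_bump (n := n) (hW.mem_nhds hx)
  refine ⟨⟨fun y => ψ y • X y, ContMDiffOn.smul_section_of_tsupport hψ.contMDiffOn hW hψW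
    fun y hy => (hX y hy).contMDiffWithinAt⟩, ?_⟩
  filter_upwards [hψ1] with y hy
  change ψ y • X y = X y
  rw [hy, one_smul]

end Extension

section Components

variable {φ : OpenPartialHomeomorph M (EuclideanSpace ℝ (Fin n))} {x : M}

theorem mvfderiv_congr {f g : M → ℝ} (h : ∀ᶠ y in 𝓝 x, f y = g y) :
    mvfderiv (𝓡 n) f x = mvfderiv (𝓡 n) g x := by
  have h' : f =ᶠ[𝓝 x] g := h
  unfold mvfderiv
  rw [h'.mfderiv_eq, h'.eq_of_nhds]

/-- A linear function of tangent vectors at a point, in coordinates. -/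
theorem map_eq_sum_coordField (hφ : φ ∈ IsManifold.maximalAtlas (𝓡 n) ∞ M) (hx : x ∈ φ.source)
    (a : CotangentSpace n x) (w : TangentSpace (𝓡 n) x) :
    a w = ∑ k, coordForm φ k x w * a (coordField φ k x) := by
  conv_lhs => rw [← sum_coordForm_smul hφ hx w]
  simp

theorem coordForm_coordField_eventually (hφ : φ ∈ IsManifold.maximalAtlas (𝓡 n) ∞ M)
    (hx : x ∈ φ.source) (i j : Fin n) :
    ∀ᶠ y in 𝓝 x, coordForm φ i y (coordField φ j y) = if i = j then 1 else 0 := by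
  filter_upwards [φ.open_source.mem_nhds hx] with y hy using coordForm_coordField hφ i j hy

theorem coordForm_injective (hφ : φ ∈ IsManifold.maximalAtlas (𝓡 n) ∞ M)
    (hx : x ∈ φ.source) {w w' : TangentSpace (𝓡 n) x}
    (h : ∀ j, coordForm φ j x w = coordForm φ j x w') : w = w' := by
  rw [← sum_coordForm_smul hφ hx w, ← sum_coordForm_smul hφ hx w']
  simp only [h]

theorem covector_ext (hφ : φ ∈ IsManifold.maximalAtlas (𝓡 n) ∞ M)
    (hx : x ∈ φ.source) {a b : CotangentSpace n x}
    (h : ∀ k, a (coordField φ k x) = b (coordField φ k x)) : a = b := by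
  rw [← sum_coordField_smul hφ hx a, ← sum_coordField_smul hφ hx b]
  simp only [h]

variable [IsManifold (𝓡 n) ∞ M]

theorem mDiffFieldAt_coordField (hφ : φ ∈ IsManifold.maximalAtlas (𝓡 n) ∞ M)
    (hx : x ∈ φ.source) (k : Fin n) : MDiffFieldAt (coordField φ k) x :=
  (contMDiffAt_coordField hφ k hx).mdifferentiableAt (by simp)

theorem mDiffFormAt_coordForm (hφ : φ ∈ IsManifold.maximalAtlas (𝓡 n) ∞ M)
    (hx : x ∈ φ.source) (k : Fin n) : MDiffFormAt (coordForm φ k) x :=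
  (contMDiffAt_coordForm hφ k hx).mdifferentiableAt (by simp)

theorem ContravariantConnection.dual_apply {P : PoissonStructure n M}
    (D : ContravariantConnection P) {β : ∀ x : M, CotangentSpace n x} (hβ : MDiffFormAt β x)
    {X : ∀ x : M, TangentSpace (𝓡 n) x} (hX : MDiffFieldAt X x) (a : CotangentSpace n x) :
    D.dual hβ a (X x) =
      mvfderiv (𝓡 n) (fun y => β y (X y)) x (P.sharp x a) - β x (D.nabla X x a) :=
  TensorialAt.mkHom_apply (D.dual_tensorial hβ a) hX

theorem PoissonStructure.bracket_apply (P : PoissonStructure n M) (α β : OneForm n M)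
    {X : ∀ x : M, TangentSpace (𝓡 n) x} (hX : MDiffFieldAt X x) :
    P.bracket α β x (X x) = P.bracketAux (fun y => α y) (fun y => β y) X x :=
  TensorialAt.mkHom_apply (bracket_tensorial P (α.mdiffFormAt x) (β.mdiffFormAt x)) hX

/-- The components of a contravariant derivative of a vector field. -/
theorem ContravariantConnection.coordForm_nabla {P : PoissonStructure n M}
    (D : ContravariantConnection P) (hφ : φ ∈ IsManifold.maximalAtlas (𝓡 n) ∞ M)
    (hx : x ∈ φ.source) (j : Fin n) {X : ∀ x : M, TangentSpace (𝓡 n) x} (hX : MDiffFieldAt X x)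
    (a : CotangentSpace n x) :
    coordForm φ j x (D.nabla X x a) =
      mvfderiv (𝓡 n) (fun y => coordForm φ j y (X y)) x (P.sharp x a) +
        ∑ k, coordForm φ k x (X x) * coordForm φ j x (D.nabla (coordField φ k) x a) := by
  -- The covector `∇^a dx^j` takes a value depending only on `X x`, so it can be expanded in the
  -- coordinate fields, on which `dx^j` is constant.
  have h1 := D.dual_apply (mDiffFormAt_coordForm hφ hx j) hX a
  rw [map_eq_sum_coordField hφ hx] at h1
  have h2 : ∀ k, D.dual (mDiffFormAt_coordForm hφ hx j) a (coordField φ k x) =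
      - coordForm φ j x (D.nabla (coordField φ k) x a) := fun k => by
    rw [D.dual_apply _ (mDiffFieldAt_coordField hφ hx k),
      mvfderiv_congr (coordForm_coordField_eventually hφ hx j k), mvfderiv_const]
    simp
  simp only [h2, mul_neg, sum_neg_distrib] at h1
  linarith

theorem mem_maximalAtlas_chartAt (x : M) :
    chartAt (EuclideanSpace ℝ (Fin n)) x ∈ IsManifold.maximalAtlas (𝓡 n) ∞ M :=
  IsManifold.chart_mem_maximalAtlas x

/-- A contravariant connection is a local operator. -/
theorem ContravariantConnection.nabla_congr {P : PoissonStructure n M}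
    (D : ContravariantConnection P) {X Y : ∀ x : M, TangentSpace (𝓡 n) x} (hX : MDiffFieldAt X x)
    (hY : MDiffFieldAt Y x) (h : ∀ᶠ y in 𝓝 x, X y = Y y) (a : CotangentSpace n x) :
    D.nabla X x a = D.nabla Y x a := by
  have hφ := mem_maximalAtlas_chartAt (n := n) x
  have hx := mem_chart_source (EuclideanSpace ℝ (Fin n)) x
  refine coordForm_injective hφ hx fun j => ?_
  rw [D.coordForm_nabla hφ hx j hX, D.coordForm_nabla hφ hx j hY, h.self_of_nhds,
    mvfderiv_congr (h.mono fun y hy => by rw [hy])]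

/-- Coordinate fields are pullbacks of constant fields, and pullback respects the Lie bracket. -/
theorem mlieBracket_coordField (hφ : φ ∈ IsManifold.maximalAtlas (𝓡 n) ∞ M)
    (hx : x ∈ φ.source) (i k : Fin n) :
    mlieBracket (𝓡 n) (coordField φ i) (coordField φ k) x = 0 := by
  have hd : ∀ (w y : EuclideanSpace ℝ (Fin n)), MDifferentiableAt (𝓡 n)
      ((𝓡 n).prod 𝓘(ℝ, EuclideanSpace ℝ (Fin n)))
      (fun y => (⟨y, constField w y⟩ : TotalSpace (EuclideanSpace ℝ (Fin n))
        (fun x : EuclideanSpace ℝ (Fin n) => TangentSpace (𝓡 n) x))) y := fun w y =>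
    (contMDiffAt_vectorSpace_iff_contDiffAt.2 (contDiffAt_const (n := 1))).mdifferentiableAt
      (by simp)
  have : IsManifold (𝓡 n) (minSmoothness ℝ 3) M :=
    IsManifold.of_le (n := ∞) (by simpa using ENat.LEInfty.out)
  have h := mpullback_mlieBracket (n := ∞) (hd (EuclideanSpace.single i 1) (φ x))
    (hd (EuclideanSpace.single k 1) (φ x)) (contMDiffAt_chart hφ hx)
    (by simpa using ENat.LEInfty.out)
  have h0 : mlieBracket (𝓡 n) (constField (EuclideanSpace.single i (1 : ℝ)))
      (constField (EuclideanSpace.single k (1 : ℝ))) (φ x) = 0 := by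
    rw [← mlieBracketWithin_univ, mlieBracketWithin_eq_lieBracketWithin]
    change lieBracketWithin ℝ (fun _ => EuclideanSpace.single i (1 : ℝ))
      (fun _ => EuclideanSpace.single k (1 : ℝ)) Set.univ (φ x) = 0
    simp [lieBracketWithin]
  rw [coordField, coordField, ← h, mpullback_apply, h0, map_zero]

/-- The difference of the two sides is tensorial in `X`, as the Leibniz terms cancel. It is enough
to test coordinate fields, where both sides vanish. -/
theorem coordForm_mlieBracket_coordField (hφ : φ ∈ IsManifold.maximalAtlas (𝓡 n) ∞ M)
    (hx : x ∈ φ.source) (j k : Fin n) {X : ∀ x : M, TangentSpace (𝓡 n) x} (hX : MDiffFieldAt X x) :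
    coordForm φ j x (mlieBracket (𝓡 n) X (coordField φ k) x) =
      - mvfderiv (𝓡 n) (fun y => coordForm φ j y (X y)) x (coordField φ k x) := by
  have hk := mDiffFieldAt_coordField hφ hx k
  have hj := mDiffFormAt_coordForm hφ hx j
  have ht : TensorialAt (𝓡 n) (EuclideanSpace ℝ (Fin n))
      (fun X => coordForm φ j x (mlieBracket (𝓡 n) X (coordField φ k) x) +
        mvfderiv (𝓡 n) (fun y => coordForm φ j y (X y)) x (coordField φ k x)) x :=
    { smul := by
        intro f X hf hX
        have h1 := mvfderiv_fun_mul hf (mdiffAt_pair hj hX)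
        simp only [Pi.smul_apply', map_smul, smul_eq_mul, h1,
          mlieBracket_smul_left hf hX, map_add, add_apply, smul_apply]
        ring
      add := by
        intro X Y hX hY
        have h1 := mvfderiv_fun_add (mdiffAt_pair hj hX) (mdiffAt_pair hj hY)
        simp only [Pi.add_apply, map_add, h1, mlieBracket_add_left hX hY, add_apply]
        ring }
  have h0 := TensorialAt.mkHom_apply ht hX
  rw [map_eq_sum_coordField hφ hx, Finset.sum_eq_zero] at h0
  · linarith
  intro l _
  rw [TensorialAt.mkHom_apply ht (mDiffFieldAt_coordField hφ hx l), mlieBracket_coordField hφ hx,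
    mvfderiv_congr (coordForm_coordField_eventually hφ hx j l), mvfderiv_const]
  simp

end Components

namespace PoissonStructure

variable {φ : OpenPartialHomeomorph M (EuclideanSpace ℝ (Fin n))} {x : M} [IsManifold (𝓡 n) ∞ M]
  (P : PoissonStructure n M)

theorem biv_skew (x : M) (a b : CotangentSpace n x) : P.biv x a b = - P.biv x b a :=
  P.skew x a b

theorem contMDiffAt_sharpField {α : ∀ x : M, CotangentSpace n x}
    (hα : ContMDiffAt (𝓡 n) ((𝓡 n).prod 𝓘(ℝ, EuclideanSpace ℝ (Fin n) →L[ℝ] ℝ)) ∞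
      (fun y => (⟨y, α y⟩ : CotangentBundle n M)) x) :
    ContMDiffAt (𝓡 n) ((𝓡 n).prod 𝓘(ℝ, EuclideanSpace ℝ (Fin n))) ∞
      (fun y => (⟨y, P.sharpField α y⟩ : TotalSpace (EuclideanSpace ℝ (Fin n))
        (fun x : M => TangentSpace (𝓡 n) x))) x :=
  ContMDiffAt.clm_bundle_apply (F₁ := EuclideanSpace ℝ (Fin n) →L[ℝ] ℝ)
    (F₂ := EuclideanSpace ℝ (Fin n)) (E₁ := fun y : M => CotangentSpace n y)
    (E₂ := fun y : M => TangentSpace (𝓡 n) y) P.contMDiff_sharp.contMDiffAt hα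

/-- The local components `π^{ij}`. -/
def bivCoord (φ : OpenPartialHomeomorph M (EuclideanSpace ℝ (Fin n))) (i j : Fin n) (y : M) : ℝ :=
  P.biv y (coordForm φ i y) (coordForm φ j y)

theorem contMDiffAt_bivCoord (hφ : φ ∈ IsManifold.maximalAtlas (𝓡 n) ∞ M) (hx : x ∈ φ.source)
    (i j : Fin n) : ContMDiffAt (𝓡 n) 𝓘(ℝ, ℝ) ∞ (P.bivCoord φ i j) x :=
  contMDiffAt_pairing (b := fun y : M => y) (contMDiffAt_coordForm hφ j hx)
    (P.contMDiffAt_sharpField (contMDiffAt_coordForm hφ i hx))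

theorem apply_sharp_coordForm (hφ : φ ∈ IsManifold.maximalAtlas (𝓡 n) ∞ M) (hx : x ∈ φ.source)
    (i : Fin n) (a : CotangentSpace n x) :
    a (P.sharp x (coordForm φ i x)) = ∑ m, P.bivCoord φ i m x * a (coordField φ m x) :=
  map_eq_sum_coordField hφ hx a _

/-- Evaluated on `∂_k`, each Lie derivative contributes `∂_k π^{ij}` and the exact term removes one
of the two copies. -/
theorem bracket_eq_mvfderiv (hφ : φ ∈ IsManifold.maximalAtlas (𝓡 n) ∞ M) (hx : x ∈ φ.source)
    {i j : Fin n} {α β : OneForm n M} (hα : ∀ᶠ y in 𝓝 x, α y = coordForm φ i y)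
    (hβ : ∀ᶠ y in 𝓝 x, β y = coordForm φ j y) :
    P.bracket α β x = mvfderiv (𝓡 n) (P.bivCoord φ i j) x := by
  refine covector_ext hφ hx fun k => ?_
  have hk := mDiffFieldAt_coordField hφ hx k
  have hsm : ∀ γ : OneForm n M, MDiffFieldAt (P.sharpField fun y => γ y) x := fun γ =>
    (P.contMDiffAt_sharpField γ.contMDiff.contMDiffAt).mdifferentiableAt (by simp)
  have h1 : ∀ᶠ y in 𝓝 x, β y (coordField φ k y) = if j = k then 1 else 0 := by
    filter_upwards [hβ, coordForm_coordField_eventually hφ hx j k] with y h1 h2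
    rw [h1, h2]
  have h2 : ∀ᶠ y in 𝓝 x, α y (coordField φ k y) = if i = k then 1 else 0 := by
    filter_upwards [hα, coordForm_coordField_eventually hφ hx i k] with y h1 h2
    rw [h1, h2]
  have h3 : ∀ᶠ y in 𝓝 x, P.biv y (α y) (β y) = P.bivCoord φ i j y := by
    filter_upwards [hα, hβ] with y h1 h2
    rw [h1, h2, bivCoord]
  have h4 : ∀ᶠ y in 𝓝 x, coordForm φ j y (P.sharpField (fun y => α y) y) = P.bivCoord φ i j y := by
    filter_upwards [hα] with y h1
    rw [sharpField, h1, bivCoord, biv]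
  have h5 : ∀ᶠ y in 𝓝 x, coordForm φ i y (P.sharpField (fun y => β y) y) =
      - P.bivCoord φ i j y := by
    filter_upwards [hβ] with y h1
    rw [sharpField, h1, bivCoord, biv_skew, biv, neg_neg]
  have hneg : mvfderiv (𝓡 n) (fun y => - P.bivCoord φ i j y) x =
      - mvfderiv (𝓡 n) (P.bivCoord φ i j) x := mvfderiv_neg
  rw [P.bracket_apply α β hk, bracketAux, mvfderiv_congr h1, mvfderiv_congr h2, mvfderiv_congr h3,
    hα.self_of_nhds, hβ.self_of_nhds, coordForm_mlieBracket_coordField hφ hx j k (hsm α),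
    coordForm_mlieBracket_coordField hφ hx i k (hsm β), mvfderiv_congr h4, mvfderiv_congr h5, hneg,
    mvfderiv_const, mvfderiv_const]
  simp

end PoissonStructure

end

/-! ### Christoffel symbols and the coordinate forms of Jacobi, torsion-freeness and association. -/

section

variable {n : ℕ} {M : Type*} [TopologicalSpace M] [ChartedSpace (EuclideanSpace ℝ (Fin n)) M]

section Christoffel

variable {φ : OpenPartialHomeomorph M (EuclideanSpace ℝ (Fin n))} {x : M} [IsManifold (𝓡 n) ∞ M]
  {P : PoissonStructure n M}

/-- The Christoffel symbols `Γ^{ij}_k`, defined by `∇^{dx^i} ∂_k = Γ^{ij}_k ∂_j`. -/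
def ContravariantConnection.christoffel (D : ContravariantConnection P)
    (φ : OpenPartialHomeomorph M (EuclideanSpace ℝ (Fin n))) (i j k : Fin n) (y : M) : ℝ :=
  coordForm φ j y (D.nabla (coordField φ k) y (coordForm φ i y))

theorem exists_oneForm_eq_coordForm [T2Space M] (hφ : φ ∈ IsManifold.maximalAtlas (𝓡 n) ∞ M)
    (hx : x ∈ φ.source) (i : Fin n) :
    ∃ α : OneForm n M, ∀ᶠ y in 𝓝 x, α y = coordForm φ i y :=
  exists_oneForm_eventuallyEq φ.open_source hx fun _ hy => contMDiffAt_coordForm hφ i hy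

/-- Smoothness of `∇` is given for global forms and fields. Locality of `∇` transfers it to `dx^i`
and `∂_k`. -/
theorem ContravariantConnection.contMDiffAt_christoffel [T2Space M]
    (D : ContravariantConnection P) (hφ : φ ∈ IsManifold.maximalAtlas (𝓡 n) ∞ M)
    (hx : x ∈ φ.source) (i j k : Fin n) :
    ContMDiffAt (𝓡 n) 𝓘(ℝ, ℝ) ∞ (D.christoffel φ i j k) x := by
  obtain ⟨α, hα⟩ := exists_oneForm_eq_coordForm hφ hx i
  obtain ⟨X, hX⟩ := exists_vField_eventuallyEq φ.open_source hx
    fun _ hy => contMDiffAt_coordField hφ k hy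
  have h := contMDiffAt_pairing (b := fun y : M => y) (contMDiffAt_coordForm hφ j hx)
    (D.smooth X α x)
  refine h.congr_of_eventuallyEq ?_
  filter_upwards [hα, hX.eventually_nhds, φ.open_source.mem_nhds hx] with y h1 h2 hy
  rw [christoffel, D.nabla_congr (X.contMDiff.contMDiffAt.mdifferentiableAt (by simp))
    (mDiffFieldAt_coordField hφ hy k) h2, h1]

variable [T2Space M] {D D' : ContravariantConnection P}

/-- The Jacobi identity for cut-off coordinate functions, whose differentials near `x` are the
`dx^a`. -/
theorem PoissonStructure.jacobi_coord (P : PoissonStructure n M)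
    (hφ : φ ∈ IsManifold.maximalAtlas (𝓡 n) ∞ M) (hx : x ∈ φ.source) (l i j : Fin n) :
    (∑ m, P.bivCoord φ l m x * mvfderiv (𝓡 n) (P.bivCoord φ i j) x (coordField φ m x)) +
      (∑ m, P.bivCoord φ i m x * mvfderiv (𝓡 n) (P.bivCoord φ j l) x (coordField φ m x)) +
      (∑ m, P.bivCoord φ j m x * mvfderiv (𝓡 n) (P.bivCoord φ l i) x (coordField φ m x)) = 0 := by
  have hc : ∀ a : Fin n, ∃ g : M → ℝ, ContMDiff (𝓡 n) 𝓘(ℝ, ℝ) ∞ g ∧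
      ∀ᶠ y in 𝓝 x, mvfderiv (𝓡 n) g y = coordForm φ a y := fun a => by
    obtain ⟨g, hg, hgx⟩ := exists_contMDiff_eventuallyEq φ.open_source hx
      fun _ hy => contMDiffAt_coord hφ a hy
    exact ⟨g, hg, hgx.eventually_nhds.mono fun y hy => mvfderiv_congr hy⟩
  have hb : ∀ (a b c : Fin n) (f g h : M → ℝ), (∀ᶠ y in 𝓝 x, mvfderiv (𝓡 n) f y = coordForm φ a y) →
      (∀ᶠ y in 𝓝 x, mvfderiv (𝓡 n) g y = coordForm φ b y) →
      (∀ᶠ y in 𝓝 x, mvfderiv (𝓡 n) h y = coordForm φ c y) →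
      functionBracket P.sharp f (functionBracket P.sharp g h) x =
        ∑ m, P.bivCoord φ a m x * mvfderiv (𝓡 n) (P.bivCoord φ b c) x (coordField φ m x) := by
    intro a b c f g h hf hg hh
    have : ∀ᶠ y in 𝓝 x, functionBracket P.sharp g h y = P.bivCoord φ b c y := by
      filter_upwards [hg, hh] with y h1 h2
      rw [functionBracket, h1, h2, PoissonStructure.bivCoord, PoissonStructure.biv]
    rw [functionBracket, mvfderiv_congr this, hf.self_of_nhds, P.apply_sharp_coordForm hφ hx]
  obtain ⟨f, hf, hfx⟩ := hc l
  obtain ⟨g, hg, hgx⟩ := hc i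
  obtain ⟨h, hh, hhx⟩ := hc j
  have key := congrFun (P.jacobi f g h hf hg hh) x
  simp only [Pi.add_apply, hb l i j f g h hfx hgx hhx, hb i j l g h f hgx hhx hfx,
    hb j l i h f g hhx hfx hgx] at key
  exact key

theorem ContravariantConnection.TorsionFree.coord (htors : D'.TorsionFree)
    (hφ : φ ∈ IsManifold.maximalAtlas (𝓡 n) ∞ M) (hx : x ∈ φ.source) (i j k : Fin n) :
    D'.christoffel φ j i k x - D'.christoffel φ i j k x =
      mvfderiv (𝓡 n) (P.bivCoord φ i j) x (coordField φ k x) := by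
  obtain ⟨α, hα⟩ := exists_oneForm_eq_coordForm hφ hx i
  obtain ⟨β, hβ⟩ := exists_oneForm_eq_coordForm hφ hx j
  have h := congrArg (fun a : CotangentSpace n x => a (coordField φ k x)) (htors α β x)
  have hk := mDiffFieldAt_coordField hφ hx k
  have h1 : ∀ᶠ y in 𝓝 x, β y (coordField φ k y) = if j = k then 1 else 0 := by
    filter_upwards [hβ, coordForm_coordField_eventually hφ hx j k] with y h1 h2
    rw [h1, h2]
  have h2 : ∀ᶠ y in 𝓝 x, α y (coordField φ k y) = if i = k then 1 else 0 := by
    filter_upwards [hα, coordForm_coordField_eventually hφ hx i k] with y h1 h2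
    rw [h1, h2]
  simp only [sub_apply, D'.dual_apply _ hk, P.bracket_eq_mvfderiv hφ hx hα hβ,
    mvfderiv_congr h1, mvfderiv_congr h2, hα.self_of_nhds, hβ.self_of_nhds] at h
  rw [mvfderiv_const, mvfderiv_const] at h
  simp only [zero_apply] at h
  rw [christoffel, christoffel]
  linarith

/-- In the `j`-th component of the association identity for `dx^l`, `dx^i`, the three terms with
derivatives of `π` cancel by the Jacobi identity, and only the Christoffel terms remain. -/
theorem ContravariantConnection.Associated.coord (hassoc : Associated D D')
    (hφ : φ ∈ IsManifold.maximalAtlas (𝓡 n) ∞ M) (hx : x ∈ φ.source) (i j l : Fin n) :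
    ∑ k, D.christoffel φ i j k x * P.bivCoord φ l k x =
      ∑ k, P.bivCoord φ i k x * D'.christoffel φ l j k x := by
  obtain ⟨α, hα⟩ := exists_oneForm_eq_coordForm hφ hx l
  obtain ⟨β, hβ⟩ := exists_oneForm_eq_coordForm hφ hx i
  have h := congrArg (coordForm φ j x) (hassoc α β x)
  have hsm : ∀ γ : OneForm n M, MDiffFieldAt (P.sharpField fun y => γ y) x := fun γ =>
    (P.contMDiffAt_sharpField γ.contMDiff.contMDiffAt).mdifferentiableAt (by simp)
  have hc : ∀ (a : Fin n) (γ : OneForm n M), (∀ᶠ y in 𝓝 x, γ y = coordForm φ a y) →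
      ∀ᶠ y in 𝓝 x, coordForm φ j y (P.sharpField (fun y => γ y) y) = P.bivCoord φ a j y :=
    fun a γ hγ => hγ.mono fun y hy => by
      rw [PoissonStructure.sharpField, hy, PoissonStructure.bivCoord, PoissonStructure.biv]
  have hs : ∀ (a k : Fin n) (γ : OneForm n M), (∀ᶠ y in 𝓝 x, γ y = coordForm φ a y) →
      coordForm φ k x (P.sharpField (fun y => γ y) x) = P.bivCoord φ a k x :=
    fun a k γ hγ => by
      rw [PoissonStructure.sharpField, hγ.self_of_nhds, PoissonStructure.bivCoord,
        PoissonStructure.biv]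
  have h3 : coordForm φ j x (P.sharp x (mvfderiv (𝓡 n) (P.bivCoord φ l i) x)) =
      - ∑ m, P.bivCoord φ j m x * mvfderiv (𝓡 n) (P.bivCoord φ l i) x (coordField φ m x) := by
    rw [P.skew, P.apply_sharp_coordForm hφ hx]
  have hneg : ∀ w, mvfderiv (𝓡 n) (P.bivCoord φ j l) x w =
      - mvfderiv (𝓡 n) (P.bivCoord φ l j) x w := fun w => by
    have h1 : P.bivCoord φ j l = fun y => - P.bivCoord φ l j y := funext fun y => P.biv_skew y _ _
    have h2 : mvfderiv (𝓡 n) (fun y => - P.bivCoord φ l j y) x =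
      - mvfderiv (𝓡 n) (P.bivCoord φ l j) x := mvfderiv_neg
    rw [h1, h2, neg_apply]
  have hJ := P.jacobi_coord hφ hx l i j
  rw [map_sub, map_sub, map_zero, D'.coordForm_nabla hφ hx j (hsm β),
    D.coordForm_nabla hφ hx j (hsm α), mvfderiv_congr (hc i β hβ), mvfderiv_congr (hc l α hα),
    P.bracket_eq_mvfderiv hφ hx hα hβ, hα.self_of_nhds, hβ.self_of_nhds, h3,
    P.apply_sharp_coordForm hφ hx, P.apply_sharp_coordForm hφ hx] at h
  simp only [hs _ _ _ hα, hs _ _ _ hβ] at h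
  simp only [hneg, mul_neg, sum_neg_distrib] at hJ
  simp only [christoffel, mul_comm (coordForm φ j x _)]
  linarith

/-- Torsion-freeness of `D'` writes the derivatives of `π` as antisymmetrised symbols of `D'`.
Association turns `π Γ'` into `Γ π`, so it is `D` for which `π` is parallel. -/
theorem ContravariantConnection.Associated.parallel_coord (hassoc : Associated D D')
    (htors : D'.TorsionFree) (hφ : φ ∈ IsManifold.maximalAtlas (𝓡 n) ∞ M) (hx : x ∈ φ.source)
    (i a s : Fin n) :
    ∑ m, P.bivCoord φ i m x * mvfderiv (𝓡 n) (P.bivCoord φ a s) x (coordField φ m x) =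
      ∑ k, P.bivCoord φ s k x * D.christoffel φ i a k x -
        ∑ k, P.bivCoord φ a k x * D.christoffel φ i s k x := by
  simp only [mul_comm (P.bivCoord φ s _ x), mul_comm (P.bivCoord φ a _ x), hassoc.coord hφ hx,
    ← htors.coord hφ hx, mul_sub, sum_sub_distrib]

end Christoffel

/-! ### The induced connection on `T*M` in coordinates. -/

section Bar

variable {φ : OpenPartialHomeomorph M (EuclideanSpace ℝ (Fin n))}

theorem fibreDeriv_eq_fderiv {p : CotangentBundle n M} {g : CotangentBundle n M → ℝ}
    {G : EuclideanSpace ℝ (Fin n) × (Fin n → ℝ) → ℝ} (hG : DifferentiableAt ℝ G (coords φ p))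
    (hg : ∀ ζ : CotangentSpace n p.1, g ⟨p.1, ζ⟩ = G (coords φ ⟨p.1, ζ⟩))
    (η : CotangentSpace n p.1) :
    fibreDeriv g p η = fderiv ℝ G (coords φ p) (0, fun i => η (coordField φ i p.1)) := by
  have h : ∀ t : ℝ, g ⟨p.1, p.2 + t • η⟩ =
      G (coords φ p + t • ((0, fun i => η (coordField φ i p.1)) :
        EuclideanSpace ℝ (Fin n) × (Fin n → ℝ))) := fun t => by
    rw [hg]
    congr 1
    refine Prod.ext ?_ (funext fun i => ?_)
    · simp [coords]
    · simp [coords]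
  rw [fibreDeriv, lineDeriv, ← hG.lineDeriv_eq_fderiv, lineDeriv]
  exact congrArg (deriv · 0) (funext h)

theorem mvfderiv_clm_comp {V W : Type*} [NormedAddCommGroup V] [NormedSpace ℝ V]
    [NormedAddCommGroup W] [NormedSpace ℝ W] (L : V →L[ℝ] W) {H : M → V} {x : M}
    (hH : MDifferentiableAt (𝓡 n) 𝓘(ℝ, V) H x) (w : TangentSpace (𝓡 n) x) :
    mvfderiv (𝓡 n) (fun y => L (H y)) x w = L (mvfderiv (𝓡 n) H x w) := by
  have h : (fun y => L (H y)) = L ∘ H := rfl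
  have hL : MDifferentiableAt 𝓘(ℝ, V) 𝓘(ℝ, W) L (H x) := L.mdifferentiableAt
  have h' := mfderiv_comp_apply x hL hH w
  rw [L.mfderiv_eq] at h'
  rw [h, mvfderiv]
  exact h'

theorem mvfderiv_comp_fderiv {V : Type*} [NormedAddCommGroup V] [NormedSpace ℝ V]
    {G : V → ℝ} {H : M → V} {x : M} (hG : DifferentiableAt ℝ G (H x))
    (hH : MDifferentiableAt (𝓡 n) 𝓘(ℝ, V) H x) (w : TangentSpace (𝓡 n) x) :
    mvfderiv (𝓡 n) (fun y => G (H y)) x w = fderiv ℝ G (H x) (mvfderiv (𝓡 n) H x w) := by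
  have h : (fun y => G (H y)) = G ∘ H := rfl
  rw [h, mvfderiv_comp_apply x hG.mdifferentiableAt hH]
  simp only [mvfderiv, mfderiv_eq_fderiv]
  rfl

variable [IsManifold (𝓡 n) ∞ M] {P : PoissonStructure n M} (D : ContravariantConnection P)

/-- The induced connection in coordinates. -/
theorem ContravariantConnection.bar_eq_fderiv (hφ : φ ∈ IsManifold.maximalAtlas (𝓡 n) ∞ M)
    {p : CotangentBundle n M} (hp : p.1 ∈ φ.source) {g : CotangentBundle n M → ℝ}
    {G : EuclideanSpace ℝ (Fin n) × (Fin n → ℝ) → ℝ} (hG : DifferentiableAt ℝ G (coords φ p))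
    (hg : ∀ᶠ y in 𝓝 p.1, ∀ ζ : CotangentSpace n y, g ⟨y, ζ⟩ = G (coords φ ⟨y, ζ⟩))
    (α : ∀ x : M, CotangentSpace n x) :
    D.bar α g p = fderiv ℝ G (coords φ p) (mvfderiv (𝓡 n) φ p.1 (P.sharp p.1 (α p.1)),
      fun i => p.2 (D.nabla (coordField φ i) p.1 (α p.1))) := by
  obtain ⟨x, ξ⟩ := p
  let β : ∀ y : M, CotangentSpace n y := fun y => extend (EuclideanSpace ℝ (Fin n) →L[ℝ] ℝ)
      (E := fun y : M => CotangentSpace n y) ξ y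
  have hβ : MDiffFormAt β x := mdiffFormAt_extend ξ
  have hβx : β x = ξ := extend_apply_self (EuclideanSpace ℝ (Fin n) →L[ℝ] ℝ) ξ
  let H : M → EuclideanSpace ℝ (Fin n) × (Fin n → ℝ) := fun y => coords φ ⟨y, β y⟩
  have hH : H x = coords φ ⟨x, ξ⟩ := by simp only [H, hβx]
  have hHd : MDifferentiableAt (𝓡 n) 𝓘(ℝ, EuclideanSpace ℝ (Fin n) × (Fin n → ℝ)) H x :=
    ((contMDiffAt_coords hφ (p := ⟨x, β x⟩) hp).mdifferentiableAt (by simp)).comp x hβ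
  have h1 : ∀ᶠ y in 𝓝 x, g ⟨y, β y⟩ = G (H y) := hg.mono fun y hy => hy _
  have h2 : ∀ w, mvfderiv (𝓡 n) H x w = (mvfderiv (𝓡 n) φ x w,
      fun i => mvfderiv (𝓡 n) (fun y => β y (coordField φ i y)) x w) := fun w => by
    refine Prod.ext ?_ (funext fun i => ?_)
    · exact (mvfderiv_clm_comp (ContinuousLinearMap.fst ℝ _ _) hHd w).symm
    · exact (mvfderiv_clm_comp ((ContinuousLinearMap.proj i).comp
        (ContinuousLinearMap.snd ℝ _ _)) hHd w).symm
  -- Both terms of `bar` are values of the same differential of `G`. The derivatives of the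
  -- components of `β` cancel against those inside `∇^α β`, so the choice of the extension of `ξ`
  -- does not matter.
  rw [bar, fibreDeriv_eq_fderiv hG hg.self_of_nhds, mvfderiv_congr h1,
    mvfderiv_comp_fderiv (hH ▸ hG) hHd, hH, h2, ← map_sub]
  congr 1
  refine Prod.ext ?_ (funext fun i => ?_)
  · simp
  · have := D.dual_apply hβ (mDiffFieldAt_coordField hφ hp i) (α x)
    rw [hβx] at this
    simp only [Prod.snd_sub, Pi.sub_apply]
    rw [this]
    ring

end Bar

end

/-! ### The ring of functions on a cotangent chart. -/

section

theorem ChartFun.isOpen_domain {n : ℕ} {M : Type*} [TopologicalSpace M]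
    (φ : OpenPartialHomeomorph M (EuclideanSpace ℝ (Fin n))) :
    IsOpen (φ.target ×ˢ (Set.univ : Set (Fin n → ℝ))) :=
  φ.open_target.prod isOpen_univ

variable {n : ℕ} {M : Type*} [TopologicalSpace M] [ChartedSpace (EuclideanSpace ℝ (Fin n)) M]

/-- Smooth functions of the coordinates of `T*M` induced by a chart. -/
abbrev ChartFun (φ : OpenPartialHomeomorph M (EuclideanSpace ℝ (Fin n))) : Type :=
  SmoothFun (φ.target ×ˢ (Set.univ : Set (Fin n → ℝ)))

namespace ChartFun

variable {φ : OpenPartialHomeomorph M (EuclideanSpace ℝ (Fin n))}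

/-- The function on `T*M` with a given expression in coordinates. -/
def ev (f : ChartFun φ) (p : CotangentBundle n M) : ℝ := SmoothFun.ext f (coords φ p)

section Ring

variable {p : CotangentBundle n M}

theorem ev_add (f g : ChartFun φ) (hp : p.1 ∈ φ.source) : ev (f + g) p = ev f p + ev g p :=
  SmoothFun.ext_add f g (coords_mem hp)

theorem ev_sub (f g : ChartFun φ) (hp : p.1 ∈ φ.source) : ev (f - g) p = ev f p - ev g p :=
  SmoothFun.ext_sub f g (coords_mem hp)

theorem ev_neg (f : ChartFun φ) (hp : p.1 ∈ φ.source) : ev (-f) p = -ev f p :=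
  SmoothFun.ext_neg f (coords_mem hp)

theorem ev_mul (f g : ChartFun φ) (hp : p.1 ∈ φ.source) : ev (f * g) p = ev f p * ev g p :=
  SmoothFun.ext_mul f g (coords_mem hp)

theorem ev_zero (hp : p.1 ∈ φ.source) : ev (0 : ChartFun φ) p = 0 :=
  SmoothFun.ext_zero (coords_mem hp)

theorem ev_one (hp : p.1 ∈ φ.source) : ev (1 : ChartFun φ) p = 1 :=
  SmoothFun.ext_one (coords_mem hp)

theorem ev_algebraMap (c : ℝ) (hp : p.1 ∈ φ.source) :
    ev (algebraMap ℝ (ChartFun φ) c) p = c :=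
  SmoothFun.ext_algebraMap c (coords_mem hp)

theorem ev_sum {ι : Type*} (s : Finset ι) (f : ι → ChartFun φ) (hp : p.1 ∈ φ.source) :
    ev (∑ i ∈ s, f i) p = ∑ i ∈ s, ev (f i) p :=
  SmoothFun.ext_sum s f (coords_mem hp)

end Ring

theorem eq_of_ev (hφ : φ ∈ IsManifold.maximalAtlas (𝓡 n) ∞ M) {f g : ChartFun φ}
    (h : ∀ p : CotangentBundle n M, p.1 ∈ φ.source → ev f p = ev g p) : f = g := by
  refine SmoothFun.eq_of_ext fun z hz => ?_
  have := h (ofCoords φ z) (φ.map_target hz.1)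
  rwa [ev, ev, coords_ofCoords hφ hz.1] at this

theorem differentiableAt_ext (f : ChartFun φ) {p : CotangentBundle n M} (hp : p.1 ∈ φ.source) :
    DifferentiableAt ℝ (SmoothFun.ext f) (coords φ p) :=
  SmoothFun.differentiableAt_ext (isOpen_domain φ) f (coords_mem hp)

/-- The derivation `∂/∂x^m`. -/
def dx (φ : OpenPartialHomeomorph M (EuclideanSpace ℝ (Fin n))) (m : Fin n) :
    Derivation ℝ (ChartFun φ) (ChartFun φ) :=
  SmoothFun.deriv (isOpen_domain φ) (EuclideanSpace.single m 1, 0)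

/-- The derivation `∂/∂ξ_m`. -/
def dξ (φ : OpenPartialHomeomorph M (EuclideanSpace ℝ (Fin n))) (m : Fin n) :
    Derivation ℝ (ChartFun φ) (ChartFun φ) :=
  SmoothFun.deriv (isOpen_domain φ) (0, Pi.single m 1)

theorem ev_dx (f : ChartFun φ) (m : Fin n) {p : CotangentBundle n M} (hp : p.1 ∈ φ.source) :
    ev (dx φ m f) p =
      fderiv ℝ (SmoothFun.ext f) (coords φ p) (EuclideanSpace.single m 1, 0) :=
  SmoothFun.ext_deriv (isOpen_domain φ) _ f (coords_mem hp)

theorem ev_dξ (f : ChartFun φ) (m : Fin n) {p : CotangentBundle n M} (hp : p.1 ∈ φ.source) :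
    ev (dξ φ m f) p = fderiv ℝ (SmoothFun.ext f) (coords φ p) (0, Pi.single m 1) :=
  SmoothFun.ext_deriv (isOpen_domain φ) _ f (coords_mem hp)

theorem fderiv_ext_apply (f : ChartFun φ) {p : CotangentBundle n M} (hp : p.1 ∈ φ.source)
    (w : EuclideanSpace ℝ (Fin n)) (c : Fin n → ℝ) :
    fderiv ℝ (SmoothFun.ext f) (coords φ p) (w, c) =
      ∑ j, w j * ev (dx φ j f) p + ∑ k, c k * ev (dξ φ k f) p := by
  have h : (w, c) = ∑ j, w j • ((EuclideanSpace.single j (1 : ℝ), 0) :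
      EuclideanSpace ℝ (Fin n) × (Fin n → ℝ)) + ∑ k, c k • (0, Pi.single k (1 : ℝ)) := by
    refine Prod.ext ?_ ?_
    · ext i
      simp [Prod.fst_sum, Pi.single_apply]
    · ext i
      simp [Prod.snd_sum, Finset.sum_apply, Pi.single_apply]
  rw [h, map_add, map_sum, map_sum]
  simp only [map_smul, smul_eq_mul, ev_dx f _ hp, ev_dξ f _ hp]

theorem fibreDeriv_of_ev {f : ChartFun φ} {g : CotangentBundle n M → ℝ} {p : CotangentBundle n M}
    (hp : p.1 ∈ φ.source) (hg : ∀ ζ : CotangentSpace n p.1, g ⟨p.1, ζ⟩ = ev f ⟨p.1, ζ⟩)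
    (η : CotangentSpace n p.1) :
    fibreDeriv g p η = ∑ s, η (coordField φ s p.1) * ev (dξ φ s f) p := by
  rw [fibreDeriv_eq_fderiv (differentiableAt_ext f hp) hg, fderiv_ext_apply f hp]
  simp

theorem contMDiffAt_ev [IsManifold (𝓡 n) ∞ M] (hφ : φ ∈ IsManifold.maximalAtlas (𝓡 n) ∞ M)
    (f : ChartFun φ) {p : CotangentBundle n M} (hp : p.1 ∈ φ.source) :
    ContMDiffAt ((𝓡 n).prod 𝓘(ℝ, EuclideanSpace ℝ (Fin n) →L[ℝ] ℝ)) 𝓘(ℝ, ℝ) ∞ (ev f) p :=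
  ((SmoothFun.contDiffOn_ext f).contDiffAt
    ((isOpen_domain φ).mem_nhds (coords_mem hp))).contMDiffAt.comp p (contMDiffAt_coords hφ hp)

section OfBundle

variable [IsManifold (𝓡 n) ∞ M] (hφ : φ ∈ IsManifold.maximalAtlas (𝓡 n) ∞ M)

/-- The coordinate expression of a function on `T*M`. -/
def ofBundle (g : CotangentBundle n M → ℝ)
    (hg : ContMDiffOn ((𝓡 n).prod 𝓘(ℝ, EuclideanSpace ℝ (Fin n) →L[ℝ] ℝ)) 𝓘(ℝ, ℝ) ∞ g
      {p | p.1 ∈ φ.source}) : ChartFun φ :=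
  SmoothFun.restrict (fun z => g (ofCoords φ z)) (by
    rw [← contMDiffOn_iff_contDiffOn]
    exact hg.comp (fun z hz => (contMDiffAt_ofCoords hφ hz.1).contMDiffWithinAt)
      fun z hz => φ.map_target hz.1)

theorem ev_ofBundle {g : CotangentBundle n M → ℝ}
    (hg : ContMDiffOn ((𝓡 n).prod 𝓘(ℝ, EuclideanSpace ℝ (Fin n) →L[ℝ] ℝ)) 𝓘(ℝ, ℝ) ∞ g
      {p | p.1 ∈ φ.source}) {p : CotangentBundle n M} (hp : p.1 ∈ φ.source) :
    ev (ofBundle hφ g hg) p = g p := by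
  rw [ev, ofBundle, SmoothFun.ext_restrict _ _ (coords_mem hp), ofCoords_coords hφ hp]

/-- The coordinate expression of a function on `M`. -/
def ofBase (g : M → ℝ) (hg : ∀ x ∈ φ.source, ContMDiffAt (𝓡 n) 𝓘(ℝ, ℝ) ∞ g x) : ChartFun φ :=
  ofBundle hφ (fun p => g p.1) fun p hp =>
    ((hg p.1 hp).comp p (contMDiffAt_proj _)).contMDiffWithinAt

variable {g : M → ℝ} (hg : ∀ x ∈ φ.source, ContMDiffAt (𝓡 n) 𝓘(ℝ, ℝ) ∞ g x)

theorem ev_ofBase {p : CotangentBundle n M} (hp : p.1 ∈ φ.source) :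
    ev (ofBase hφ g hg) p = g p.1 := ev_ofBundle hφ _ hp

theorem dξ_ofBase (m : Fin n) : dξ φ m (ofBase hφ g hg) = 0 := by
  refine eq_of_ev hφ fun p hp => ?_
  have h := fibreDeriv_of_ev (f := ofBase hφ g hg) (g := fun p => g p.1) hp
    (fun ζ => (ev_ofBase hφ hg (p := ⟨p.1, ζ⟩) hp).symm) (coordForm φ m p.1)
  have h0 : fibreDeriv (fun p : CotangentBundle n M => g p.1) p (coordForm φ m p.1) = 0 := by
    simp [fibreDeriv, lineDeriv]
  rw [h0] at h
  simpa [coordForm_coordField hφ _ _ hp, ev_zero hp] using h.symm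

theorem ev_dx_ofBase (m : Fin n) {p : CotangentBundle n M} (hp : p.1 ∈ φ.source) :
    ev (dx φ m (ofBase hφ g hg)) p = mvfderiv (𝓡 n) g p.1 (coordField φ m p.1) := by
  -- A slice with the fibre coordinates frozen at those of `p`; along it the coordinate expression
  -- is that of `g` on the base.
  let ι : EuclideanSpace ℝ (Fin n) → EuclideanSpace ℝ (Fin n) × (Fin n → ℝ) :=
    fun z => (z, (coords φ p).2)
  have hι : HasFDerivAt ι (ContinuousLinearMap.inl ℝ _ _) (φ p.1) :=
    (hasFDerivAt_id _).prodMk (hasFDerivAt_const _ _)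
  have hd := differentiableAt_ext (ofBase hφ g hg) hp
  have h1 := HasFDerivAt.comp (φ p.1) (f := ι) (g := SmoothFun.ext (ofBase hφ g hg))
    hd.hasFDerivAt hι
  have h2 : ∀ᶠ y in 𝓝 p.1, g y = (SmoothFun.ext (ofBase hφ g hg) ∘ ι) (φ y) := by
    filter_upwards [φ.open_source.mem_nhds hp] with y hy
    have hq : coords φ ⟨y, ∑ i, (coords φ p).2 i • coordForm φ i y⟩ = ι (φ y) :=
      Prod.ext rfl (funext fun i => sum_smul_coordForm_apply hφ hy _ i)
    rw [Function.comp_apply, ← hq]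
    exact (ev_ofBase hφ hg (p := ⟨y, _⟩) hy).symm
  rw [ev_dx _ _ hp, mvfderiv_congr h2, mvfderiv_comp_fderiv h1.differentiableAt
    ((contMDiffAt_chart hφ hp).mdifferentiableAt (by simp)), h1.fderiv, mvfderiv_coordField hφ m hp]
  simp

end OfBundle

end ChartFun

end

/-! ### The connection algebra of a chart. -/

section

variable {n : ℕ} {M : Type*} [TopologicalSpace M]

namespace ChartFun

variable {φ : OpenPartialHomeomorph M (EuclideanSpace ℝ (Fin n))}

/-- The fibre coordinate `ξ_i`. -/
def fibreCoord (φ : OpenPartialHomeomorph M (EuclideanSpace ℝ (Fin n))) (i : Fin n) : ChartFun φ :=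
  SmoothFun.restrict (fun z => z.2 i) (by fun_prop)

theorem deriv_fibreCoord (i : Fin n) (w : EuclideanSpace ℝ (Fin n)) (c : Fin n → ℝ) :
    SmoothFun.deriv (isOpen_domain φ) (w, c) (fibreCoord φ i) =
      algebraMap ℝ (ChartFun φ) (c i) := by
  refine SmoothFun.eq_of_ext fun z hz => ?_
  let L : EuclideanSpace ℝ (Fin n) × (Fin n → ℝ) →L[ℝ] ℝ :=
    (ContinuousLinearMap.proj i).comp (ContinuousLinearMap.snd ℝ _ _)
  have h : Set.EqOn (SmoothFun.ext (fibreCoord φ i)) L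
    (φ.target ×ˢ (Set.univ : Set (Fin n → ℝ))) := SmoothFun.ext_restrict _ _
  rw [SmoothFun.ext_deriv_of_eqOn _ _ h hz, SmoothFun.ext_algebraMap _ hz, L.fderiv]
  rfl

variable [ChartedSpace (EuclideanSpace ℝ (Fin n)) M]

theorem ev_fibreCoord (i : Fin n) {p : CotangentBundle n M} (hp : p.1 ∈ φ.source) :
    ev (fibreCoord φ i) p = p.2 (coordField φ i p.1) :=
  SmoothFun.ext_restrict _ _ (coords_mem hp)

theorem mem_homogeneous_iff (hφ : φ ∈ IsManifold.maximalAtlas (𝓡 n) ∞ M) {f : ChartFun φ} {k : ℕ} :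
    f ∈ homogeneous φ.target k ↔ ∀ x ∈ φ.source, ∀ (ξ : CotangentSpace n x) (t : ℝ),
      ev f ⟨x, t • ξ⟩ = t ^ k * ev f ⟨x, ξ⟩ := by
  have hc : ∀ (x : M) (ξ : CotangentSpace n x) (t : ℝ),
      coords φ ⟨x, t • ξ⟩ = (φ x, t • (coords φ ⟨x, ξ⟩).2) := fun x ξ t => by
    refine Prod.ext rfl (funext fun i => ?_)
    simp [coords]
  constructor
  · intro h x hx ξ t
    rw [ev, hc]
    exact h (φ x) (φ.map_source hx) _ t
  · intro h y hy c t
    obtain ⟨η, hη⟩ : ∃ η : CotangentSpace n (φ.symm y), coords φ ⟨φ.symm y, η⟩ = (y, c) :=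
      ⟨(ofCoords φ (y, c)).2, coords_ofCoords hφ (z := (y, c)) hy⟩
    have := h (φ.symm y) (φ.map_target hy) η t
    rwa [ev, hc, ev, hη, φ.right_inv hy] at this

section Algebra

variable [IsManifold (𝓡 n) ∞ M] (hφ : φ ∈ IsManifold.maximalAtlas (𝓡 n) ∞ M)

theorem ofBase_mem_homogeneous {g : M → ℝ}
    (hg : ∀ x ∈ φ.source, ContMDiffAt (𝓡 n) 𝓘(ℝ, ℝ) ∞ g x) :
    ofBase hφ g hg ∈ homogeneous φ.target 0 :=
  (mem_homogeneous_iff hφ).2 fun x hx ξ t => by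
    rw [ev_ofBase hφ hg (p := ⟨x, _⟩) hx, ev_ofBase hφ hg (p := ⟨x, _⟩) hx, pow_zero, one_mul]

variable [T2Space M]
  {P : PoissonStructure n M} {D D' : ContravariantConnection P}

/-- The local components of a Poisson bivector and of an associated contravariant connection. -/
def connectionAlgebra (hassoc : ContravariantConnection.Associated D D')
    (htors : D'.TorsionFree) : ConnectionAlgebra n (ChartFun φ) where
  dx := dx φ
  dξ := dξ φ
  ξ := fibreCoord φ
  biv i j := ofBase hφ (P.bivCoord φ i j) fun _ hx => P.contMDiffAt_bivCoord hφ hx i j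
  Γ i j k := ofBase hφ (D.christoffel φ i j k) fun _ hx => D.contMDiffAt_christoffel hφ hx i j k
  dx_dx i j g := SmoothFun.deriv_comm _ _ _ g
  dx_dξ i j g := SmoothFun.deriv_comm _ _ _ g
  dξ_dξ i j g := SmoothFun.deriv_comm _ _ _ g
  dx_ξ i j := by
    rw [dx, deriv_fibreCoord, Pi.zero_apply, map_zero]
  dξ_ξ i j := by
    rw [dξ, deriv_fibreCoord]
    by_cases h : i = j
    · simp [h]
    · simp [h]
  dξ_biv a i j := dξ_ofBase hφ _ a
  dξ_Γ a i j k := dξ_ofBase hφ _ a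
  skew i j := eq_of_ev hφ fun p hp => by
    rw [ev_neg _ hp, ev_ofBase hφ _ hp, ev_ofBase hφ _ hp]
    exact P.biv_skew _ _ _
  jacobi l i j := eq_of_ev hφ fun p hp => by
    simp only [ev_add _ _ hp, ev_sum _ _ hp, ev_mul _ _ hp, ev_dx_ofBase hφ _ _ hp,
      ev_ofBase hφ _ hp, ev_zero hp]
    exact P.jacobi_coord hφ hp l i j
  parallel i a s := eq_of_ev hφ fun p hp => by
    simp only [ev_sub _ _ hp, ev_sum _ _ hp, ev_mul _ _ hp, ev_dx_ofBase hφ _ _ hp,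
      ev_ofBase hφ _ hp]
    exact hassoc.parallel_coord htors hφ hp i a s

variable (hassoc : ContravariantConnection.Associated D D') (htors : D'.TorsionFree)

theorem ev_biv {p : CotangentBundle n M} (hp : p.1 ∈ φ.source) (i j : Fin n) :
    ev ((connectionAlgebra hφ hassoc htors).biv i j) p = P.bivCoord φ i j p.1 :=
  ev_ofBase hφ (fun _ hx => P.contMDiffAt_bivCoord hφ hx i j) hp

theorem ev_Γ {p : CotangentBundle n M} (hp : p.1 ∈ φ.source) (i j k : Fin n) :
    ev ((connectionAlgebra hφ hassoc htors).Γ i j k) p = D.christoffel φ i j k p.1 :=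
  ev_ofBase hφ (fun _ hx => D.contMDiffAt_christoffel hφ hx i j k) hp

/-- The induced connection acts in coordinates by the derivations `nab i`. -/
theorem bar_eq_sum_nab {p : CotangentBundle n M} (hp : p.1 ∈ φ.source)
    {g : CotangentBundle n M → ℝ} {f : ChartFun φ}
    (hg : ∀ᶠ y in 𝓝 p.1, ∀ ζ : CotangentSpace n y, g ⟨y, ζ⟩ = ev f ⟨y, ζ⟩)
    (α : ∀ x : M, CotangentSpace n x) :
    D.bar α g p = ∑ i, α p.1 (coordField φ i p.1) *
      ev ((connectionAlgebra hφ hassoc htors).nab i f) p := by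
  set a := α p.1 with ha
  have h1 : ∀ j, mvfderiv (𝓡 n) φ p.1 (P.sharp p.1 a) j =
      ∑ i, a (coordField φ i p.1) * P.bivCoord φ i j p.1 := fun j => by
    rw [← coordForm_apply hφ j hp]
    conv_lhs => rw [← sum_coordField_smul hφ hp a]
    simp only [map_sum, map_smul, smul_eq_mul]
    rfl
  have h2 : ∀ k, p.2 (D.nabla (coordField φ k) p.1 a) = ∑ i, a (coordField φ i p.1) *
      ∑ j, D.christoffel φ i j k p.1 * p.2 (coordField φ j p.1) := fun k => by
    conv_lhs => rw [← sum_coordField_smul hφ hp a]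
    simp only [map_sum, map_smul, smul_eq_mul]
    refine sum_congr rfl fun i _ => ?_
    rw [map_eq_sum_coordField hφ hp p.2]
    rfl
  rw [D.bar_eq_fderiv hφ hp (differentiableAt_ext f hp) hg α, ← ha, fderiv_ext_apply f hp]
  simp only [h1, h2, ConnectionAlgebra.nab_apply, ConnectionAlgebra.fibreCoeff, ev_add _ _ hp,
    ev_sum _ _ hp, ev_mul _ _ hp, ev_biv hφ hassoc htors hp, ev_Γ hφ hassoc htors hp, mul_add,
    sum_add_distrib, mul_sum, sum_mul]
  congr 1
  · rw [sum_comm]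
    exact sum_congr rfl fun i _ => sum_congr rfl fun j _ => by rw [mul_assoc]; rfl
  · rw [sum_comm]
    refine sum_congr rfl fun i _ => sum_congr rfl fun j _ => sum_congr rfl fun k _ => ?_
    rw [← ev_fibreCoord k hp, mul_assoc]
    rfl

end Algebra

end ChartFun

end

/-! ### Hamiltonian fields: independence of choices, gluing, and the fields of `U(α)`. -/

section

variable {n : ℕ} {M : Type*} [TopologicalSpace M] [ChartedSpace (EuclideanSpace ℝ (Fin n)) M]

theorem fibreDeriv_coordForm {φ : OpenPartialHomeomorph M (EuclideanSpace ℝ (Fin n))}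
    (hφ : φ ∈ IsManifold.maximalAtlas (𝓡 n) ∞ M) {f : ChartFun φ}
    {g : CotangentBundle n M → ℝ} {p : CotangentBundle n M} (hp : p.1 ∈ φ.source)
    (hg : ∀ q : CotangentBundle n M, q.1 ∈ φ.source → g q = ChartFun.ev f q) (j : Fin n) :
    fibreDeriv g p (coordForm φ j p.1) = ChartFun.ev (ChartFun.dξ φ j f) p := by
  rw [ChartFun.fibreDeriv_of_ev hp (fun ζ => hg ⟨p.1, ζ⟩ hp)]
  simp [coordForm_coordField hφ _ _ hp]

variable [IsManifold (𝓡 n) ∞ M] {P : PoissonStructure n M}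

section PointwiseHamiltonian

variable {F G : ℕ → CotangentBundle n M → ℝ} {p : CotangentBundle n M}

variable (P F p) in
/-- The covectors `V k` are the components at `p` of a Hamiltonian vector field of `F`. -/
def IsHamiltonianAt (V : ℕ → CotangentSpace n p.1) : Prop :=
  ∀ (k : ℕ) (η : CotangentSpace n p.1), P.biv p.1 (V k) η = - fibreDeriv (F (k + 1)) p η

/-- The action on a Hamiltonian function does not depend on the choice of the Hamiltonian field. -/
theorem IsHamiltonianAt.sum_fibreDeriv_eq {V V' K : ℕ → CotangentSpace n p.1}
    (hV : IsHamiltonianAt P F p V) (hV' : IsHamiltonianAt P F p V') (hK : IsHamiltonianAt P G p K)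
    (k : ℕ) : ∑ ij ∈ antidiagonal k, fibreDeriv (G (ij.2 + 1)) p (V ij.1) =
      ∑ ij ∈ antidiagonal k, fibreDeriv (G (ij.2 + 1)) p (V' ij.1) := by
  refine sum_congr rfl fun ij _ => ?_
  -- By skew-symmetry each summand is `-d_ξ F` on the Hamiltonian vector `K` of `G`, an expression
  -- free of `V`.
  have h1 := hK ij.2 (V ij.1)
  have h2 := hK ij.2 (V' ij.1)
  have h3 := hV ij.1 (K ij.2)
  have h4 := hV' ij.1 (K ij.2)
  rw [P.biv_skew] at h1 h2
  linarith

theorem omegaBracket_eq_sum (hF : ∃ H, IsHamiltonianField P F H)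
    {V K : ℕ → CotangentSpace n p.1} (hV : IsHamiltonianAt P F p V) (hK : IsHamiltonianAt P G p K)
    (k : ℕ) : omegaBracket P F G k p =
      ∑ ij ∈ antidiagonal k, fibreDeriv (G (ij.2 + 1)) p (V ij.1) := by
  have h : IsHamiltonianField P F (hamiltonianField P F) := by
    rw [hamiltonianField, dif_pos hF]
    exact hF.choose_spec
  exact IsHamiltonianAt.sum_fibreDeriv_eq (fun k η => h.2 k p η) hV hK k

theorem contMDiff_mul_of_tsupport_subset {W : Set M} (hW : IsOpen W) {ψ : M → ℝ}
    (hψ : ContMDiff (𝓡 n) 𝓘(ℝ, ℝ) ∞ ψ) (hψW : tsupport ψ ⊆ W) {g : CotangentBundle n M → ℝ}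
    (hg : ContMDiffOn ((𝓡 n).prod 𝓘(ℝ, EuclideanSpace ℝ (Fin n) →L[ℝ] ℝ)) 𝓘(ℝ, ℝ) ∞ g
      {p | p.1 ∈ W}) :
    ContMDiff ((𝓡 n).prod 𝓘(ℝ, EuclideanSpace ℝ (Fin n) →L[ℝ] ℝ)) 𝓘(ℝ, ℝ) ∞
      (fun p => ψ p.1 * g p) := by
  have hproj : Continuous (fun q : CotangentBundle n M => q.1) :=
    FiberBundle.continuous_proj _ _
  refine contMDiff_of_tsupport fun p hp => ?_
  have hpW : p.1 ∈ W := hψW (tsupport_comp_subset_preimage ψ hproj (tsupport_mul_subset_left hp))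
  exact (hψ.contMDiffAt.comp p (contMDiffAt_proj _)).mul
    (hg.contMDiffAt ((hW.preimage hproj).mem_nhds hpW))

/-- Local Hamiltonian vector fields can be glued. -/
theorem exists_isHamiltonianField [T2Space M] [SigmaCompactSpace M]
    (h : ∀ x : M, ∃ W : Set M, IsOpen W ∧ x ∈ W ∧
      ∃ H : ℕ → ∀ p : CotangentBundle n M, CotangentSpace n p.1,
        (∀ X : VField n M, IsFormalOn W (fun k p => H k p (X p.1))) ∧
        ∀ p : CotangentBundle n M, p.1 ∈ W → IsHamiltonianAt P F p fun k => H k p) :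
    ∃ H, IsHamiltonianField P F H := by
  choose W hW hxW H hH hHam using h
  obtain ⟨ρ, hρ⟩ := SmoothPartitionOfUnity.exists_isSubordinate (𝓡 n) isClosed_univ W hW
    fun x _ => Set.mem_iUnion.2 ⟨x, hxW x⟩
  have hmem : ∀ {x y : M}, y ∈ ρ.finsupport x → x ∈ W y := fun {x y} hy =>
    hρ y (subset_tsupport _ ((ρ.mem_finsupport x).1 hy))
  have hproj : Continuous (fun q : CotangentBundle n M => q.1) :=
    FiberBundle.continuous_proj _ _
  -- For a fixed `F` the condition `ι(H) Ω = -d_ξ F` is affine in `H`, so it survives averaging with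
  -- weights that are functions on the base and sum to one.
  refine ⟨fun k p => ∑ y ∈ ρ.finsupport p.1, ρ y p.1 • H y k p, fun X k => ⟨?_, ?_⟩, ?_⟩
  · have h1 : (fun p : CotangentBundle n M =>
        (∑ y ∈ ρ.finsupport p.1, ρ y p.1 • H y k p) (X p.1)) =
        fun p => ∑ᶠ y, ρ y p.1 * H y k p (X p.1) := funext fun p => by
      rw [finsum_eq_sum_of_support_subset (s := ρ.finsupport p.1)]
      · simp
      · rw [ρ.coe_finsupport]
        exact Function.support_mul_subset_left _ _
    change ContMDiffOn _ _ _ (fun p : CotangentBundle n M =>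
      (∑ y ∈ ρ.finsupport p.1, ρ y p.1 • H y k p) (X p.1)) _
    rw [h1]
    refine (contMDiff_finsum (fun y => contMDiff_mul_of_tsupport_subset (hW y) (ρ y).contMDiff
      (hρ y) (hH y X k).1) ?_).contMDiffOn
    exact (ρ.locallyFinite.preimage_continuous hproj).subset
      fun y => Function.support_mul_subset_left _ _
  · intro x _ ξ t
    simp only [_root_.sum_apply, smul_apply, mul_sum, smul_eq_mul]
    refine sum_congr rfl fun y hy => ?_
    have h := (hH y X k).2 x (hmem hy) ξ t
    dsimp only at h
    rw [h]
    ring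
  · intro k p η
    have h1 : ∀ y ∈ ρ.finsupport p.1, ρ y p.1 * P.biv p.1 (H y k p) η =
        ρ y p.1 * -fibreDeriv (F (k + 1)) p η := fun y hy => by
      rw [hHam y p (hmem hy) k η]
    have h2 : P.biv p.1 (∑ y ∈ ρ.finsupport p.1, ρ y p.1 • H y k p) η =
        ∑ y ∈ ρ.finsupport p.1, ρ y p.1 * P.biv p.1 (H y k p) η := by
      simp [PoissonStructure.biv]
    rw [h2, sum_congr rfl h1, ← sum_mul, ρ.sum_finsupport p.1 (Set.mem_univ _), one_mul]

end PointwiseHamiltonian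

section Potential

variable {φ : OpenPartialHomeomorph M (EuclideanSpace ℝ (Fin n))}
  {U : ℕ → ∀ p : CotangentBundle n M, CotangentSpace n p.1 →ₗ[ℝ] ℝ}
  {u : Fin n → ℕ → CotangentBundle n M → ℝ} {v : Fin n → Fin n → ℕ → CotangentBundle n M → ℝ}

/-- The vector field `α_i v^i_s ∂/∂ξ_s`. -/
def potentialField (φ : OpenPartialHomeomorph M (EuclideanSpace ℝ (Fin n)))
    (v : Fin n → Fin n → ℕ → CotangentBundle n M → ℝ) (α : ∀ x : M, CotangentSpace n x) (k : ℕ)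
    (p : CotangentBundle n M) : CotangentSpace n p.1 :=
  ∑ i, ∑ s, (α p.1 (coordField φ i p.1) * v i s k p) • coordForm φ s p.1

theorem IsLocalPotential.evalForm_eq (hU : IsLocalPotential P U φ u v)
    (hφ : φ ∈ IsManifold.maximalAtlas (𝓡 n) ∞ M) {p : CotangentBundle n M} (hp : p.1 ∈ φ.source)
    (α : ∀ x : M, CotangentSpace n x) (d : ℕ) :
    evalForm U α d p = ∑ i, α p.1 (coordField φ i p.1) *
      ∑ s, P.bivCoord φ i s p.1 * u s d p := by
  obtain ⟨x, ξ⟩ := p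
  have h := sum_coordField_smul hφ hp (α x)
  rw [evalForm]
  conv_lhs => rw [← h]
  simp only [map_sum, map_smul, smul_eq_mul]
  exact sum_congr rfl fun i _ => congrArg _ (hU.potential i x hp ξ d)

/-- For `α = dx^i` this is compatibility: `∂(π^{is} u_s)/∂ξ_j = π^{is} ∂u_s/∂ξ_j = π^{js} v^i_s`.
Both sides are linear in the value of `α`. -/
theorem IsLocalPotential.isHamiltonianAt (hU : IsLocalPotential P U φ u v)
    (hφ : φ ∈ IsManifold.maximalAtlas (𝓡 n) ∞ M) {p : CotangentBundle n M} (hp : p.1 ∈ φ.source)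
    (α : ∀ x : M, CotangentSpace n x) :
    IsHamiltonianAt P (evalForm U α) p fun k => potentialField φ v α k p := by
  intro k η
  let w : Fin n → ChartFun φ := fun s =>
    ChartFun.ofBundle hφ (u s (k + 1)) (hU.formal_u s (k + 1)).1
  have hw : ∀ s (q : CotangentBundle n M), q.1 ∈ φ.source → u s (k + 1) q = ChartFun.ev (w s) q :=
    fun s q hq => (ChartFun.ev_ofBundle hφ _ hq).symm
  -- The coefficients are frozen at the base point: only fibre derivatives occur, and `α` need not
  -- be smooth.
  let f : ChartFun φ := ∑ i, ∑ s, (α p.1 (coordField φ i p.1) * P.bivCoord φ i s p.1) • w s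
  have hf : ∀ ζ : CotangentSpace n p.1, evalForm U α (k + 1) ⟨p.1, ζ⟩ = ChartFun.ev f ⟨p.1, ζ⟩ := by
    intro ζ
    rw [hU.evalForm_eq hφ (p := ⟨p.1, ζ⟩) hp, ChartFun.ev_sum _ _ (p := ⟨p.1, ζ⟩) hp]
    refine sum_congr rfl fun i _ => ?_
    rw [ChartFun.ev_sum _ _ (p := ⟨p.1, ζ⟩) hp, mul_sum]
    refine sum_congr rfl fun s _ => ?_
    rw [ChartFun.ev, SmoothFun.ext_smul _ _ (coords_mem (p := ⟨p.1, ζ⟩) hp), hw s ⟨p.1, ζ⟩ hp,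
      mul_assoc]
    rfl
  have h1 : ∀ j, ChartFun.ev (ChartFun.dξ φ j f) p = ∑ i, α p.1 (coordField φ i p.1) *
      ∑ s, P.bivCoord φ j s p.1 * v i s k p := by
    intro j
    simp only [f, map_sum, ChartFun.ev_sum _ _ hp]
    refine sum_congr rfl fun i _ => ?_
    have := hU.compatible j i p.1 hp p.2 k
    simp only [PoissonStructure.bivCoord]
    refine Eq.trans ?_ (congrArg _ this.symm)
    rw [mul_sum]
    refine sum_congr rfl fun s _ => ?_
    have h3 := fibreDeriv_coordForm hφ hp (hw s) j
    rw [Derivation.map_smul, ChartFun.ev, SmoothFun.ext_smul _ _ (coords_mem hp), mul_assoc]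
    exact congrArg _ (congrArg _ h3.symm)
  rw [ChartFun.fibreDeriv_of_ev hp hf]
  simp only [h1]
  rw [PoissonStructure.biv, map_eq_sum_coordField hφ hp η, ← sum_neg_distrib]
  refine sum_congr rfl fun j _ => ?_
  have h2 : coordForm φ j p.1 (P.sharp p.1 (potentialField φ v α k p)) =
      - ∑ i, α p.1 (coordField φ i p.1) * ∑ s, P.bivCoord φ j s p.1 * v i s k p := by
    rw [P.skew, P.apply_sharp_coordForm hφ hp]
    simp only [potentialField, _root_.sum_apply, smul_apply, smul_eq_mul,
      coordForm_coordField hφ _ _ hp, mul_ite, mul_one, mul_zero, sum_ite_eq', mem_univ, if_true,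
      mul_sum]
    rw [sum_comm]
    exact congrArg _ (sum_congr rfl fun i _ => sum_congr rfl fun s _ => by ring)
  rw [h2]
  ring

theorem IsLocalPotential.potentialField_zero (hU : IsLocalPotential P U φ u v)
    (hφ : φ ∈ IsManifold.maximalAtlas (𝓡 n) ∞ M) {p : CotangentBundle n M} (hp : p.1 ∈ φ.source)
    (α : ∀ x : M, CotangentSpace n x) : potentialField φ v α 0 p = α p.1 := by
  have h : ∀ i s, v i s 0 p = if i = s then 1 else 0 := fun i s => hU.v_zero i s p.1 hp p.2
  simp only [potentialField, h, mul_ite, mul_one, mul_zero, ite_smul, zero_smul, sum_ite_eq,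
    mem_univ, if_true]
  exact sum_coordField_smul hφ hp (α p.1)

theorem IsLocalPotential.isFormalOn_potentialField (hU : IsLocalPotential P U φ u v)
    (hφ : φ ∈ IsManifold.maximalAtlas (𝓡 n) ∞ M) (α : OneForm n M) (X : VField n M) :
    IsFormalOn φ.source fun k p => potentialField φ v (fun y => α y) k p (X p.1) := by
  have hex : (fun (k : ℕ) (p : CotangentBundle n M) =>
      potentialField φ v (fun y => α y) k p (X p.1)) = fun k p => ∑ i, ∑ s,
        α p.1 (coordField φ i p.1) * v i s k p * coordForm φ s p.1 (X p.1) := by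
    funext k p
    simp [potentialField]
  rw [hex]
  refine fun k => ⟨fun p hp => ?_, fun x hx ξ t => ?_⟩
  · have hproj : ContMDiffAt ((𝓡 n).prod 𝓘(ℝ, EuclideanSpace ℝ (Fin n) →L[ℝ] ℝ)) (𝓡 n) ∞
      (fun q : CotangentBundle n M => q.1) p := contMDiffAt_proj _
    refine ContMDiffWithinAt.sum fun i _ => ContMDiffWithinAt.sum fun s _ => ?_
    refine ((ContMDiffAt.contMDiffWithinAt ?_).mul ((hU.formal_v i s k).1 p hp)).mul
      (ContMDiffAt.contMDiffWithinAt ?_)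
    · exact (contMDiffAt_pairing (b := fun y : M => y) α.contMDiff.contMDiffAt
        (contMDiffAt_coordField hφ i hp)).comp p hproj
    · exact (contMDiffAt_pairing (b := fun y : M => y) (contMDiffAt_coordForm hφ s hp)
        X.contMDiff.contMDiffAt).comp p hproj
  · simp only [mul_sum]
    refine sum_congr rfl fun i _ => sum_congr rfl fun s _ => ?_
    rw [(hU.formal_v i s k).2 x hx ξ t]
    ring

/-- The functions `U(α)` are Hamiltonian. -/
theorem HasLocalPotentials.exists_isHamiltonianField [T2Space M] [SigmaCompactSpace M]
    (hpot : HasLocalPotentials P U) (α : OneForm n M) :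
    ∃ H, IsHamiltonianField P (evalForm U fun y => α y) H :=
  FormalLift.exists_isHamiltonianField fun x => by
    obtain ⟨φ, hφ, hx, u, v, hU⟩ := hpot x
    exact ⟨φ.source, φ.open_source, hx, potentialField φ v fun y => α y,
      hU.isFormalOn_potentialField hφ α, fun p hp => hU.isHamiltonianAt hφ hp _⟩

end Potential

end

/-! ### Curvature and `Q` in coordinates. -/

section

variable {n : ℕ} {M : Type*} [TopologicalSpace M] [ChartedSpace (EuclideanSpace ℝ (Fin n)) M]
  [IsManifold (𝓡 n) ∞ M] [T2Space M] {P : PoissonStructure n M}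

theorem exists_oneForm_apply_eq {x : M} (a : CotangentSpace n x) : ∃ α : OneForm n M, α x = a := by
  obtain ⟨s, hs, hext⟩ := exists_contMDiffOn_extend (𝓡 n) (EuclideanSpace ℝ (Fin n) →L[ℝ] ℝ)
    (k := ∞) (V := fun y : M => CotangentSpace n y) a
  obtain ⟨α, hα⟩ := exists_oneForm_eventuallyEq isOpen_interior (mem_interior_iff_mem_nhds.2 hs)
    fun y hy => hext.contMDiffAt (mem_interior_iff_mem_nhds.1 hy)
  exact ⟨α, hα.self_of_nhds.trans (extend_apply_self (EuclideanSpace ℝ (Fin n) →L[ℝ] ℝ) a)⟩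

theorem exists_vField_eventuallyEq_extend {x : M} (w : TangentSpace (𝓡 n) x) :
    ∃ Y : VField n M, ∀ᶠ y in 𝓝 x, Y y = extend (EuclideanSpace ℝ (Fin n))
      (E := fun y : M => TangentSpace (𝓡 n) y) w y := by
  obtain ⟨s, hs, hext⟩ := exists_contMDiffOn_extend (𝓡 n) (EuclideanSpace ℝ (Fin n))
    (k := ∞) (V := fun y : M => TangentSpace (𝓡 n) y) w
  exact exists_vField_eventuallyEq isOpen_interior (mem_interior_iff_mem_nhds.2 hs)
    fun y hy => hext.contMDiffAt (mem_interior_iff_mem_nhds.1 hy)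

namespace ChartFun

variable {φ : OpenPartialHomeomorph M (EuclideanSpace ℝ (Fin n))}
  (hφ : φ ∈ IsManifold.maximalAtlas (𝓡 n) ∞ M)
  {D D' : ContravariantConnection P} (hassoc : ContravariantConnection.Associated D D')
  (htors : D'.TorsionFree)

theorem bar_eq_nab {p : CotangentBundle n M} (hp : p.1 ∈ φ.source)
    {g : CotangentBundle n M → ℝ} {f : ChartFun φ}
    (hg : ∀ᶠ y in 𝓝 p.1, ∀ ζ : CotangentSpace n y, g ⟨y, ζ⟩ = ev f ⟨y, ζ⟩) {i : Fin n}
    {α : ∀ x : M, CotangentSpace n x} (hα : α p.1 = coordForm φ i p.1) :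
    D.bar α g p = ev ((connectionAlgebra hφ hassoc htors).nab i f) p := by
  rw [bar_eq_sum_nab hφ hassoc htors hp hg]
  simp [hα, coordForm_coordField hφ _ _ hp]

/-- Since `[dx^i, dx^j] = dπ^{ij}`, the term `∇^{[α, β]}` removes exactly the non-vertical part of
the commutator in `nab_nab`. -/
theorem barCurvature_eq {p : CotangentBundle n M} (hp : p.1 ∈ φ.source)
    {g : CotangentBundle n M → ℝ} {f : ChartFun φ}
    (hg : ∀ᶠ y in 𝓝 p.1, ∀ ζ : CotangentSpace n y, g ⟨y, ζ⟩ = ev f ⟨y, ζ⟩) {i j : Fin n}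
    {α β : OneForm n M} (hα : ∀ᶠ y in 𝓝 p.1, α y = coordForm φ i y)
    (hβ : ∀ᶠ y in 𝓝 p.1, β y = coordForm φ j y) :
    D.barCurvature α β g p =
      ∑ s, ev ((connectionAlgebra hφ hassoc htors).curv i j s) p * ev (dξ φ s f) p := by
  set K := connectionAlgebra hφ hassoc htors with hK
  have hbar : ∀ (a : Fin n) (γ : OneForm n M), (∀ᶠ y in 𝓝 p.1, γ y = coordForm φ a y) →
      ∀ᶠ y in 𝓝 p.1, ∀ ζ : CotangentSpace n y,
        D.bar (fun y => γ y) g ⟨y, ζ⟩ = ev (K.nab a f) ⟨y, ζ⟩ := fun a γ hγ => by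
    filter_upwards [hγ, hg.eventually_nhds, φ.open_source.mem_nhds hp] with y h1 h2 h3 ζ
    exact bar_eq_nab hφ hassoc htors (p := ⟨y, ζ⟩) h3 h2 h1
  have h1 := bar_eq_nab hφ hassoc htors hp (hbar j β hβ) (α := fun y => α y) hα.self_of_nhds
  have h2 := bar_eq_nab hφ hassoc htors hp (hbar i α hα) (α := fun y => β y) hβ.self_of_nhds
  have h3 := bar_eq_sum_nab hφ hassoc htors hp hg (P.bracket α β)
  have h4 : ∀ k, P.bracket α β p.1 (coordField φ k p.1) = ev (K.dx k (K.biv i j)) p := fun k => by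
    rw [P.bracket_eq_mvfderiv hφ hp hα hβ]
    exact (ev_dx_ofBase hφ (fun _ hx => P.contMDiffAt_bivCoord hφ hx i j) k hp).symm
  have h5 := K.nab_nab i j f
  rw [combination_apply] at h5
  have h6 := congrArg (fun f => ev f p) h5
  simp only [ev_sub _ _ hp, ev_add _ _ hp, ev_sum _ _ hp, ev_mul _ _ hp] at h6
  simp only [h4] at h3
  rw [ContravariantConnection.barCurvature, h1, h2, h3, ← hK, h6, add_sub_cancel_left]
  rfl

/-- The curvature field in coordinates. -/
theorem barCurvatureField_eq {p : CotangentBundle n M} (hp : p.1 ∈ φ.source) {i j : Fin n}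
    {α β : OneForm n M} (hα : ∀ᶠ y in 𝓝 p.1, α y = coordForm φ i y)
    (hβ : ∀ᶠ y in 𝓝 p.1, β y = coordForm φ j y) :
    D.barCurvatureField α β 1 p =
      ∑ s, ev ((connectionAlgebra hφ hassoc htors).curv i j s) p • coordForm φ s p.1 := by
  -- The curvature acts here on the fibrewise linear function of an extension of `w`. Being
  -- vertical, it sees only the fibre derivatives at `p`, and in the direction `dx^s` that is
  -- `dx^s(w)`.
  have h : ∀ w : TangentSpace (𝓡 n) p.1, D.barCurvature α β
      (fun q => q.2 (extend (EuclideanSpace ℝ (Fin n))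
        (E := fun y : M => TangentSpace (𝓡 n) y) (x := p.1) w q.1)) p =
      ∑ s, ev ((connectionAlgebra hφ hassoc htors).curv i j s) p * coordForm φ s p.1 w := by
    intro w
    obtain ⟨Y, hY⟩ := exists_vField_eventuallyEq_extend w
    have hsm : ContMDiff ((𝓡 n).prod 𝓘(ℝ, EuclideanSpace ℝ (Fin n) →L[ℝ] ℝ)) 𝓘(ℝ, ℝ) ∞
        (fun q : CotangentBundle n M => q.2 (Y q.1)) := fun q =>
      contMDiffAt_pairing (b := fun q : CotangentBundle n M => q.1) (β := fun q => q.2)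
        contMDiffAt_id (Y.contMDiff.contMDiffAt.comp q (contMDiffAt_proj _))
    let f : ChartFun φ := ofBundle hφ _ hsm.contMDiffOn
    have hf : ∀ q : CotangentBundle n M, q.1 ∈ φ.source → q.2 (Y q.1) = ev f q := fun q hq =>
      (ev_ofBundle hφ hsm.contMDiffOn hq).symm
    rw [barCurvature_eq hφ hassoc htors hp (f := f) ?_ hα hβ]
    · refine sum_congr rfl fun s _ => ?_
      rw [← fibreDeriv_coordForm hφ hp hf s]
      congr 1
      have h1 : ∀ t : ℝ, (p.2 + t • coordForm φ s p.1) (Y p.1) =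
          p.2 (Y p.1) + t * coordForm φ s p.1 w := fun t => by
        rw [hY.self_of_nhds, extend_apply_self]
        rfl
      simp only [fibreDeriv, lineDeriv, h1]
      simp
    · filter_upwards [hY, φ.open_source.mem_nhds hp] with y h1 h2 ζ
      rw [← hf ⟨y, ζ⟩ h2, ← h1]
  have h1 : D.barCurvatureField α β 1 p = ∑ k : Fin n,
      (∑ s, ev ((connectionAlgebra hφ hassoc htors).curv i j s) p *
        coordForm φ s p.1 (EuclideanSpace.single k (1 : ℝ))) •
        (EuclideanSpace.proj k : EuclideanSpace ℝ (Fin n) →L[ℝ] ℝ) := by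
    rw [ContravariantConnection.barCurvatureField, if_pos rfl]
    exact sum_congr rfl fun k _ => congrArg (· • _) (h (EuclideanSpace.single k (1 : ℝ)))
  rw [h1]
  refine ContinuousLinearMap.ext fun w => ?_
  -- The expansion is in the standard basis of the model space, to which `TangentSpace` unfolds, and
  -- not in the coordinate fields of `φ`.
  have h2 : ∀ s, ∑ k, coordForm φ s p.1 (EuclideanSpace.single k (1 : ℝ)) * w k =
      coordForm φ s p.1 w := fun s => by
    let L : EuclideanSpace ℝ (Fin n) →L[ℝ] ℝ := coordForm φ s p.1
    have h3 : (w : EuclideanSpace ℝ (Fin n)) = ∑ k, w k • EuclideanSpace.single k (1 : ℝ) := by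
      ext i
      simp [Pi.single_apply]
    have h4 : L w = ∑ k, L (EuclideanSpace.single k (1 : ℝ)) * w k := by
      conv_lhs => rw [h3]
      simp [mul_comm]
    exact h4.symm
  have h5 : ∀ w : TangentSpace (𝓡 n) p.1,
      (∑ s, ev ((connectionAlgebra hφ hassoc htors).curv i j s) p • coordForm φ s p.1) w =
      ∑ s, ev ((connectionAlgebra hφ hassoc htors).curv i j s) p * coordForm φ s p.1 w := by
    simp
  refine Eq.trans ?_ (h5 w).symm
  simp only [← h2, mul_sum]
  rw [sum_comm, _root_.sum_apply]
  refine sum_congr rfl fun k _ => ?_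
  rw [smul_apply, smul_eq_mul, sum_mul, PiLp.proj_apply]
  exact sum_congr rfl fun s _ => mul_assoc _ _ _

/-- The Euler field and the curvature field live in degree one, so only the pair `(1, 1)` of the
antidiagonal counts and `Q` has degree two. -/
theorem barQ_eq {p : CotangentBundle n M} (hp : p.1 ∈ φ.source) {i j : Fin n}
    {α β : OneForm n M} (hα : ∀ᶠ y in 𝓝 p.1, α y = coordForm φ i y)
    (hβ : ∀ᶠ y in 𝓝 p.1, β y = coordForm φ j y) (d : ℕ) :
    barQ D α β d p = if d = 2 then ev ((connectionAlgebra hφ hassoc htors).quad i j) p else 0 := by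
  have h0 : ∀ ij : ℕ × ℕ, P.biv p.1 (eulerField ij.1 p) (D.barCurvatureField α β ij.2 p) =
      if ij = (1, 1) then P.biv p.1 p.2 (D.barCurvatureField α β 1 p) else 0 := by
    rintro ⟨a, b⟩
    by_cases ha : a = 1
    · by_cases hb : b = 1
      · simp [ha, hb, eulerField]
      · simp [hb, ContravariantConnection.barCurvatureField, PoissonStructure.biv]
    · simp [ha, eulerField, PoissonStructure.biv]
  rw [barQ, omega, sum_congr rfl fun ij _ => h0 ij, sum_ite_eq']
  by_cases hd : d = 2
  · rw [if_pos (by simp [hd]), if_pos hd, barCurvatureField_eq hφ hassoc htors hp hα hβ,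
      ConnectionAlgebra.quad, ev_mul _ _ hp, ev_algebraMap _ hp]
    congr 1
    have h1 : ∀ s, P.biv p.1 p.2 (coordForm φ s p.1) =
        ∑ a, p.2 (coordField φ a p.1) * P.bivCoord φ a s p.1 := fun s => by
      conv_lhs => rw [← sum_coordField_smul hφ hp p.2]
      simp [PoissonStructure.biv, PoissonStructure.bivCoord]
    rw [PoissonStructure.biv]
    simp only [_root_.sum_apply, smul_apply, smul_eq_mul, ev_sum _ _ hp, ev_mul _ _ hp,
      ev_biv hφ hassoc htors hp]
    rw [sum_comm]
    refine sum_congr rfl fun s _ => ?_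
    have h2 := h1 s
    rw [PoissonStructure.biv] at h2
    rw [h2, mul_sum]
    refine sum_congr rfl fun a _ => ?_
    have h3 : ev ((connectionAlgebra hφ hassoc htors).ξ a) p = p.2 (coordField φ a p.1) :=
      ev_fibreCoord a hp
    rw [h3]
    ring
  · rw [if_neg, if_neg hd, mul_zero]
    simpa using fun h => hd h.symm

end ChartFun

end

/-! ### The Fundamental Equation in coordinates, and the formal chart of a potential. -/

section

variable {n : ℕ} {M : Type*} [TopologicalSpace M] [ChartedSpace (EuclideanSpace ℝ (Fin n)) M]
  {φ : OpenPartialHomeomorph M (EuclideanSpace ℝ (Fin n))}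
  {v : Fin n → Fin n → ℕ → CotangentBundle n M → ℝ}

theorem potentialField_coordField (hφ : φ ∈ IsManifold.maximalAtlas (𝓡 n) ∞ M)
    {p : CotangentBundle n M} (hp : p.1 ∈ φ.source) (α : ∀ x : M, CotangentSpace n x) (k : ℕ)
    (m : Fin n) : potentialField φ v α k p (coordField φ m p.1) =
      ∑ i, α p.1 (coordField φ i p.1) * v i m k p := by
  simp [potentialField, coordForm_coordField hφ _ _ hp]

variable [IsManifold (𝓡 n) ∞ M] {P : PoissonStructure n M}
  {U : ℕ → ∀ p : CotangentBundle n M, CotangentSpace n p.1 →ₗ[ℝ] ℝ}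
  {u : Fin n → ℕ → CotangentBundle n M → ℝ}

variable [T2Space M] [SigmaCompactSpace M]
  {D D' : ContravariantConnection P}

namespace ChartFun

/-- The fundamental equation in coordinates. -/
theorem fundamental_coord (hφ : φ ∈ IsManifold.maximalAtlas (𝓡 n) ∞ M)
    (hassoc : ContravariantConnection.Associated D D')
    (htors : D'.TorsionFree) (hpot : HasLocalPotentials P U) (hfund : FundamentalEquation D U)
    (hU : IsLocalPotential P U φ u v) {p : CotangentBundle n M} (hp : p.1 ∈ φ.source) (i j : Fin n)
    (d : ℕ) {K : ConnectionAlgebra n (ChartFun φ)} (hK : K = connectionAlgebra hφ hassoc htors)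
    {w : Fin n → ℕ → ChartFun φ} {z : Fin n → Fin n → ℕ → ChartFun φ}
    (hw : ∀ s d (q : CotangentBundle n M), q.1 ∈ φ.source → ev (w s d) q = u s d q)
    (hz : ∀ i s d (q : CotangentBundle n M), q.1 ∈ φ.source → ev (z i s d) q = v i s d q) :
    (if d = 0 then P.bivCoord φ i j p.1 else 0) =
      (if d = 2 then ev (K.quad i j) p else 0)
      - ev (K.nab i (∑ k, K.biv j k * w k d)) p
      + ev (K.nab j (∑ k, K.biv i k * w k d)) p
      + ev (∑ l, K.dx l (K.biv i j) * ∑ k, K.biv l k * w k d) p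
      + ev (K.shiftedVert (z i) (fun e => ∑ k, K.biv j k * w k e) d) p := by
  obtain ⟨α, hα⟩ := exists_oneForm_eq_coordForm hφ hp i
  obtain ⟨β, hβ⟩ := exists_oneForm_eq_coordForm hφ hp j
  have hev : ∀ (a : Fin n) (e : ℕ) (q : CotangentBundle n M), q.1 ∈ φ.source →
      U e q (coordForm φ a q.1) = ev (∑ k, K.biv a k * w k e) q := fun a e q hq => by
    rw [ev_sum _ _ hq]
    refine (hU.potential a q.1 hq q.2 e).trans (sum_congr rfl fun k _ => ?_)
    rw [ev_mul _ _ hq, hw k e q hq, hK, ev_biv hφ hassoc htors hq]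
    rfl
  have hnear : ∀ (a : Fin n) (γ : OneForm n M), (∀ᶠ y in 𝓝 p.1, γ y = coordForm φ a y) → ∀ e,
      ∀ᶠ y in 𝓝 p.1, ∀ ζ : CotangentSpace n y, evalForm U (fun y => γ y) e ⟨y, ζ⟩ =
        ev (∑ k, K.biv a k * w k e) ⟨y, ζ⟩ := fun a γ hγ e => by
    filter_upwards [hγ, φ.open_source.mem_nhds hp] with y h1 h2 ζ
    rw [← hev a e ⟨y, ζ⟩ h2, evalForm, h1]
  have h1 := bar_eq_nab hφ hassoc htors hp (hnear j β hβ d) (α := fun y => α y) hα.self_of_nhds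
  have h2 := bar_eq_nab hφ hassoc htors hp (hnear i α hα d) (α := fun y => β y) hβ.self_of_nhds
  have h3 : evalForm U (P.bracket α β) d p =
      ev (∑ l, K.dx l (K.biv i j) * ∑ k, K.biv l k * w k d) p := by
    rw [evalForm, P.bracket_eq_mvfderiv hφ hp hα hβ,
      ← sum_coordField_smul hφ hp (mvfderiv (𝓡 n) (P.bivCoord φ i j) p.1), map_sum, ev_sum _ _ hp]
    refine sum_congr rfl fun l _ => ?_
    rw [map_smul, smul_eq_mul, hev l d p hp, ev_mul _ _ hp, hK]
    congr 1
    exact (ev_dx_ofBase hφ (fun _ hx => P.contMDiffAt_bivCoord hφ hx i j) l hp).symm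
  -- The bracket does not depend on the Hamiltonian field, so the local `v^i` may replace the
  -- globally chosen one at `p`.
  have h4 : omegaBracket P (evalForm U fun y => α y) (evalForm U fun y => β y) d p =
      ev (K.shiftedVert (z i) (fun e => ∑ k, K.biv j k * w k e) d) p := by
    rw [omegaBracket_eq_sum (hpot.exists_isHamiltonianField α) (hU.isHamiltonianAt hφ hp _)
      (hU.isHamiltonianAt hφ hp _), ConnectionAlgebra.shiftedVert, ev_sum _ _ hp]
    refine sum_congr rfl fun ab _ => ?_
    rw [fibreDeriv_of_ev hp (hnear j β hβ (ab.2 + 1)).self_of_nhds, ev_sum _ _ hp]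
    refine sum_congr rfl fun s _ => ?_
    rw [potentialField_coordField hφ hp, hα.self_of_nhds, ev_mul _ _ hp, hz i s ab.1 p hp, hK]
    simp only [coordForm_coordField hφ _ _ hp, ite_mul, one_mul, zero_mul, sum_ite_eq, mem_univ,
      if_true]
    rfl
  have key := hfund α β d p
  rw [barQ_eq hφ hassoc htors hp hα hβ, h1, h2, h3, h4, ← hK] at key
  rw [← key, pullback, hα.self_of_nhds, hβ.self_of_nhds, PoissonStructure.bivCoord]

/-- The formal chart given by a chart of the manifold with local potentials. -/
def formalChart (hφ : φ ∈ IsManifold.maximalAtlas (𝓡 n) ∞ M)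
    (hassoc : ContravariantConnection.Associated D D') (htors : D'.TorsionFree)
    (hpot : HasLocalPotentials P U) (hfund : FundamentalEquation D U)
    (hU : IsLocalPotential P U φ u v) : FormalChart n (ChartFun φ) where
  toConnectionAlgebra := connectionAlgebra hφ hassoc htors
  deg := homogeneous φ.target
  mul_mem := mul_mem_homogeneous
  ξ_mem i := (mem_homogeneous_iff hφ).2 fun x hx ξ t => by
    have h := ev_fibreCoord (φ := φ) i (p := ⟨x, t • ξ⟩) hx
    have h' := ev_fibreCoord (φ := φ) i (p := ⟨x, ξ⟩) hx
    refine h.trans (Eq.trans ?_ (congrArg _ h'.symm))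
    simp
  biv_mem i j := ofBase_mem_homogeneous hφ fun _ hx => P.contMDiffAt_bivCoord hφ hx i j
  dx_mem i h := deriv_base_mem_homogeneous φ.open_target h _
  dξ_mem i h := deriv_fibre_mem_homogeneous φ.open_target h _
  euler {k a} h := eq_of_ev hφ fun p hp => by
    have h1 := euler_homogeneous φ.open_target h (φ.map_source hp) (coords φ p).2
    have h2 := fderiv_ext_apply a hp 0 (coords φ p).2
    refine Eq.trans ?_ (SmoothFun.ext_smul (k : ℝ) a (coords_mem hp)).symm
    refine Eq.trans ?_ h1
    refine Eq.trans ?_ h2.symm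
    simp only [PiLp.zero_apply, zero_mul, sum_const_zero, zero_add]
    refine (ev_sum _ _ hp).trans (sum_congr rfl fun i _ => (ev_mul _ _ hp).trans ?_)
    exact congrArg (· * _) (ev_fibreCoord i hp)
  Γ' i j k := ofBase hφ (D'.christoffel φ i j k) fun _ hx => D'.contMDiffAt_christoffel hφ hx i j k
  Γ'_mem i j k := ofBase_mem_homogeneous hφ _
  assoc i j l := eq_of_ev hφ fun p hp => by
    simp only [ev_sum _ _ hp, ev_mul _ _ hp, ev_Γ hφ hassoc htors hp, ev_biv hφ hassoc htors hp,
      ev_ofBase hφ _ hp]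
    exact hassoc.coord hφ hp i j l
  u s d := ofBundle hφ (u s d) (hU.formal_u s d).1
  v i s d := ofBundle hφ (v i s d) (hU.formal_v i s d).1
  u_mem s d := (mem_homogeneous_iff hφ).2 fun x hx ξ t => by
    rw [ev_ofBundle hφ _ (p := ⟨x, _⟩) hx, ev_ofBundle hφ _ (p := ⟨x, _⟩) hx]
    exact (hU.formal_u s d).2 x hx ξ t
  u_zero s := eq_of_ev hφ fun p hp => by
    rw [ev_ofBundle hφ _ hp, ev_zero hp]
    exact hU.u_zero s p.1 hp p.2
  v_zero i s := eq_of_ev hφ fun p hp => by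
    rw [ev_ofBundle hφ _ hp]
    refine (hU.v_zero i s p.1 hp p.2).trans ?_
    split_ifs
    · exact (ev_one hp).symm
    · exact (ev_zero hp).symm
  compatible i j d := eq_of_ev hφ fun p hp => by
    simp only [ev_sum _ _ hp, ev_mul _ _ hp, ev_biv hφ hassoc htors hp, ev_ofBundle hφ _ hp]
    refine (hU.compatible i j p.1 hp p.2 d).trans (sum_congr rfl fun s _ => congrArg _ ?_)
    exact fibreDeriv_coordForm hφ hp (fun q hq => (ev_ofBundle hφ _ hq).symm) i
  fundamental i j d := eq_of_ev hφ fun p hp => by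
    have h := fundamental_coord hφ hassoc htors hpot hfund hU hp i j d rfl
      (fun s d q hq => ev_ofBundle hφ (hU.formal_u s d).1 hq)
      (fun i s d q hq => ev_ofBundle hφ (hU.formal_v i s d).1 hq)
    rw [ev_add _ _ hp, ev_add _ _ hp, ev_add _ _ hp, ev_sub _ _ hp]
    refine Eq.trans ?_ (h.trans ?_)
    · split_ifs
      · exact ev_biv hφ hassoc htors hp i j
      · exact ev_zero hp
    · congr 4
      split_ifs
      · rfl
      · exact (ev_zero hp).symm

end ChartFun

end

/-! ### Existence of lifts over a chart. -/

section

variable {n : ℕ} {M : Type*} [TopologicalSpace M] [ChartedSpace (EuclideanSpace ℝ (Fin n)) M]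
  [IsManifold (𝓡 n) ∞ M] {P : PoissonStructure n M}
  {U : ℕ → ∀ p : CotangentBundle n M, CotangentSpace n p.1 →ₗ[ℝ] ℝ}

/-- The equation `∇^α F = {U(α), F}_Ω` at the point `p`, in terms of Hamiltonian vectors of `U(α)`
at `p`. -/
def SolvesAt (D : ContravariantConnection P)
    (U : ℕ → ∀ p : CotangentBundle n M, CotangentSpace n p.1 →ₗ[ℝ] ℝ)
    (F : ℕ → CotangentBundle n M → ℝ) (p : CotangentBundle n M) : Prop :=
  ∀ (α : ∀ x : M, CotangentSpace n x) (V : ℕ → CotangentSpace n p.1),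
    IsHamiltonianAt P (evalForm U α) p V → ∀ k,
      D.bar α (F k) p = ∑ ij ∈ antidiagonal k, fibreDeriv (F (ij.2 + 1)) p (V ij.1)

/-- A formal function near `W` with a Hamiltonian vector field that solves the lifting equation. -/
structure IsLiftOn (D : ContravariantConnection P)
    (U : ℕ → ∀ p : CotangentBundle n M, CotangentSpace n p.1 →ₗ[ℝ] ℝ) (f : M → ℝ) (W : Set M)
    (F : ℕ → CotangentBundle n M → ℝ) (H : ℕ → ∀ p : CotangentBundle n M, CotangentSpace n p.1) :
    Prop where
  formal : IsFormalOn W F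
  formal_field : ∀ X : VField n M, IsFormalOn W (fun k p => H k p (X p.1))
  isHamiltonianAt : ∀ p : CotangentBundle n M, p.1 ∈ W → IsHamiltonianAt P F p fun k => H k p
  solvesAt : ∀ p : CotangentBundle n M, p.1 ∈ W → SolvesAt D U F p
  initial : ∀ x ∈ W, F 0 ⟨x, 0⟩ = f x

variable [T2Space M] [SigmaCompactSpace M]
  {φ : OpenPartialHomeomorph M (EuclideanSpace ℝ (Fin n))}
  {u : Fin n → ℕ → CotangentBundle n M → ℝ} {v : Fin n → Fin n → ℕ → CotangentBundle n M → ℝ}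
  {D D' : ContravariantConnection P}

open ChartFun in
/-- Formal lifts exist in charts with local potentials. -/
theorem IsLocalPotential.exists_isLiftOn (hU : IsLocalPotential P U φ u v)
    (hφ : φ ∈ IsManifold.maximalAtlas (𝓡 n) ∞ M)
    (hassoc : ContravariantConnection.Associated D D') (htors : D'.TorsionFree)
    (hpot : HasLocalPotentials P U) (hfund : FundamentalEquation D U)
    {f : M → ℝ} (hf : ContMDiff (𝓡 n) 𝓘(ℝ, ℝ) ∞ f) :
    ∃ F H, IsLiftOn D U f φ.source F H := by
  let L := formalChart hφ hassoc htors hpot hfund hU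
  have hfx : ∀ x ∈ φ.source, ContMDiffAt (𝓡 n) 𝓘(ℝ, ℝ) ∞ f x := fun x _ => hf.contMDiffAt
  let f₀ : ChartFun φ := ofBase hφ f hfx
  have hf₀ : f₀ ∈ L.deg 0 := ofBase_mem_homogeneous hφ hfx
  have hdf₀ : ∀ a, L.dξ a f₀ = 0 := fun a => dξ_ofBase hφ hfx a
  let F : ℕ → CotangentBundle n M → ℝ := fun k => ev (L.liftFun f₀ k)
  let H : ℕ → ∀ p : CotangentBundle n M, CotangentSpace n p.1 := fun k p =>
    ∑ m, ev (L.liftField f₀ k m) p • coordForm φ m p.1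
  have hproj : ∀ p : CotangentBundle n M,
      ContMDiffAt ((𝓡 n).prod 𝓘(ℝ, EuclideanSpace ℝ (Fin n) →L[ℝ] ℝ)) (𝓡 n) ∞
      (fun q : CotangentBundle n M => q.1) p := fun p => contMDiffAt_proj _
  have hdξ : ∀ (k : ℕ) (p : CotangentBundle n M), p.1 ∈ φ.source → ∀ η : CotangentSpace n p.1,
      fibreDeriv (F k) p η = ∑ s, η (coordField φ s p.1) * ev (L.dξ s (L.liftFun f₀ k)) p :=
    fun k p hp η => fibreDeriv_of_ev hp (fun _ => rfl) η
  have hHam : ∀ p : CotangentBundle n M, p.1 ∈ φ.source → IsHamiltonianAt P F p fun k => H k p := by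
    intro p hp k η
    rw [hdξ _ p hp, PoissonStructure.biv, map_eq_sum_coordField hφ hp η, ← sum_neg_distrib]
    refine sum_congr rfl fun a _ => ?_
    have h2 : coordForm φ a p.1 (P.sharp p.1 (H k p)) =
        - ev (L.dξ a (L.liftFun f₀ (k + 1))) p := by
      rw [P.skew, P.apply_sharp_coordForm hφ hp, L.dξ_liftFun hf₀ hdf₀, ev_sum _ _ hp]
      refine congrArg _ (sum_congr rfl fun m _ => ?_)
      rw [ev_mul _ _ hp, show ev (L.biv a m) p = _ from ev_biv hφ hassoc htors hp a m]
      simp [H, coordForm_coordField hφ _ _ hp]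
    rw [h2]
    ring
  refine ⟨F, H, ⟨fun k => ⟨fun p hp => (contMDiffAt_ev hφ _ hp).contMDiffWithinAt,
    (mem_homogeneous_iff hφ).1 (L.liftFun_mem hf₀ k)⟩, fun X k => ⟨fun p hp => ?_,
    fun x hx ξ t => ?_⟩, fun p hp k η => ?_, fun p hp α V hV k => ?_, fun x hx => ?_⟩⟩
  · have h : (fun p : CotangentBundle n M => H k p (X p.1)) =
        fun p => ∑ m, ev (L.liftField f₀ k m) p * coordForm φ m p.1 (X p.1) := by
      funext p
      simp [H]
    dsimp only
    rw [h]
    refine ContMDiffWithinAt.sum fun m _ =>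
      ((contMDiffAt_ev hφ _ hp).mul ?_).contMDiffWithinAt
    exact (contMDiffAt_pairing (b := fun y : M => y) (contMDiffAt_coordForm hφ m hp)
        X.contMDiff.contMDiffAt).comp p (hproj p)
  · have h := fun m => (mem_homogeneous_iff hφ).1 (L.liftField_mem hf₀ k m) x hx ξ t
    simp only [H, _root_.sum_apply, smul_apply, smul_eq_mul, h, mul_sum, mul_assoc]
  · exact hHam p hp k η
  -- Any Hamiltonian vectors of `U(α)` may be exchanged for `α_i v^i`, because the lift itself is
  -- Hamiltonian.
  · rw [hV.sum_fibreDeriv_eq (hU.isHamiltonianAt hφ hp α) (hHam p hp)]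
    · rw [bar_eq_sum_nab hφ hassoc htors hp (f := L.liftFun f₀ k)
        (Filter.Eventually.of_forall fun _ _ => rfl) α]
      have h : ∀ i, ev ((connectionAlgebra hφ hassoc htors).nab i (L.liftFun f₀ k)) p =
          ∑ ab ∈ antidiagonal k, ∑ s, v i s ab.1 p * ev (L.dξ s (L.liftFun f₀ (ab.2 + 1))) p := by
        intro i
        refine (congrArg (fun g => ev g p) (L.nab_liftFun hf₀ hdf₀ i k)).trans ?_
        rw [ConnectionAlgebra.shiftedVert, ev_sum _ _ hp]
        refine sum_congr rfl fun ab _ => ?_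
        rw [ev_sum _ _ hp]
        refine sum_congr rfl fun s _ => ?_
        rw [ev_mul _ _ hp]
        exact congrArg (· * _) (ev_ofBundle hφ (hU.formal_v i s ab.1).1 hp)
      simp only [h, hdξ _ p hp, potentialField_coordField hφ hp, mul_sum, sum_mul]
      rw [sum_comm]
      refine sum_congr rfl fun ab _ => ?_
      rw [sum_comm]
      exact sum_congr rfl fun s _ => sum_congr rfl fun i _ => (mul_assoc _ _ _).symm
  · exact ev_ofBase hφ hfx (p := ⟨x, 0⟩) hx

end

/-! ### Uniqueness, and passage to global lifts. -/

section

variable {n : ℕ} {M : Type*} [TopologicalSpace M] [ChartedSpace (EuclideanSpace ℝ (Fin n)) M]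

theorem fibreDeriv_congr {g g' : CotangentBundle n M → ℝ} {p : CotangentBundle n M}
    (h : ∀ ζ : CotangentSpace n p.1, g ⟨p.1, ζ⟩ = g' ⟨p.1, ζ⟩) (η : CotangentSpace n p.1) :
    fibreDeriv g p η = fibreDeriv g' p η := by
  simp only [fibreDeriv, h]

/-- Euler's identity. -/
theorem fibreDeriv_self {g : CotangentBundle n M → ℝ} {p : CotangentBundle n M} {k : ℕ}
    (h : ∀ t : ℝ, g ⟨p.1, t • p.2⟩ = t ^ k * g p) : fibreDeriv g p p.2 = k * g p := by
  have h1 : ∀ t : ℝ, g ⟨p.1, p.2 + t • p.2⟩ = (1 + t) ^ k * g p := fun t => by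
    rw [← h, add_smul, one_smul]
  have h2 : HasDerivAt (fun t : ℝ => (1 + t) ^ k * g p) (k * g p) 0 := by
    simpa using (((hasDerivAt_id (0 : ℝ)).const_add 1).pow k).mul_const (g p)
  rw [fibreDeriv, lineDeriv, funext h1, h2.deriv]

variable [IsManifold (𝓡 n) ∞ M] {P : PoissonStructure n M}
  {U : ℕ → ∀ p : CotangentBundle n M, CotangentSpace n p.1 →ₗ[ℝ] ℝ}
  {D D' : ContravariantConnection P}

theorem IsFormalOn.mono {W W' : Set M} {F : ℕ → CotangentBundle n M → ℝ} (hF : IsFormalOn W F)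
    (h : W' ⊆ W) : IsFormalOn W' F :=
  fun k => ⟨(hF k).1.mono fun _ hp => h hp, fun x hx => (hF k).2 x (h hx)⟩

theorem ContravariantConnection.bar_congr {α α' : ∀ x : M, CotangentSpace n x}
    {g g' : CotangentBundle n M → ℝ} {p : CotangentBundle n M} (hα : α p.1 = α' p.1)
    (h : ∀ᶠ y in 𝓝 p.1, ∀ ζ : CotangentSpace n y, g ⟨y, ζ⟩ = g' ⟨y, ζ⟩) :
    D.bar α g p = D.bar α' g' p := by
  rw [bar, bar, hα, mvfderiv_congr (h.mono fun y hy => hy _), fibreDeriv_congr h.self_of_nhds]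

theorem IsHamiltonianAt.congr {F F' : ℕ → CotangentBundle n M → ℝ} {p : CotangentBundle n M}
    {V : ℕ → CotangentSpace n p.1} (hV : IsHamiltonianAt P F p V)
    (h : ∀ (k : ℕ) (ζ : CotangentSpace n p.1), F k ⟨p.1, ζ⟩ = F' k ⟨p.1, ζ⟩) :
    IsHamiltonianAt P F' p V := fun k η => by
  rw [hV k η, fibreDeriv_congr (h (k + 1))]

theorem SolvesAt.congr {F F' : ℕ → CotangentBundle n M → ℝ} {p : CotangentBundle n M}
    (hF : SolvesAt D U F p)
    (h : ∀ᶠ y in 𝓝 p.1, ∀ (k : ℕ) (ζ : CotangentSpace n y), F k ⟨y, ζ⟩ = F' k ⟨y, ζ⟩) :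
    SolvesAt D U F' p := fun α V hV k => by
  have h1 := hF α V hV k
  rw [D.bar_congr rfl (h.mono fun y hy => hy k)] at h1
  rw [h1]
  exact sum_congr rfl fun ij _ => fibreDeriv_congr (h.self_of_nhds (ij.2 + 1)) _

/-- Solutions of the lifting equation are determined by their restriction to the zero section. -/
theorem SolvesAt.unique [T2Space M] (hpot : HasLocalPotentials P U) {W : Set M} (hW : IsOpen W)
    {F F' : ℕ → CotangentBundle n M → ℝ} (hF : IsFormalOn W F) (hF' : IsFormalOn W F')
    (hs : ∀ p : CotangentBundle n M, p.1 ∈ W → SolvesAt D U F p)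
    (hs' : ∀ p : CotangentBundle n M, p.1 ∈ W → SolvesAt D U F' p)
    (h0 : ∀ x ∈ W, F 0 ⟨x, 0⟩ = F' 0 ⟨x, 0⟩) (k : ℕ) :
    ∀ p : CotangentBundle n M, p.1 ∈ W → F k p = F' k p := by
  induction k using Nat.strong_induction_on with
  | _ k ih =>
  rintro ⟨x, ξ⟩ hx
  cases k with
  | zero =>
    -- Degree zero means constant on fibres; scaling by `0` reduces to the zero section.
    have h1 := (hF 0).2 x hx ξ 0
    have h2 := (hF' 0).2 x hx ξ 0
    rw [zero_smul, pow_zero, one_mul] at h1 h2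
    rw [← h1, ← h2, h0 x hx]
  | succ k =>
    obtain ⟨φ, hφ, hxφ, u, v, hU⟩ := hpot x
    -- With `α x = ξ` the leading Hamiltonian vector is `ξ` itself. The top term of the equation is
    -- then the Euler derivative `(k+1) F_{k+1}`, and all other terms involve components already
    -- known to agree.
    obtain ⟨α, hα⟩ := exists_oneForm_apply_eq ξ
    let p : CotangentBundle n M := ⟨x, ξ⟩
    have hV := hU.isHamiltonianAt hφ (p := p) hxφ fun y => α y
    have hV0 : potentialField φ v (fun y => α y) 0 p = ξ :=
      (hU.potentialField_zero hφ (p := p) hxφ _).trans hα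
    have hb : D.bar (fun y => α y) (F k) p = D.bar (fun y => α y) (F' k) p :=
      D.bar_congr rfl (Filter.mem_of_superset (hW.mem_nhds hx)
        fun y hy ζ => ih k k.lt_succ_self ⟨y, ζ⟩ hy)
    rw [hs p hx _ _ hV, hs' p hx _ _ hV, ← sub_eq_zero, ← sum_sub_distrib,
      sum_eq_single (0, k)] at hb
    · dsimp only at hb
      rw [hV0, fibreDeriv_self (p := p) fun t => (hF (k + 1)).2 x hx ξ t,
        fibreDeriv_self (p := p) fun t => (hF' (k + 1)).2 x hx ξ t, ← mul_sub] at hb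
      have hk : ((k + 1 : ℕ) : ℝ) ≠ 0 := Nat.cast_ne_zero.2 k.succ_ne_zero
      exact sub_eq_zero.1 ((mul_eq_zero.1 hb).resolve_left hk)
    · rintro ⟨i, j⟩ hij hne
      rw [HasAntidiagonal.mem_antidiagonal] at hij
      have hj : j + 1 < k + 1 := by
        rcases Nat.eq_zero_or_pos i with hi | hi
        · exact absurd (Prod.ext hi (by simpa [hi] using hij)) hne
        · dsimp only at hij; omega
      rw [sub_eq_zero]
      exact fibreDeriv_congr (fun ζ => ih (j + 1) hj ⟨x, ζ⟩ hx) _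
    · intro h
      exact absurd (HasAntidiagonal.mem_antidiagonal.2 (zero_add k)) h

variable [T2Space M] [SigmaCompactSpace M]

/-- Formal lifts exist globally. -/
theorem exists_isLiftOn_univ
    (hassoc : ContravariantConnection.Associated D D') (htors : D'.TorsionFree)
    (hpot : HasLocalPotentials P U) (hfund : FundamentalEquation D U)
    {f : M → ℝ} (hf : ContMDiff (𝓡 n) 𝓘(ℝ, ℝ) ∞ f) :
    ∃ F H, IsLiftOn D U f Set.univ F H := by
  have hloc : ∀ x : M, ∃ W : Set M, IsOpen W ∧ x ∈ W ∧ ∃ F H, IsLiftOn D U f W F H := fun x => by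
    obtain ⟨φ, hφ, hx, u, v, hU⟩ := hpot x
    exact ⟨φ.source, φ.open_source, hx, hU.exists_isLiftOn hφ hassoc htors hpot hfund hf⟩
  choose W hW hxW F₀ H₀ hlift using hloc
  -- Each point uses the local lift attached to its own base point. Uniqueness on `W x ∩ W p.1`
  -- makes this agree with every local lift on its domain, hence smooth.
  let F : ℕ → CotangentBundle n M → ℝ := fun k p => F₀ p.1 k p
  have hF : ∀ (x : M) (k : ℕ) (p : CotangentBundle n M), p.1 ∈ W x → F₀ x k p = F k p :=
    fun x k p hp => SolvesAt.unique hpot ((hW x).inter (hW p.1))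
      ((hlift x).formal.mono Set.inter_subset_left)
      ((hlift p.1).formal.mono Set.inter_subset_right)
      (fun q hq => (hlift x).solvesAt q hq.1) (fun q hq => (hlift p.1).solvesAt q hq.2)
      (fun y hy => ((hlift x).initial y hy.1).trans ((hlift p.1).initial y hy.2).symm) k p
      ⟨hp, hxW p.1⟩
  have hproj : Continuous (fun q : CotangentBundle n M => q.1) :=
    FiberBundle.continuous_proj _ _
  have hformal : IsFormalOn Set.univ F := fun k => by
    refine ⟨fun p _ => ContMDiffAt.contMDiffWithinAt ?_, fun x _ ξ t => ?_⟩
    · have hmem : {q : CotangentBundle n M | q.1 ∈ W p.1} ∈ 𝓝 p :=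
        ((hW p.1).preimage hproj).mem_nhds (hxW p.1)
      exact (((hlift p.1).formal k).1.contMDiffAt hmem).congr_of_eventuallyEq
        (Filter.mem_of_superset hmem fun q hq => (hF p.1 k q hq).symm)
    · exact ((hlift x).formal k).2 x (hxW x) ξ t
  -- The local fields need not agree on overlaps, since `π` may be degenerate; they are averaged
  -- instead.
  obtain ⟨H, hH⟩ := exists_isHamiltonianField (P := P) (F := F) fun x =>
    ⟨W x, hW x, hxW x, H₀ x, (hlift x).formal_field, fun p hp =>
      ((hlift x).isHamiltonianAt p hp).congr fun k ζ => hF x k ⟨p.1, ζ⟩ hp⟩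
  refine ⟨F, H, hformal, hH.1, fun p _ k η => hH.2 k p η, fun p _ => ?_, fun x _ => ?_⟩
  · exact ((hlift p.1).solvesAt p (hxW p.1)).congr
      (Filter.mem_of_superset ((hW p.1).mem_nhds (hxW p.1)) fun y hy k ζ => hF p.1 k ⟨y, ζ⟩ hy)
  · exact (hlift x).initial x (hxW x)

/-- Both sides at `p` depend on `α` only through its value at the base point, and the bracket does
not depend on the Hamiltonian field. The equation for smooth 1-forms therefore implies its pointwise
form. -/
theorem solvesAt_of_bar_eq_omegaBracket (hpot : HasLocalPotentials P U)
    {F : ℕ → CotangentBundle n M → ℝ} (hF : IsHamiltonian P F)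
    (heq : ∀ (α : OneForm n M) (k : ℕ) (p : CotangentBundle n M),
      D.bar (fun y => α y) (F k) p = omegaBracket P (evalForm U fun y => α y) F k p)
    (p : CotangentBundle n M) : SolvesAt D U F p := fun α V hV k => by
  obtain ⟨H, hH⟩ := hF.2
  obtain ⟨β, hβ⟩ := exists_oneForm_apply_eq (α p.1)
  have hV' : IsHamiltonianAt P (evalForm U fun y => β y) p V :=
    hV.congr fun k ζ => by simp only [evalForm, hβ]
  rw [D.bar_congr (α' := fun y => β y) hβ.symm (Filter.Eventually.of_forall fun _ _ => rfl),
    heq β k p, omegaBracket_eq_sum (hpot.exists_isHamiltonianField β) hV' fun k η => hH.2 k p η]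

theorem IsLiftOn.bar_eq_omegaBracket (hpot : HasLocalPotentials P U) {f : M → ℝ}
    {F : ℕ → CotangentBundle n M → ℝ} {H : ℕ → ∀ p : CotangentBundle n M, CotangentSpace n p.1}
    (hF : IsLiftOn D U f Set.univ F H) (α : OneForm n M) (k : ℕ) (p : CotangentBundle n M) :
    D.bar (fun y => α y) (F k) p = omegaBracket P (evalForm U fun y => α y) F k p := by
  obtain ⟨φ, hφ, hx, u, v, hU⟩ := hpot p.1
  have hV := hU.isHamiltonianAt hφ hx fun y => α y
  rw [omegaBracket_eq_sum (hpot.exists_isHamiltonianField α) hV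
    (hF.isHamiltonianAt p (Set.mem_univ _))]
  exact hF.solvesAt p (Set.mem_univ _) _ _ hV k

end

end FormalLift

end

theorem theoremT {n : ℕ} {M : Type*} [TopologicalSpace M] [T2Space M] [SigmaCompactSpace M]
    [ChartedSpace (EuclideanSpace ℝ (Fin n)) M] [IsManifold (𝓡 n) ∞ M]
    (P : FormalLift.PoissonStructure n M)
    (D D' : FormalLift.ContravariantConnection P)
    (hassoc : FormalLift.ContravariantConnection.Associated D D')
    (htors : D'.TorsionFree)
    (U : ℕ → ∀ p : FormalLift.CotangentBundle n M, FormalLift.CotangentSpace n p.1 →ₗ[ℝ] ℝ)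
    (hU : FormalLift.IsVerticalOneForm U)
    (hpot : FormalLift.HasLocalPotentials P U)
    (hfund : FormalLift.FundamentalEquation D U)
    (f : M → ℝ) (hf : ContMDiff (𝓡 n) 𝓘(ℝ, ℝ) ∞ f) :
    ∃! F : ℕ → FormalLift.CotangentBundle n M → ℝ,
      FormalLift.IsHamiltonian P F ∧
      (∀ (α : FormalLift.OneForm n M) (k : ℕ) (p : FormalLift.CotangentBundle n M),
        D.bar (fun y => α y) (F k) p =
          FormalLift.omegaBracket P (FormalLift.evalForm U (fun y => α y)) F k p) ∧
      ∀ x : M, F 0 ⟨x, 0⟩ = f x := by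
  obtain ⟨F, H, hF⟩ := FormalLift.exists_isLiftOn_univ hassoc htors hpot hfund hf
  refine ⟨F, ⟨⟨hF.formal, H, hF.formal_field, fun k p η => hF.isHamiltonianAt p trivial k η⟩,
    hF.bar_eq_omegaBracket hpot, fun x => hF.initial x trivial⟩, ?_⟩
  rintro G ⟨hG, hGeq, hG0⟩
  refine funext fun k => funext fun p => ?_
  exact FormalLift.SolvesAt.unique hpot isOpen_univ hG.1 hF.formal
    (fun q _ => FormalLift.solvesAt_of_bar_eq_omegaBracket hpot hG hGeq q) hF.solvesAt
    (fun x hx => (hG0 x).trans (hF.initial x hx).symm) k p trivial
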